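/- Let $\mu\ge 1$. Let $\nu_i=(1,i)$ $(0\le i\le \mu+1)$ be the generators of the fan of $\widehat{\mathbf C^2/\mathbf Z_{\mu+1}}$, let $\mathcal L=\{l\in\mathbf Z^{\mu+2}:\sum_i l_i\nu_i=0\}$, and consider the GKZ system in the variables $a=(a_0,\dots,a_{\mu+1})$, $$\Big(\tfrac{\partial}{\partial a}\Big)^{l^+}f=\Big(\tfrac{\partial}{\partial a}\Big)^{l^-}f\quad(l=l^+-l^-\in\mathcal L),\qquad \sum_i a_i\tfrac{\partial f}{\partial a_i}=0,\qquad \sum_i i\,a_i\tfrac{\partial f}{\partial a_i}=0 .$$ Let $D$ be the set of $a\in(\mathbf C^*)^{\mu+2}$ for which $\sum_i a_iW^i$ has no multiple root, let $x_k=a_{k-1}a_{k+1}/a_k^2$ $(1\le k\le\mu)$, and let $U\subset(\mathbf C^*)^\mu$ be the image of $D$ under $a\mapsto x(a)=(x_1,\dots,x_\mu)$. For $q=(q_1,\dots,q_\mu)$ put $\lambda_0=1$, $\lambda_j=q_1\cdots q_j$. The mirror map $q\mapsto x(q)$ is given by the same formula for $x_k$, with $a_i=a_i(q)$ defined by $\sum_i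 a_i(q)W^i=\prod_{j=0}^{\mu}(1+\lambda_jW)$. Let $V$ be the set of $q\in(\mathbf C^*)^\mu$ such that $\lambda_0,\dots,\lambda_\mu$ are distinct and all $a_i(q)$ are nonzero. The symmetric group $S_{\mu+1}$ of $\{0,\dots,\mu\}$ acts on $q$ by $(\sigma q)_k=\lambda_{\sigma^{-1}(k)}/\lambda_{\sigma^{-1}(k-1)}$, and linearly on $w\in\mathbf C^\mu$ by $(\sigma w)_k=s_{\sigma^{-1}(k)}-s_{\sigma^{-1}(k-1)}$, where $s_j=w_1+\dots+w_j$. Let $l^{(k)}\in\mathcal L$ have entries $1,-2,1$ at $k-1,k,k+1$ and $0$ elsewhere, let $c(\rho)=\prod_{i=0}^{\mu+1}\Gamma\big(1+\sum_k\rho_kl^{(k)}_i\big)^{-1}$, and let $$w_k(x)=\frac1{2\pi i}\sum_{n\in\mathbf N^\mu}\frac{\partial}{\partial\rho_k}\Big(c(n+\rho)\,x^{n+\rho}\Big)\Big|_{\rho=0}\qquad(1\le k\le\mu)$$ be the hypergeometric series (the coefficient of $J_k$ in $w(x;\frac J{2\pi i})=1+\sum_kw_kJ_k$), with principal logarithms.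 The mirror coordinates are $q_k=e^{2\pi iw_k}$. Write $e(w)=(e^{2\pi i w_1},\dots,e^{2\pi i w_\mu})$. By a mirror branch at $x_0$ we mean a germ $W$ of a holomorphic $\mathbf C^\mu$-valued map at $x_0$ such that, for $x$ near $x_0$, $e(W(x))$ lies in $V$ and is sent to $x$ by the mirror map. **Proposition 3.2.** 1. $S_{\mu+1}$ acts freely on $V$, and $V$ is path connected. The mirror map restricts to a surjective covering map $V\to U$ whose fibres are exactly the $S_{\mu+1}$-orbits. For every $q\in V$ there is a mirror branch $W$ at $x(q)$ with $e(W(x(q)))=q$. 2. Let $a\in D$ and let $W$ be a mirror branch at $x(a)$. A function $f$ is a holomorphic solution of the GKZ system near $a$ if and only if, near $a$, $f=c_0+\sum_kc_kW_k(x(\cdot))$ for unique $c_0,\dots,c_\mu\in\mathbf C$. So the solutions are exactly the linear combinations of $1,\log q_1,\dots,\log q_\mu$. 3. There is $\varepsilon>0$ such that for all $x_0$ with $0<|x_{0,k}|<\varepsilon$ for every $k$: $x_0\in U$, the series $w_k(x_0)$ converge absolutely, $e(w(x_0))\in V$, and the mirror map sends $e(w(x_0))$ to $x_0$. If moreover no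 $x_{0,k}$ is a negative real number, then $w=(w_1,\dots,w_\mu)$ is a mirror branch at $x_0$, and: - $w$ can be continued analytically along every path in $U$ from $x_0$, and every germ of the continuation is a mirror branch; - continuation along a loop in $U$ based at $x_0$ changes $w$ into $\sigma w+n$ for a unique pair $(\sigma,n)\in S_{\mu+1}\times\mathbf Z^\mu$; it changes $w$ by a shift $w\mapsto w+n$, $n\in\mathbf Z^\mu$, if and only if the loop lifts through the mirror map to a loop in $V$ based at $e(w(x_0))$; - every pair $(\sigma,n)\in S_{\mu+1}\times\mathbf Z^\mu$ arises from some loop. So the mirror coordinates uniformize the solutions of the GKZ system up to the shifts $w_i\mapsto w_i+1$. 4. $e(\sigma w+n)=\sigma\, e(w)$ for all $w\in\mathbf C^\mu$, $\sigma\in S_{\mu+1}$, $n\in\mathbf Z^\mu$; so the residual monodromy on the mirror coordinates is the action of $S_{\mu+1}$. For $\mu=2$ the transpositions $r_1=(0\,1)$ and $r_2=(1\,2)$ act by $r_1:(q_1,q_2)\mapsto(1/q_1,\,q_1q_2)$ and $r_2:(q_1,q_2)\mapsto(q_1q_2,\,1/q_2)$, that is, $r_1:(w_1,w_2)\mapsto(-w_1,\,w_1+w_2)$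 and $r_2:(w_1,w_2)\mapsto(w_1+w_2,\,-w_2)$; they satisfy $r_1^2=r_2^2=(r_1r_2)^3=1$ and generate $S_3$. -/

import Mathlib

open Filter Topology

noncomputable section

namespace LocalMirror

/-! ### The GKZ system of the resolution of `ℂ² / ℤ_{μ+1}`

The variables are `a : Fin (μ + 2) → ℂ`, numbered from `0`, so that `a i` is the coefficient of
`W ^ i`, and the `i`-th integral generator of the fan is `ν i = (1, i)`. -/

/-- The integral generators `(1,0), (1,1), …, (1,μ+1)` of the one-dimensional cones. -/
def nu {μ : ℕ} (i : Fin (μ + 2)) : ℤ × ℤ := (1, (i : ℤ))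

/-- The lattice of relations among the generators. -/
def relationLattice (μ : ℕ) : Set (Fin (μ + 2) → ℤ) := {l | ∑ i, l i • nu i = 0}

/-- The partial derivative `∂f/∂a_i`. -/
def partialD {n : ℕ} (i : Fin n) (f : (Fin n → ℂ) → ℂ) : (Fin n → ℂ) → ℂ :=
  fun a => fderiv ℂ f a (Pi.single i 1)

/-- The iterated partial derivative `(∂/∂a)^m = ∏ i, (∂/∂a_i)^(m i)`. -/
def monomialD {n : ℕ} (m : Fin n → ℕ) (f : (Fin n → ℂ) → ℂ) : (Fin n → ℂ) → ℂ :=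
  (List.finRange n).foldr (fun i g => (partialD i)^[m i] g) f

/-- The box operator `(∂/∂a)^{l⁺} - (∂/∂a)^{l⁻}`, where `l = l⁺ - l⁻`. -/
def box {n : ℕ} (l : Fin n → ℤ) (f : (Fin n → ℂ) → ℂ) (a : Fin n → ℂ) : ℂ :=
  monomialD (fun i => (l i).toNat) f a - monomialD (fun i => (-l i).toNat) f a

/-- `f` is a holomorphic solution, near `a`, of the GKZ system: all box operators and the two
Euler operators `θ_0 + ⋯ + θ_{μ+1}` and `θ_1 + 2 θ_2 + ⋯ + (μ+1) θ_{μ+1}` annihilate it. -/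
def IsGKZSolutionAt {μ : ℕ} (f : (Fin (μ + 2) → ℂ) → ℂ) (a : Fin (μ + 2) → ℂ) : Prop :=
  AnalyticAt ℂ f a ∧ ∀ᶠ b in 𝓝 a,
    (∀ l ∈ relationLattice μ, box l f b = 0) ∧
    (∑ i : Fin (μ + 2), b i * partialD i f b = 0) ∧
    (∑ i : Fin (μ + 2), ((i : ℕ) : ℂ) * (b i * partialD i f b) = 0)

/-! ### The parameter space -/

/-- The polynomial `a_0 + a_1 W + ⋯ + a_{μ+1} W^{μ+1}`. -/
def fSigma {μ : ℕ} (a : Fin (μ + 2) → ℂ) : Polynomial ℂ :=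
  ∑ i, Polynomial.C (a i) * Polynomial.X ^ (i : ℕ)

/-- Points of the torus `(ℂ*)^{μ+2}` off the discriminant (the polynomial has no multiple root). -/
def regularLocus (μ : ℕ) : Set (Fin (μ + 2) → ℂ) :=
  {a | (∀ i, a i ≠ 0) ∧ (fSigma a).Separable}

/-- The coordinates `x_k = a_k a_{k+2} / a_{k+1}²` on `(ℂ*)^{μ+2} / (ℂ*)²`. -/
def xCoord {μ : ℕ} (a : Fin (μ + 2) → ℂ) (k : Fin μ) : ℂ :=
  a k.castSucc.castSucc * a k.succ.succ / a k.succ.castSucc ^ 2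

/-- The complement of the discriminant in the torus with coordinates `x_1, …, x_μ`. -/
def xSpace (μ : ℕ) : Set (Fin μ → ℂ) := xCoord '' regularLocus μ

/-! ### The hypergeometric series at the large complex structure limit -/

/-- The relations `l^{(k)} = (0, …, 0, 1, -2, 1, 0, …, 0)`. -/
def lVec {μ : ℕ} (k : Fin μ) (i : Fin (μ + 2)) : ℤ :=
  if (i : ℕ) = k then 1 else if (i : ℕ) = k + 1 then -2 else if (i : ℕ) = k + 2 then 1 else 0

/-- `c(ρ) = ∏ i, 1 / Γ(1 + ∑ k, ρ_k l^{(k)}_i)`. This is an entire function: Mathlib's `Γ` is `0`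
at the poles and `0⁻¹ = 0`. -/
def cCoeff {μ : ℕ} (ρ : Fin μ → ℂ) : ℂ :=
  ∏ i : Fin (μ + 2), (Complex.Gamma (1 + ∑ k, ρ k * (lVec k i : ℂ)))⁻¹

/-- The term `c(n + ρ) x^{n + ρ}` of the series `w(x; ρ) = ∑ n, c(n + ρ) x^{n + ρ}`. -/
def wTerm {μ : ℕ} (x ρ : Fin μ → ℂ) (n : Fin μ → ℕ) : ℂ :=
  cCoeff (fun k => (n k : ℂ) + ρ k) * ∏ k, x k ^ ((n k : ℂ) + ρ k)

/-- The derivative of the term with index `n` in the direction `ρ_k` at `ρ = 0`. -/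
def wTermD {μ : ℕ} (k : Fin μ) (x : Fin μ → ℂ) (n : Fin μ → ℕ) : ℂ :=
  deriv (fun s : ℂ => wTerm x (Pi.single k s) n) 0

/-- The series `w_k(x)`, i.e. the coefficient of `J_k` in the cohomology-valued series
`w(x; J / 2πi) = 1 + ∑ k, w_k(x) J_k` (the nilpotent classes are substituted term by term). The
logarithms of the `x_k` are the principal ones. -/
def w {μ : ℕ} (x : Fin μ → ℂ) : Fin μ → ℂ :=
  fun k => (2 * Real.pi * Complex.I)⁻¹ * ∑' n : Fin μ → ℕ, wTermD k x n

/-- `q_k = exp (2πi w_k)`. -/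
def expQ {μ : ℕ} (v : Fin μ → ℂ) : Fin μ → ℂ :=
  fun k => Complex.exp (2 * Real.pi * Complex.I * v k)

/-! ### The mirror map -/

/-- The coefficients of `(1 + W)(1 + q_1 W)(1 + q_1 q_2 W) ⋯ (1 + q_1 ⋯ q_μ W)`. -/
def qCoeff {μ : ℕ} (q : Fin μ → ℂ) (i : Fin (μ + 2)) : ℂ :=
  (∏ j : Fin (μ + 1), (1 + Polynomial.C (Fin.partialProd q j) * Polynomial.X)).coeff i

/-- The mirror map `q ↦ x(q)`. -/
def mirrorMap {μ : ℕ} (q : Fin μ → ℂ) : Fin μ → ℂ := xCoord (qCoeff q)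

/-- The `q` with nonzero coordinates that the mirror map sends to the torus off the discriminant:
the products `1, q_1, q_1 q_2, …, q_1 ⋯ q_μ` are distinct and the coefficients do not vanish. -/
def qSpace (μ : ℕ) : Set (Fin μ → ℂ) :=
  {q | (∀ k, q k ≠ 0) ∧ Function.Injective (Fin.partialProd q) ∧ ∀ i, qCoeff q i ≠ 0}

/-- The action of the symmetric group on `q` that permutes `1, q_1, q_1 q_2, …, q_1 ⋯ q_μ` up to
a common factor. -/
def permQ {μ : ℕ} (σ : Equiv.Perm (Fin (μ + 1))) (q : Fin μ → ℂ) : Fin μ → ℂ :=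
  fun k => Fin.partialProd q (σ⁻¹ k.succ) / Fin.partialProd q (σ⁻¹ k.castSucc)

/-- The linear action of the symmetric group on `w` that permutes
`0, w_1, w_1 + w_2, …, w_1 + ⋯ + w_μ` up to a common summand. -/
def permW {μ : ℕ} (σ : Equiv.Perm (Fin (μ + 1))) (v : Fin μ → ℂ) : Fin μ → ℂ :=
  fun k => Fin.partialSum v (σ⁻¹ k.succ) - Fin.partialSum v (σ⁻¹ k.castSucc)

/-- Near `x₀`, `W` is a holomorphic branch of `(2πi)⁻¹ log q`, for `q` a local inverse of the mirror
map. -/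
def IsMirrorBranchAt {μ : ℕ} (W : (Fin μ → ℂ) → Fin μ → ℂ) (x₀ : Fin μ → ℂ) : Prop :=
  AnalyticAt ℂ W x₀ ∧ ∀ᶠ x in 𝓝 x₀, expQ (W x) ∈ qSpace μ ∧ mirrorMap (expQ (W x)) = x

/-! ### Analytic continuation -/

/-- The germs of `F t` at `γ t` form an analytic continuation along the path `γ`. -/
def IsContinuationAlong {μ : ℕ} {x₀ x₁ : Fin μ → ℂ} (γ : Path x₀ x₁)
    (F : unitInterval → (Fin μ → ℂ) → Fin μ → ℂ) : Prop :=
  ∀ t, AnalyticAt ℂ (F t) (γ t) ∧ ∀ᶠ s in 𝓝 t, F s =ᶠ[𝓝 (γ s)] F t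

end LocalMirror

end

noncomputable section

namespace LocalMirror

variable {μ : ℕ}

/-! ### Root parameters -/

/-! Modulo the torus action a_i ↦ s t^i a_i, a regular a amounts to μ+1 distinct nonzero numbers r_j
with ∑ a_i W^i = a_0 ∏ (1 + r_j W), unordered and up to a common factor. Ordering them is the same
as giving q_k = r_k / r_{k-1}. So the fibres of the mirror map are the S_{μ+1}-orbits, and the
action is free because the λ_j are distinct and a_1 ≠ 0 (`eq_one_of_permQ_eq`). Simple roots depend
holomorphically on the coefficients, so local sections exist (`exists_local_section`), and a free
action of a finite group makes the mirror map a covering (`isCoveringMap_mirrorMap`). The preimage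
of V under e is the complement of the zeros of an entire function, hence path connected
(`joinedIn_expQ_mem_qSpace`). A path upstairs from W(x₀) to σW(x₀) + n pushes down to a loop with
monodromy (σ, n). Conversely, the end of a continuation lies over the same x₀, so it differs from W
by such a pair.

A root ρ of ∑ a_i W^i satisfies ∂_i ρ = ρ^i ∂_0 ρ. Hence (∂/∂a)^m log ρ, for m ≠ 0, depends only on
∑ m_i and ∑ i m_i (`monomialD_eq`), and the box operators annihilate log ρ. The Euler operators give
0 and -1, so differences of such logarithms are solutions. For the converse, the box equations leave
one second derivative for each index sum, and the differentiated Euler equations form a linear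
system for these that is solvable because ∑ a_i W^i and its Euler derivative are coprime
(`exists_bezout_X_pow`). A solution is therefore determined by its value and gradient
(`IsGKZSolutionAt.eq_zero`). The Euler equations cut the gradient down to μ parameters, and 1
together with the W_k realise all possible values and gradients (`isGKZSolutionAt_iff`).

Near the limit point, a_i(q) = λ_0⋯λ_{i-1} u_i(q) with u_i(0) = 1, so x_k = q_k u_{k-1} u_{k+1} /
u_k² is invertible at 0. After a rescaling of W that makes i of the roots large and the others
small, -log u_i is the constant term of the logarithm of the Laurent polynomial ∑ a_j W^j / (a_i
W^i) (`hasSum_logCoeff_unitFactor`). Expanding that logarithm multinomially, the constant terms are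
indexed by the relations whose only negative entry is the i-th (`hasSum_unitLogCoeff`), and their
coefficients are the derivatives of c(ρ), because 1/Γ has simple zeros at the nonpositive integers
(`wTermD_eq`). Thus 2πi w_k = log x_k - ∑_i l^{(k)}_i log u_i, and its exponential is q_k. -/

/-- The quotients of consecutive entries. -/
def ratio (r : Fin (μ + 1) → ℂ) : Fin μ → ℂ := fun k => r k.succ / r k.castSucc

/-- The polynomial `∏ j, (1 + r_j W)`. -/
def prodPoly (r : Fin (μ + 1) → ℂ) : Polynomial ℂ :=
  ∏ j : Fin (μ + 1), (1 + Polynomial.C (r j) * Polynomial.X)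

/-- The coefficients of `∏ j, (1 + r_j W)`. -/
def rootCoeff (r : Fin (μ + 1) → ℂ) (i : Fin (μ + 2)) : ℂ := (prodPoly r).coeff i

theorem qCoeff_eq (q : Fin μ → ℂ) : qCoeff q = rootCoeff (Fin.partialProd q) := rfl

theorem permQ_eq (σ : Equiv.Perm (Fin (μ + 1))) (q : Fin μ → ℂ) :
    permQ σ q = ratio (fun j => Fin.partialProd q (σ⁻¹ j)) := rfl

theorem partialProd_ne_zero {q : Fin μ → ℂ} (hq : ∀ k, q k ≠ 0) (j : Fin (μ + 1)) :
    Fin.partialProd q j ≠ 0 := by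
  induction j using Fin.induction with
  | zero => simp
  | succ i ih => rw [Fin.partialProd_succ]; exact mul_ne_zero ih (hq i)

theorem partialProd_ratio {r : Fin (μ + 1) → ℂ} (hr : ∀ j, r j ≠ 0) (j : Fin (μ + 1)) :
    Fin.partialProd (ratio r) j = r j / r 0 := by
  induction j using Fin.induction with
  | zero => simp [hr 0]
  | succ i ih =>
    rw [Fin.partialProd_succ, ih, ratio]
    have h1 := hr i.castSucc
    have h2 := hr 0
    field_simp

theorem ratio_partialProd {q : Fin μ → ℂ} (hq : ∀ k, q k ≠ 0) :
    ratio (Fin.partialProd q) = q := by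
  ext k
  rw [ratio, Fin.partialProd_succ]
  exact mul_div_cancel_left₀ _ (partialProd_ne_zero hq _)

theorem ratio_ne_zero {r : Fin (μ + 1) → ℂ} (hr : ∀ j, r j ≠ 0) (k : Fin μ) : ratio r k ≠ 0 :=
  div_ne_zero (hr _) (hr _)

theorem natDegree_prodPoly_le (r : Fin (μ + 1) → ℂ) : (prodPoly r).natDegree ≤ μ + 1 := by
  refine (Polynomial.natDegree_prod_le _ _).trans ?_
  refine (Finset.sum_le_card_nsmul _ _ 1 fun j _ => ?_).trans (by simp)
  refine (Polynomial.natDegree_add_le _ _).trans ?_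
  simp only [Polynomial.natDegree_one, zero_le, sup_of_le_right]
  exact (Polynomial.natDegree_C_mul_le _ _).trans Polynomial.natDegree_X_le

theorem eval_prodPoly (r : Fin (μ + 1) → ℂ) (z : ℂ) :
    (prodPoly r).eval z = ∏ j, (1 + r j * z) := by
  simp [prodPoly, Polynomial.eval_prod]

theorem coeff_fSigma (a : Fin (μ + 2) → ℂ) (i : Fin (μ + 2)) : (fSigma a).coeff i = a i := by
  simp only [fSigma, Polynomial.finsetSum_coeff, Polynomial.coeff_C_mul, Polynomial.coeff_X_pow]
  rw [Finset.sum_eq_single i]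
  · simp
  · intro j _ hj
    have : (i : ℕ) ≠ j := fun h => hj (Fin.ext h.symm)
    simp [this]
  · simp

theorem natDegree_fSigma_le (a : Fin (μ + 2) → ℂ) : (fSigma a).natDegree ≤ μ + 1 := by
  refine Polynomial.natDegree_sum_le_of_forall_le _ _ fun i _ => ?_
  exact (Polynomial.natDegree_C_mul_X_pow_le _ _).trans (by omega)

theorem eval_fSigma (a : Fin (μ + 2) → ℂ) (z : ℂ) :
    (fSigma a).eval z = ∑ i, a i * z ^ (i : ℕ) := by
  simp [fSigma, Polynomial.eval_finsetSum]

theorem fSigma_eq_of_coeff {a : Fin (μ + 2) → ℂ} {p : Polynomial ℂ} (hp : p.natDegree ≤ μ + 1)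
    (h : ∀ i : Fin (μ + 2), a i = p.coeff i) : fSigma a = p := by
  ext m
  by_cases hm : m < μ + 2
  · exact (coeff_fSigma a ⟨m, hm⟩).trans (h ⟨m, hm⟩)
  · rw [Polynomial.coeff_eq_zero_of_natDegree_lt (by have := natDegree_fSigma_le a; omega),
      Polynomial.coeff_eq_zero_of_natDegree_lt (by omega)]

theorem fSigma_rootCoeff (r : Fin (μ + 1) → ℂ) : fSigma (rootCoeff r) = prodPoly r :=
  fSigma_eq_of_coeff (natDegree_prodPoly_le r) fun _ => rfl

theorem rootCoeff_zero (r : Fin (μ + 1) → ℂ) : rootCoeff r 0 = 1 := by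
  simp [rootCoeff, Polynomial.coeff_zero_eq_eval_zero, eval_prodPoly]

/-- A polynomial of degree at most `μ + 1` is determined by `μ + 1` distinct nonzero roots and
its constant term. -/
theorem eq_mul_rootCoeff {a : Fin (μ + 2) → ℂ} {z : Fin (μ + 1) → ℂ}
    (hz : Function.Injective z) (hz0 : ∀ j, z j ≠ 0) (h : ∀ j, (fSigma a).eval (z j) = 0)
    (i : Fin (μ + 2)) : a i = a 0 * rootCoeff (fun j => -1 / z j) i := by
  have key : fSigma a = Polynomial.C (a 0) * prodPoly (fun j => -1 / z j) := by
    classical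
    -- The two polynomials have degree at most μ + 1 and are compared at μ + 2 nodes: 0, where the
    -- constant terms agree, and the z_j, where both vanish.
    have hinj : Function.Injective (Fin.cons 0 z : Fin (μ + 2) → ℂ) :=
      Fin.cons_injective_iff.2 ⟨by rintro ⟨j, hj⟩; exact hz0 j hj, hz⟩
    refine Polynomial.eq_of_degree_sub_lt_of_eval_index_eq (Finset.univ)
      (v := (Fin.cons 0 z : Fin (μ + 2) → ℂ)) hinj.injOn ?_ ?_
    · refine (Polynomial.degree_le_of_natDegree_le (n := μ + 1) ?_).trans_lt ?_
      · refine (Polynomial.natDegree_sub_le _ _).trans (max_le (natDegree_fSigma_le a) ?_)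
        exact (Polynomial.natDegree_C_mul_le _ _).trans (natDegree_prodPoly_le _)
      · simp only [Finset.card_univ, Fintype.card_fin]
        exact_mod_cast Nat.lt_succ_self _
    · intro j _
      refine Fin.cases ?_ (fun j => ?_) j
      · have := coeff_fSigma a 0
        simp only [Fin.val_zero, Polynomial.coeff_zero_eq_eval_zero] at this
        simp [this, eval_prodPoly]
      · simp only [Fin.cons_succ, h, Polynomial.eval_mul, eval_prodPoly]
        rw [Finset.prod_eq_zero (Finset.mem_univ j), mul_zero]
        have := hz0 j
        field_simp
        ring
  have := congrArg (fun p : Polynomial ℂ => p.coeff i) key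
  simpa [coeff_fSigma, rootCoeff] using this

/-- Two linear factors with different slopes are coprime by an explicit Bézout identity with
denominator r_i - r_j. This also covers a slope equal to zero, where the factor is 1. -/
theorem separable_prodPoly {r : Fin (μ + 1) → ℂ} (hr : Function.Injective r) :
    (prodPoly r).Separable := by
  refine Polynomial.separable_prod ?_ ?_
  · intro i j hij
    refine ⟨Polynomial.C (-r j / (r i - r j)), Polynomial.C (r i / (r i - r j)), ?_⟩
    have h : r i - r j ≠ 0 := sub_ne_zero.2 fun e => hij (hr e)
    have e1 : Polynomial.C (-r j / (r i - r j)) + Polynomial.C (r i / (r i - r j)) =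
        (1 : Polynomial ℂ) := by
      rw [← Polynomial.C_add, ← Polynomial.C_1]; congr 1; field_simp; ring
    have e2 : Polynomial.C (-r j / (r i - r j)) * Polynomial.C (r i) +
        Polynomial.C (r i / (r i - r j)) * Polynomial.C (r j) = (0 : Polynomial ℂ) := by
      rw [← Polynomial.C_mul, ← Polynomial.C_mul, ← Polynomial.C_add, ← Polynomial.C_0]
      congr 1; ring
    linear_combination e1 + Polynomial.X * e2
  · intro j
    -- The Bézout identity is (1 + rX) - X·r = 1.
    refine ⟨1, -Polynomial.X, ?_⟩
    simp only [Polynomial.derivative_add, Polynomial.derivative_one, Polynomial.derivative_mul,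
      Polynomial.derivative_C, Polynomial.derivative_X]
    ring

theorem rootCoeff_mem_regularLocus {r : Fin (μ + 1) → ℂ} (hr : Function.Injective r)
    (h : ∀ i, rootCoeff r i ≠ 0) : rootCoeff r ∈ regularLocus μ :=
  ⟨h, by rw [fSigma_rootCoeff]; exact separable_prodPoly hr⟩

theorem natDegree_fSigma {a : Fin (μ + 2) → ℂ} (ha : ∀ i, a i ≠ 0) :
    (fSigma a).natDegree = μ + 1 := by
  refine le_antisymm (natDegree_fSigma_le a) (Polynomial.le_natDegree_of_ne_zero ?_)
  have := coeff_fSigma a (Fin.last _)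
  simp only [Fin.val_last] at this
  rw [this]; exact ha _

/-- The leading coefficient is nonzero, so the degree is exactly μ + 1, and over ℂ a separable
polynomial has as many roots as its degree. Zero is not a root since a_0 ≠ 0. -/
theorem exists_roots_of_mem_regularLocus {a : Fin (μ + 2) → ℂ} (ha : a ∈ regularLocus μ) :
    ∃ z : Fin (μ + 1) → ℂ, Function.Injective z ∧ (∀ j, z j ≠ 0) ∧
      ∀ j, (fSigma a).eval (z j) = 0 := by
  have hcard : Fintype.card ((fSigma a).rootSet ℂ) = μ + 1 := by
    rw [Polynomial.card_rootSet_eq_natDegree ha.2 (IsAlgClosed.splits _), natDegree_fSigma ha.1]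
  let e := (Fintype.equivFinOfCardEq hcard).symm
  have hroot : ∀ j, (fSigma a).eval (e j : ℂ) = 0 := fun j => by
    have := (Polynomial.mem_rootSet.1 (e j).2).2
    simpa using this
  refine ⟨fun j => e j, fun i j h => e.injective (Subtype.ext h), fun j h0 => ?_, hroot⟩
  have h1 := hroot j
  simp only at h0
  rw [h0, ← Polynomial.coeff_zero_eq_eval_zero] at h1
  exact ha.1 0 ((coeff_fSigma a 0).symm.trans h1)

theorem exists_rootCoeff_of_mem_regularLocus {a : Fin (μ + 2) → ℂ} (ha : a ∈ regularLocus μ) :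
    ∃ r : Fin (μ + 1) → ℂ, Function.Injective r ∧ (∀ j, r j ≠ 0) ∧
      ∀ i, a i = a 0 * rootCoeff r i := by
  obtain ⟨z, hz, hz0, h⟩ := exists_roots_of_mem_regularLocus ha
  refine ⟨fun j => -1 / z j, fun i j hij => hz ?_, fun j => ?_, eq_mul_rootCoeff hz hz0 h⟩
  · have h1 := hz0 i; have h2 := hz0 j
    simp only at hij
    field_simp at hij
    exact (neg_injective hij).symm
  · exact div_ne_zero (by norm_num) (hz0 j)

theorem rootCoeff_comp_perm (r : Fin (μ + 1) → ℂ) (σ : Equiv.Perm (Fin (μ + 1))) :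
    rootCoeff (fun j => r (σ j)) = rootCoeff r := by
  have : prodPoly (fun j => r (σ j)) = prodPoly r :=
    Equiv.prod_comp σ (fun j => 1 + Polynomial.C (r j) * Polynomial.X)
  ext i; rw [rootCoeff, this, rootCoeff]

theorem rootCoeff_smul (t : ℂ) (r : Fin (μ + 1) → ℂ) (i : Fin (μ + 2)) :
    rootCoeff (fun j => t * r j) i = t ^ (i : ℕ) * rootCoeff r i := by
  have : prodPoly (fun j => t * r j) = (prodPoly r).comp (Polynomial.C t * Polynomial.X) := by
    simp only [prodPoly, Polynomial.prod_comp]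
    refine Finset.prod_congr rfl fun j _ => ?_
    simp; ring
  rw [rootCoeff, this, Polynomial.comp_C_mul_X_coeff, rootCoeff, mul_comm]

/-- Each -1/r'_j is a root of the common polynomial, so r'_j occurs among the r_i. Injectivity of r'
makes the resulting index map injective, hence bijective. -/
theorem exists_perm_of_rootCoeff_eq {r r' : Fin (μ + 1) → ℂ}
    (hr' : Function.Injective r') (hr0' : ∀ j, r' j ≠ 0)
    (h : rootCoeff r = rootCoeff r') :
    ∃ σ : Equiv.Perm (Fin (μ + 1)), ∀ j, r' j = r (σ j) := by
  have hp : prodPoly r = prodPoly r' := by rw [← fSigma_rootCoeff, h, fSigma_rootCoeff]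
  have hex : ∀ j, ∃ i, r' j = r i := fun j => by
    have h1 : (prodPoly r).eval (-1 / r' j) = 0 := by
      rw [hp, eval_prodPoly]
      refine Finset.prod_eq_zero (Finset.mem_univ j) ?_
      have := hr0' j
      field_simp; ring
    rw [eval_prodPoly, Finset.prod_eq_zero_iff] at h1
    obtain ⟨i, -, hi⟩ := h1
    refine ⟨i, ?_⟩
    have := hr0' j
    field_simp at hi
    linear_combination hi
  choose f hf using hex
  have hinj : Function.Injective f := fun i j hij => hr' (by rw [hf, hf, hij])
  exact ⟨Equiv.ofBijective f (Finite.injective_iff_bijective.1 hinj), hf⟩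

/-! ### Torus scalings and the coordinates x -/

theorem xCoord_scale {s t : ℂ} (hs : s ≠ 0) (ht : t ≠ 0) (a : Fin (μ + 2) → ℂ) :
    xCoord (fun i => s * (t ^ (i : ℕ) * a i)) = xCoord a := by
  ext k
  have e : ∀ A B C : ℂ, s * (t ^ (k : ℕ) * A) * (s * (t ^ ((k : ℕ) + 1 + 1) * B)) /
      (s * (t ^ ((k : ℕ) + 1) * C)) ^ 2 = A * B / C ^ 2 := fun A B C => by
    -- With a zero denominator both quotients are 0 by convention, so no condition on a is needed.
    rcases eq_or_ne C 0 with rfl | h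
    · simp
    · field_simp
      ring
  exact e _ _ _

/-- The coordinate x_k determines an entry from the two preceding ones. Thus s and t are fixed by
matching the entries 0 and 1, and a two-step induction propagates the match. -/
theorem eq_scale_of_xCoord_eq {a b : Fin (μ + 2) → ℂ} (ha : ∀ i, a i ≠ 0) (hb : ∀ i, b i ≠ 0)
    (h : xCoord a = xCoord b) :
    ∃ s t : ℂ, s ≠ 0 ∧ t ≠ 0 ∧ ∀ i : Fin (μ + 2), a i = s * (t ^ (i : ℕ) * b i) := by
  refine ⟨a 0 / b 0, (a 1 / b 1) / (a 0 / b 0), div_ne_zero (ha _) (hb _),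
    div_ne_zero (div_ne_zero (ha _) (hb _)) (div_ne_zero (ha _) (hb _)), ?_⟩
  generalize hs : a 0 / b 0 = s
  generalize ht : (a 1 / b 1) / s = t
  have hs0 : s ≠ 0 := by rw [← hs]; exact div_ne_zero (ha _) (hb _)
  have ht0 : t ≠ 0 := by rw [← ht]; exact div_ne_zero (div_ne_zero (ha _) (hb _)) hs0
  have key : ∀ n : ℕ, ∀ (h0 : n < μ + 1),
      a ⟨n, by omega⟩ = s * (t ^ n * b ⟨n, by omega⟩) ∧
      a ⟨n + 1, by omega⟩ = s * (t ^ (n + 1) * b ⟨n + 1, by omega⟩) := by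
    intro n
    induction n with
    | zero =>
      intro h0
      have e0 : (⟨0, by omega⟩ : Fin (μ + 2)) = 0 := rfl
      have e1 : (⟨0 + 1, by omega⟩ : Fin (μ + 2)) = 1 := by ext; simp
      rw [e0, e1]
      have h0 := hb 0; have h1 := hb 1
      constructor
      · rw [← hs]; field_simp
      · rw [← ht, zero_add, pow_one]; field_simp
    | succ n ih =>
      intro h0
      obtain ⟨i1, i2⟩ := ih (by omega)
      refine ⟨i2, ?_⟩
      have hk := congrFun h ⟨n, by omega⟩
      simp only [xCoord] at hk
      have c1 : (⟨n, by omega⟩ : Fin μ).castSucc.castSucc = ⟨n, by omega⟩ := rfl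
      have c2 : (⟨n, by omega⟩ : Fin μ).succ.castSucc = ⟨n + 1, by omega⟩ := rfl
      have c3 : (⟨n, by omega⟩ : Fin μ).succ.succ = ⟨n + 1 + 1, by omega⟩ := rfl
      rw [c1, c2, c3, i1, i2] at hk
      have b1 := hb ⟨n, by omega⟩
      have b2 := hb ⟨n + 1, by omega⟩
      have hk' : a ⟨n + 1 + 1, by omega⟩ * (s * t ^ n * b ⟨n, by omega⟩) =
          (s * (t ^ (n + 1 + 1) * b ⟨n + 1 + 1, by omega⟩)) * (s * t ^ n * b ⟨n, by omega⟩) := by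
        have h2 : t ^ n ≠ 0 := pow_ne_zero _ ht0
        field_simp at hk
        have e : (t ^ (n + 1)) ^ 2 = t ^ n * t ^ (n + 1 + 1) := by ring
        rw [e, mul_left_comm, mul_assoc] at hk
        have hk2 := mul_left_cancel₀ h2 hk
        rw [hk2]; ring
      exact mul_right_cancel₀ (mul_ne_zero (mul_ne_zero hs0 (pow_ne_zero _ ht0)) b1) hk'
  intro i
  by_cases hi : (i : ℕ) < μ + 1
  · exact (key i hi).1
  · have : i = ⟨μ + 1, by omega⟩ := by ext; simp; omega
    rw [this]
    exact (key μ (by omega)).2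

/-- The partial products of the quotients are r_j / r_0. Dividing all r_j by r_0 is the substitution
W ↦ W / r_0, which the x-coordinates do not see. -/
theorem mirrorMap_ratio {r : Fin (μ + 1) → ℂ} (hr : ∀ j, r j ≠ 0) :
    mirrorMap (ratio r) = xCoord (rootCoeff r) := by
  rw [mirrorMap, qCoeff_eq]
  have h : rootCoeff (Fin.partialProd (ratio r)) =
      fun i : Fin (μ + 2) => 1 * ((r 0)⁻¹ ^ (i : ℕ) * rootCoeff r i) := by
    ext i
    rw [one_mul, ← rootCoeff_smul]
    congr 1; ext j; rw [partialProd_ratio hr, div_eq_inv_mul]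
  rw [h, xCoord_scale one_ne_zero (inv_ne_zero (hr 0))]

theorem ratio_mem_qSpace {r : Fin (μ + 1) → ℂ} (hr : Function.Injective r)
    (hr0 : ∀ j, r j ≠ 0) (h : ∀ i, rootCoeff r i ≠ 0) : ratio r ∈ qSpace μ := by
  refine ⟨ratio_ne_zero hr0, fun i j hij => hr ?_, fun i => ?_⟩
  · rw [partialProd_ratio hr0, partialProd_ratio hr0] at hij
    have := hr0 0
    field_simp at hij
    exact hij
  · rw [qCoeff_eq]
    have : rootCoeff (Fin.partialProd (ratio r)) i = (r 0)⁻¹ ^ (i : ℕ) * rootCoeff r i := by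
      rw [← rootCoeff_smul]
      congr 1; ext j; rw [partialProd_ratio hr0, div_eq_inv_mul]
    rw [this]
    exact mul_ne_zero (pow_ne_zero _ (inv_ne_zero (hr0 0))) (h i)

/-! ### The action of the symmetric group -/

theorem permQ_mem_qSpace {q : Fin μ → ℂ} (hq : q ∈ qSpace μ) (σ : Equiv.Perm (Fin (μ + 1))) :
    permQ σ q ∈ qSpace μ := by
  rw [permQ_eq]
  refine ratio_mem_qSpace (hq.2.1.comp σ⁻¹.injective) (fun j => partialProd_ne_zero hq.1 _)
    fun i => ?_
  rw [rootCoeff_comp_perm (Fin.partialProd q) σ⁻¹]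
  exact hq.2.2 i

theorem mirrorMap_permQ {q : Fin μ → ℂ} (hq : ∀ k, q k ≠ 0) (σ : Equiv.Perm (Fin (μ + 1))) :
    mirrorMap (permQ σ q) = mirrorMap q := by
  rw [permQ_eq, mirrorMap_ratio fun j => partialProd_ne_zero hq _,
    rootCoeff_comp_perm (Fin.partialProd q) σ⁻¹]
  rfl

theorem permQ_one {q : Fin μ → ℂ} (hq : ∀ k, q k ≠ 0) : permQ 1 q = q := by
  rw [permQ_eq]; exact ratio_partialProd hq

theorem partialProd_permQ {q : Fin μ → ℂ} (hq : ∀ k, q k ≠ 0) (σ : Equiv.Perm (Fin (μ + 1)))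
    (j : Fin (μ + 1)) : Fin.partialProd (permQ σ q) j =
      Fin.partialProd q (σ⁻¹ j) / Fin.partialProd q (σ⁻¹ 0) := by
  rw [permQ_eq, partialProd_ratio fun j => partialProd_ne_zero hq _]

theorem permQ_mul {q : Fin μ → ℂ} (hq : ∀ k, q k ≠ 0) (σ τ : Equiv.Perm (Fin (μ + 1))) :
    permQ (σ * τ) q = permQ σ (permQ τ q) := by
  ext k
  rw [permQ, permQ, partialProd_permQ hq, partialProd_permQ hq]
  have h := partialProd_ne_zero hq
  simp only [mul_inv_rev, Equiv.Perm.mul_apply]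
  have h1 := h (τ⁻¹ 0)
  have h2 := h (τ⁻¹ (σ⁻¹ k.castSucc))
  field_simp

theorem xCoord_injOn_scale {a : Fin (μ + 2) → ℂ} {t : ℂ} (ha : a 1 ≠ 0)
    (h : ∀ i : Fin (μ + 2), a i = t ^ (i : ℕ) * a i) : t = 1 := by
  have := h 1
  simp only [Fin.val_one, pow_one] at this
  have h2 : (t - 1) * a 1 = 0 := by linear_combination -this
  exact sub_eq_zero.1 ((mul_eq_zero.1 h2).resolve_right ha)

/-- If σ fixes q, permuting the λ_j multiplies them all by one factor c. The coefficients are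
symmetric, so a_i = c^i a_i, and a_1 ≠ 0 forces c = 1; distinctness of the λ_j then gives σ = 1. The
condition on a_1 matters: for μ = 1 the point q = -1, where a_1 = 0, is fixed by the transposition.
-/
theorem eq_one_of_permQ_eq {q : Fin μ → ℂ} (hq : q ∈ qSpace μ) {σ : Equiv.Perm (Fin (μ + 1))}
    (h : permQ σ q = q) : σ = 1 := by
  have hne := partialProd_ne_zero hq.1
  set c := Fin.partialProd q (σ⁻¹ 0) with hc
  have hj : ∀ j, Fin.partialProd q (σ⁻¹ j) = c * Fin.partialProd q j := fun j => by
    have := partialProd_permQ hq.1 σ j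
    rw [h, ← hc] at this
    rw [this]; have := hne (σ⁻¹ 0); rw [← hc] at this; field_simp
  have hc1 : c = 1 := by
    refine xCoord_injOn_scale (hq.2.2 1) fun i => ?_
    have h1 := rootCoeff_smul c (Fin.partialProd q) i
    rw [qCoeff_eq, ← h1, ← rootCoeff_comp_perm (Fin.partialProd q) σ⁻¹]
    simp_rw [hj]
  have : σ⁻¹ = 1 := by
    ext j
    have := hj j
    rw [hc1, one_mul] at this
    rw [hq.2.1 this]; rfl
  exact inv_eq_one.1 this

theorem permQ_injective {q : Fin μ → ℂ} (hq : q ∈ qSpace μ) {σ τ : Equiv.Perm (Fin (μ + 1))}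
    (h : permQ σ q = permQ τ q) : σ = τ := by
  have h2 : permQ (τ⁻¹ * σ) q = q := by
    rw [permQ_mul hq.1, h, ← permQ_mul hq.1, inv_mul_cancel, permQ_one hq.1]
  exact (inv_mul_eq_one.1 (eq_one_of_permQ_eq hq h2)).symm

/-- Equal images differ by a scaling (s, t). Both constant terms are 1, so s = 1, and the λ'_j are
then a permutation of the t λ_j. The factor t cancels in the quotients. -/
theorem exists_permQ_of_mirrorMap_eq {q q' : Fin μ → ℂ} (hq : q ∈ qSpace μ)
    (hq' : q' ∈ qSpace μ) (h : mirrorMap q = mirrorMap q') :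
    ∃ σ : Equiv.Perm (Fin (μ + 1)), q' = permQ σ q := by
  obtain ⟨s, t, hs, ht, hst⟩ := eq_scale_of_xCoord_eq hq'.2.2 hq.2.2 h.symm
  have hs1 : s = 1 := by
    have := hst 0
    rw [qCoeff_eq, qCoeff_eq, rootCoeff_zero, rootCoeff_zero] at this
    simpa using this.symm
  subst hs1
  have hne' := partialProd_ne_zero hq'.1
  obtain ⟨σ, hσ⟩ := exists_perm_of_rootCoeff_eq (r := fun j => t * Fin.partialProd q j)
    (r' := Fin.partialProd q') hq'.2.1 hne' (by
      ext i
      have := hst i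
      rw [qCoeff_eq, qCoeff_eq, one_mul] at this
      rw [rootCoeff_smul, this])
  refine ⟨σ⁻¹, ?_⟩
  conv_lhs => rw [← ratio_partialProd hq'.1]
  ext k
  rw [ratio, permQ, hσ, hσ, inv_inv, mul_div_mul_left _ _ ht]

theorem mirrorMap_eq_iff {q q' : Fin μ → ℂ} (hq : q ∈ qSpace μ) (hq' : q' ∈ qSpace μ) :
    mirrorMap q = mirrorMap q' ↔ ∃ σ : Equiv.Perm (Fin (μ + 1)), q' = permQ σ q := by
  refine ⟨exists_permQ_of_mirrorMap_eq hq hq', ?_⟩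
  rintro ⟨σ, rfl⟩
  exact (mirrorMap_permQ hq.1 σ).symm

theorem qCoeff_mem_regularLocus {q : Fin μ → ℂ} (hq : q ∈ qSpace μ) :
    qCoeff q ∈ regularLocus μ :=
  rootCoeff_mem_regularLocus hq.2.1 hq.2.2

theorem mirrorMap_mapsTo : Set.MapsTo mirrorMap (qSpace μ) (xSpace μ) :=
  fun _ hq => ⟨_, qCoeff_mem_regularLocus hq, rfl⟩

theorem exists_mirrorMap_eq {x : Fin μ → ℂ} (hx : x ∈ xSpace μ) :
    ∃ q ∈ qSpace μ, mirrorMap q = x := by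
  obtain ⟨a, ha, rfl⟩ := hx
  obtain ⟨r, hr, hr0, h⟩ := exists_rootCoeff_of_mem_regularLocus ha
  refine ⟨ratio r, ratio_mem_qSpace hr hr0 fun i h0 => ha.1 i (by rw [h, h0, mul_zero]), ?_⟩
  rw [mirrorMap_ratio hr0, ← xCoord_scale (ha.1 0) one_ne_zero]
  congr 1; ext i; rw [h i]; simp

/-! ### The exponential map -/

theorem two_pi_I_ne_zero : (2 * Real.pi * Complex.I : ℂ) ≠ 0 := Complex.two_pi_I_ne_zero

theorem expQ_ne_zero (v : Fin μ → ℂ) (k : Fin μ) : expQ v k ≠ 0 := Complex.exp_ne_zero _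

theorem partialProd_expQ (v : Fin μ → ℂ) (j : Fin (μ + 1)) :
    Fin.partialProd (expQ v) j = Complex.exp (2 * Real.pi * Complex.I * Fin.partialSum v j) := by
  induction j using Fin.induction with
  | zero => simp
  | succ i ih => rw [Fin.partialProd_succ, Fin.partialSum_succ, ih, expQ, ← Complex.exp_add,
      mul_add]

theorem expQ_add_int (v : Fin μ → ℂ) (n : Fin μ → ℤ) :
    expQ (fun k => v k + (n k : ℂ)) = expQ v := by
  ext k
  rw [expQ, expQ, mul_add, Complex.exp_add, mul_comm _ ((n k : ℂ)), Complex.exp_int_mul_two_pi_mul_I,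
    mul_one]

theorem expQ_permW (σ : Equiv.Perm (Fin (μ + 1))) (v : Fin μ → ℂ) :
    expQ (permW σ v) = permQ σ (expQ v) := by
  ext k
  rw [permQ, partialProd_expQ, partialProd_expQ, ← Complex.exp_sub, expQ, permW, mul_sub]

theorem expQ_permW_add_int (σ : Equiv.Perm (Fin (μ + 1))) (v : Fin μ → ℂ) (n : Fin μ → ℤ) :
    expQ (fun k => permW σ v k + (n k : ℂ)) = permQ σ (expQ v) := by
  rw [expQ_add_int, expQ_permW]

theorem exists_int_of_expQ_eq {v v' : Fin μ → ℂ} (h : expQ v = expQ v') :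
    ∃ n : Fin μ → ℤ, ∀ k, v k = v' k + (n k : ℂ) := by
  have : ∀ k, ∃ n : ℤ, v k = v' k + n := fun k => by
    obtain ⟨n, hn⟩ := Complex.exp_eq_exp_iff_exists_int.1 (congrFun h k)
    refine ⟨n, mul_left_cancel₀ two_pi_I_ne_zero ?_⟩
    rw [hn]; ring
  choose n hn using this
  exact ⟨n, hn⟩

theorem exists_expQ_eq {q : Fin μ → ℂ} (hq : ∀ k, q k ≠ 0) : ∃ v, expQ v = q := by
  refine ⟨fun k => (2 * Real.pi * Complex.I)⁻¹ * Complex.log (q k), ?_⟩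
  ext k
  rw [expQ, mul_inv_cancel_left₀ two_pi_I_ne_zero, Complex.exp_log (hq k)]

/-! ### Analyticity -/

section Analyticity

variable {E : Type*} [NormedAddCommGroup E] [NormedSpace ℂ E]

theorem analyticAt_rootCoeff {r : E → Fin (μ + 1) → ℂ} {x₀ : E}
    (hr : ∀ j, AnalyticAt ℂ (fun x => r x j) x₀) (i : Fin (μ + 2)) :
    AnalyticAt ℂ (fun x => rootCoeff (r x) i) x₀ := by
  have key : ∀ (s : Finset (Fin (μ + 1))) (m : ℕ), AnalyticAt ℂ (fun x =>
      (∏ j ∈ s, (1 + Polynomial.C (r x j) * Polynomial.X)).coeff m) x₀ := by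
    classical
    intro s
    induction s using Finset.induction with
    | empty => intro m; simp only [Finset.prod_empty]; exact analyticAt_const
    | insert j s hj ih =>
      intro m
      have e : ∀ x, (∏ j ∈ insert j s, (1 + Polynomial.C (r x j) * Polynomial.X)) =
          (∏ j ∈ s, (1 + Polynomial.C (r x j) * Polynomial.X)) + Polynomial.C (r x j) *
          (∏ j ∈ s, (1 + Polynomial.C (r x j) * Polynomial.X)) * Polynomial.X := fun x => by
        rw [Finset.prod_insert hj]; ring
      simp only [e, Polynomial.coeff_add]
      refine (ih m).add ?_
      cases m with
      | zero => simp only [Polynomial.mul_coeff_zero, Polynomial.coeff_X_zero, mul_zero]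
                exact analyticAt_const
      | succ m =>
        simp only [Polynomial.coeff_mul_X, Polynomial.coeff_C_mul]
        exact (hr j).mul (ih m)
  exact key _ _

theorem analyticAt_partialProd {q : E → Fin μ → ℂ} {x₀ : E}
    (hq : ∀ k, AnalyticAt ℂ (fun x => q x k) x₀) (j : Fin (μ + 1)) :
    AnalyticAt ℂ (fun x => Fin.partialProd (q x) j) x₀ := by
  induction j using Fin.induction with
  | zero => simp only [Fin.partialProd_zero]; exact analyticAt_const
  | succ i ih => simp only [Fin.partialProd_succ]; exact ih.mul (hq i)

theorem analyticAt_qCoeff {q : E → Fin μ → ℂ} {x₀ : E}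
    (hq : ∀ k, AnalyticAt ℂ (fun x => q x k) x₀) (i : Fin (μ + 2)) :
    AnalyticAt ℂ (fun x => qCoeff (q x) i) x₀ := by
  simp only [qCoeff_eq]
  exact analyticAt_rootCoeff (analyticAt_partialProd hq) i

theorem analyticAt_xCoord {b : E → Fin (μ + 2) → ℂ} {x₀ : E}
    (hb : ∀ i, AnalyticAt ℂ (fun x => b x i) x₀) (h0 : ∀ i, b x₀ i ≠ 0) :
    AnalyticAt ℂ (fun x => xCoord (b x)) x₀ := by
  refine analyticAt_pi_iff.2 fun k => ?_
  simp only [xCoord]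
  exact ((hb _).mul (hb _)).div ((hb _).pow 2) (pow_ne_zero _ (h0 _))

theorem analyticAt_mirrorMap {q : E → Fin μ → ℂ} {x₀ : E}
    (hq : ∀ k, AnalyticAt ℂ (fun x => q x k) x₀) (h0 : ∀ i, qCoeff (q x₀) i ≠ 0) :
    AnalyticAt ℂ (fun x => mirrorMap (q x)) x₀ :=
  analyticAt_xCoord (analyticAt_qCoeff hq) h0

theorem analyticAt_ratio {r : E → Fin (μ + 1) → ℂ} {x₀ : E}
    (hr : ∀ j, AnalyticAt ℂ (fun x => r x j) x₀) (h0 : ∀ j, r x₀ j ≠ 0) :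
    AnalyticAt ℂ (fun x => ratio (r x)) x₀ := by
  refine analyticAt_pi_iff.2 fun k => ?_
  simp only [ratio]
  exact (hr _).div (hr _) (h0 _)

theorem analyticAt_expQ {v : E → Fin μ → ℂ} {x₀ : E} (hv : AnalyticAt ℂ v x₀) :
    AnalyticAt ℂ (fun x => expQ (v x)) x₀ := by
  refine analyticAt_pi_iff.2 fun k => ?_
  simp only [expQ]
  exact (analyticAt_const.mul (analyticAt_pi_iff.1 hv k)).cexp

end Analyticity

theorem analyticAt_apply (q : Fin μ → ℂ) (k : Fin μ) :
    AnalyticAt ℂ (fun q : Fin μ → ℂ => q k) q := analyticAt_pi_iff.1 analyticAt_id k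

theorem continuous_partialProd (j : Fin (μ + 1)) :
    Continuous fun q : Fin μ → ℂ => Fin.partialProd q j :=
  continuous_iff_continuousAt.2 fun q =>
    (analyticAt_partialProd (analyticAt_apply q) j).continuousAt

theorem continuous_qCoeff (i : Fin (μ + 2)) : Continuous fun q : Fin μ → ℂ => qCoeff q i :=
  continuous_iff_continuousAt.2 fun q => (analyticAt_qCoeff (analyticAt_apply q) i).continuousAt

theorem continuous_expQ : Continuous (expQ : (Fin μ → ℂ) → Fin μ → ℂ) :=
  continuous_iff_continuousAt.2 fun _ => (analyticAt_expQ analyticAt_id).continuousAt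

theorem isOpen_qSpace : IsOpen (qSpace μ) := by
  have h : qSpace μ = (⋂ k, {q | q k ≠ 0}) ∩ ((⋂ i, ⋂ j, {q | i ≠ j →
      Fin.partialProd q i ≠ Fin.partialProd q j}) ∩ ⋂ i, {q | qCoeff q i ≠ 0}) := by
    ext q
    simp only [qSpace, Set.mem_ofPred_eq, Set.mem_inter_iff, Set.mem_iInter, Function.Injective]
    refine and_congr Iff.rfl (and_congr ⟨fun h i j => mt (@h i j), fun h i j => ?_⟩ Iff.rfl)
    exact not_imp_not.1 (h i j)
  rw [h]
  refine (isOpen_iInter_of_finite fun k => ?_).inter ((isOpen_iInter_of_finite fun i =>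
    isOpen_iInter_of_finite fun j => ?_).inter (isOpen_iInter_of_finite fun i => ?_))
  · exact isOpen_ne_fun (continuous_apply k) continuous_const
  · by_cases hij : i = j
    · simp [hij]
    · simp only [ne_eq, hij, not_false_eq_true, forall_const]
      exact isOpen_ne_fun (continuous_partialProd i) (continuous_partialProd j)
  · exact isOpen_ne_fun (continuous_qCoeff i) continuous_const

theorem analyticAt_permQ {q : Fin μ → ℂ} (hq : ∀ k, q k ≠ 0) (σ : Equiv.Perm (Fin (μ + 1))) :
    AnalyticAt ℂ (permQ σ) q :=
  analyticAt_ratio (r := fun q j => Fin.partialProd q (σ⁻¹ j))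
    (fun _ => analyticAt_partialProd (analyticAt_apply q) _) fun _ => partialProd_ne_zero hq _

theorem continuousAt_mirrorMap {q : Fin μ → ℂ} (hq : q ∈ qSpace μ) : ContinuousAt mirrorMap q :=
  (analyticAt_mirrorMap (analyticAt_apply q) hq.2.2).continuousAt

/-! ### Local inverses of the mirror map -/

/-- This is the implicit function theorem for (b, w) ↦ ∑ b_i w^i at a simple root. Smoothness of
order ⊤ means analyticity, so the implicit function is analytic. -/
theorem exists_analytic_root {a : Fin (μ + 2) → ℂ} {z : ℂ} (hz : (fSigma a).eval z = 0)
    (hz' : (fSigma a).derivative.eval z ≠ 0) :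
    ∃ ρ : (Fin (μ + 2) → ℂ) → ℂ, AnalyticAt ℂ ρ a ∧ ρ a = z ∧
      ∀ᶠ b in 𝓝 a, (fSigma b).eval (ρ b) = 0 := by
  let f : (Fin (μ + 2) → ℂ) × ℂ → ℂ := fun p => (fSigma p.1).eval p.2
  have hf : ContDiff ℂ ⊤ f := by
    simp only [f, eval_fSigma]
    fun_prop
  have hfa : ContDiffAt ℂ ⊤ f (a, z) := hf.contDiffAt
  have hd : HasFDerivAt f (fderiv ℂ f (a, z)) (a, z) :=
    (hfa.differentiableAt (by simp)).hasFDerivAt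
  have hd2 : HasDerivAt (fun w => f (a, w)) (fderiv ℂ f (a, z) (0, 1)) z := by
    have h1 : HasDerivAt (fun w : ℂ => (a, w)) ((0 : Fin (μ + 2) → ℂ), (1 : ℂ)) z :=
      (hasDerivAt_const z a).prodMk (hasDerivAt_id z)
    exact hd.comp_hasDerivAt z h1
  have hval : fderiv ℂ f (a, z) (0, 1) = (fSigma a).derivative.eval z :=
    hd2.unique ((fSigma a).hasDerivAt z)
  set c := (fSigma a).derivative.eval z with hc
  have hinv : (fderiv ℂ f (a, z) ∘L .inr ℂ (Fin (μ + 2) → ℂ) ℂ).IsInvertible := by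
    refine ⟨ContinuousLinearEquiv.unitsEquivAut ℂ (Units.mk0 c hz'), ?_⟩
    ext
    simp [hval]
  refine ⟨hfa.implicitFunction (by simp) hinv, ?_, hfa.implicitFunction_apply_self (by simp) hinv,
    ?_⟩
  · exact (hfa.contDiffAt_implicitFunction (by simp) hinv).analyticAt
  · filter_upwards [hfa.eventually_apply_implicitFunction (by simp) hinv] with b hb
    exact hb.trans hz

/-- The coefficients with prescribed coordinates `x` and prescribed first two entries. -/
def coeffOfX (c₀ c₁ : ℂ) (x : Fin μ → ℂ) : ℕ → ℂ
  | 0 => c₀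
  | 1 => c₁
  | k + 2 => (if h : k < μ then x ⟨k, h⟩ else 0) * coeffOfX c₀ c₁ x (k + 1) ^ 2 /
      coeffOfX c₀ c₁ x k

theorem coeffOfX_xCoord {a : Fin (μ + 2) → ℂ} (ha : ∀ i, a i ≠ 0) (i : Fin (μ + 2)) :
    coeffOfX (a 0) (a 1) (xCoord a) i = a i := by
  obtain ⟨n, hn⟩ := i
  induction n using Nat.strong_induction_on with
  | _ n ih =>
    match n, hn with
    | 0, _ => rfl
    | 1, _ => rw [coeffOfX]; congr 1
    | k + 2, hn =>
      have h1 := ih (k + 1) (by omega) (by omega)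
      have h2 := ih k (by omega) (by omega)
      simp only at h1 h2 ⊢
      rw [coeffOfX, h1, h2, dif_pos (by omega)]
      simp only [xCoord]
      have e1 := ha ⟨k, by omega⟩
      have e2 := ha ⟨k + 1, by omega⟩
      have c1 : (⟨k, by omega⟩ : Fin μ).castSucc.castSucc = ⟨k, by omega⟩ := rfl
      have c2 : (⟨k, by omega⟩ : Fin μ).succ.castSucc = ⟨k + 1, by omega⟩ := rfl
      have c3 : (⟨k, by omega⟩ : Fin μ).succ.succ = ⟨k + 2, by omega⟩ := rfl
      rw [c1, c2, c3]
      field_simp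

theorem xCoord_coeffOfX {c₀ c₁ : ℂ} {x : Fin μ → ℂ}
    (h : ∀ i : Fin (μ + 2), coeffOfX c₀ c₁ x i ≠ 0) :
    xCoord (fun i : Fin (μ + 2) => coeffOfX c₀ c₁ x i) = x := by
  ext k
  have h1 := h k.castSucc.castSucc
  have h2 := h k.succ.castSucc
  simp only [Fin.val_castSucc, Fin.val_succ] at h1 h2
  simp only [xCoord, Fin.val_castSucc, Fin.val_succ]
  rw [coeffOfX, dif_pos k.2]
  field_simp

/-- Freezing the first two coefficients at their values in a and solving the recursion for the
others gives a rational section through a. -/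
theorem exists_xCoord_section {a : Fin (μ + 2) → ℂ} (ha : ∀ i, a i ≠ 0) :
    ∃ b : (Fin μ → ℂ) → Fin (μ + 2) → ℂ, AnalyticAt ℂ b (xCoord a) ∧ b (xCoord a) = a ∧
      ∀ᶠ x in 𝓝 (xCoord a), (∀ i, b x i ≠ 0) ∧ xCoord (b x) = x := by
  have han : ∀ i : Fin (μ + 2),
      AnalyticAt ℂ (fun x : Fin μ → ℂ => coeffOfX (a 0) (a 1) x i) (xCoord a) := by
    rintro ⟨n, hn⟩
    induction n using Nat.strong_induction_on with
    | _ n ih =>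
      match n, hn with
      | 0, _ => simp only [coeffOfX]; exact analyticAt_const
      | 1, _ => simp only [coeffOfX]; exact analyticAt_const
      | k + 2, hn =>
        have h1 := ih (k + 1) (by omega) (by omega)
        have h2 := ih k (by omega) (by omega)
        have hk : k < μ := by omega
        simp only [coeffOfX, hk, dif_pos] at h1 h2 ⊢
        refine ((analyticAt_apply _ _).mul (h1.pow 2)).div h2 ?_
        have := coeffOfX_xCoord ha ⟨k, by omega⟩
        simp only at this
        rw [this]; exact ha _
  have hval : (fun i : Fin (μ + 2) => coeffOfX (a 0) (a 1) (xCoord a) i) = a :=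
    funext (coeffOfX_xCoord ha)
  refine ⟨fun x i => coeffOfX (a 0) (a 1) x i, analyticAt_pi_iff.2 han, hval, ?_⟩
  have : ∀ᶠ x in 𝓝 (xCoord a), ∀ i : Fin (μ + 2), coeffOfX (a 0) (a 1) x i ≠ 0 :=
    eventually_all.2 fun i => (han i).continuousAt.eventually_ne (by
      rw [coeffOfX_xCoord ha]; exact ha i)
  filter_upwards [this] with x hx
  exact ⟨hx, xCoord_coeffOfX hx⟩

theorem eval_derivative_ne_zero {p : Polynomial ℂ} (hp : p.Separable) {z : ℂ}
    (hz : p.eval z = 0) : p.derivative.eval z ≠ 0 := by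
  obtain ⟨u, v, h⟩ := hp
  intro h0
  have := congrArg (Polynomial.eval z) h
  simp [hz, h0] at this

theorem eventually_injective {E : Type*} [TopologicalSpace E] {ι : Type*} [Finite ι]
    {f : E → ι → ℂ} {x₀ : E} (hf : ∀ i, ContinuousAt (fun x => f x i) x₀)
    (h : Function.Injective (f x₀)) : ∀ᶠ x in 𝓝 x₀, Function.Injective (f x) := by
  have : ∀ i j, ∀ᶠ x in 𝓝 x₀, i ≠ j → f x i ≠ f x j := fun i j => by
    by_cases hij : i = j
    · simp [hij]
    · filter_upwards [((hf i).ne_iff_eventually_ne (hf j)).1 (h.ne hij)] with x hx _ using hx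
  filter_upwards [eventually_all.2 fun i => eventually_all.2 (this i)] with x hx i j
  exact not_imp_not.1 (hx i j)

/-- The mirror map has holomorphic local sections. -/
theorem exists_local_section {q : Fin μ → ℂ} (hq : q ∈ qSpace μ) :
    ∃ s : (Fin μ → ℂ) → Fin μ → ℂ, AnalyticAt ℂ s (mirrorMap q) ∧ s (mirrorMap q) = q ∧
      ∀ᶠ x in 𝓝 (mirrorMap q), s x ∈ qSpace μ ∧ mirrorMap (s x) = x := by
  have hreg := qCoeff_mem_regularLocus hq
  have hne := partialProd_ne_zero hq.1
  have hroot : ∀ j, (fSigma (qCoeff q)).eval (-1 / Fin.partialProd q j) = 0 := fun j => by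
    rw [qCoeff_eq, fSigma_rootCoeff, eval_prodPoly]
    refine Finset.prod_eq_zero (Finset.mem_univ j) ?_
    have := hne j
    field_simp; ring
  -- The section follows the simple roots -1/λ_j holomorphically along the coefficients b(x), and
  -- takes quotients of the resulting λ-parameters.
  choose ρ hρ hρa hρe using fun j =>
    exists_analytic_root (hroot j) (eval_derivative_ne_zero hreg.2 (hroot j))
  obtain ⟨b, hb, hba, hbe⟩ := exists_xCoord_section hreg.1
  change AnalyticAt ℂ b (mirrorMap q) at hb
  change b (mirrorMap q) = qCoeff q at hba
  change ∀ᶠ x in 𝓝 (mirrorMap q), _ at hbe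
  have hρb : ∀ j, AnalyticAt ℂ (fun x => ρ j (b x)) (mirrorMap q) := fun j =>
    AnalyticAt.comp (g := ρ j) (by rw [hba]; exact hρ j) hb
  have hρ0 : ∀ j, ρ j (b (mirrorMap q)) = -1 / Fin.partialProd q j := fun j => by rw [hba, hρa]
  have hρ0' : ∀ j, ρ j (b (mirrorMap q)) ≠ 0 := fun j => by
    rw [hρ0]; exact div_ne_zero (by norm_num) (hne j)
  have hr : ∀ j, AnalyticAt ℂ (fun x => -1 / ρ j (b x)) (mirrorMap q) := fun j =>
    analyticAt_const.div (hρb j) (hρ0' j)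
  have hr0 : ∀ j, -1 / ρ j (b (mirrorMap q)) = Fin.partialProd q j := fun j => by
    rw [hρ0]; have := hne j; field_simp
  refine ⟨fun x => ratio fun j => -1 / ρ j (b x), analyticAt_ratio hr fun j => ?_, ?_, ?_⟩
  · rw [hr0]; exact hne j
  · simp only [hr0]; exact ratio_partialProd hq.1
  · have e1 : ∀ᶠ x in 𝓝 (mirrorMap q), ∀ j, (fSigma (b x)).eval (ρ j (b x)) = 0 :=
      eventually_all.2 fun j => hb.continuousAt.eventually (by rw [hba]; exact hρe j)
    have e2 : ∀ᶠ x in 𝓝 (mirrorMap q), ∀ j, ρ j (b x) ≠ 0 :=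
      eventually_all.2 fun j => (hρb j).continuousAt.eventually_ne (hρ0' j)
    have e3 : ∀ᶠ x in 𝓝 (mirrorMap q), Function.Injective fun j => ρ j (b x) := by
      refine eventually_injective (fun j => (hρb j).continuousAt) ?_
      simp only [hρ0]
      intro i j hij
      have h1 := hne i; have h2 := hne j
      simp only at hij
      field_simp at hij
      exact hq.2.1 (neg_injective hij).symm
    filter_upwards [e1, e2, e3, hbe] with x h1 h2 h3 h4
    -- The followed roots remain μ + 1 distinct nonzero roots, so they account for the whole
    -- polynomial up to its constant term.
    have h5 := eq_mul_rootCoeff h3 h2 h1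
    have h6 : ∀ j, -1 / ρ j (b x) ≠ 0 := fun j => div_ne_zero (by norm_num) (h2 j)
    refine ⟨ratio_mem_qSpace (fun i j hij => h3 ?_) h6 fun i h0 => h4.1 i (by rw [h5, h0, mul_zero]),
      ?_⟩
    · have h1 := h2 i; have h2 := h2 j
      field_simp at hij
      exact (neg_injective hij).symm
    · rw [mirrorMap_ratio h6, ← xCoord_scale (h4.1 0) one_ne_zero]
      conv_rhs => rw [← h4.2]
      congr 1; ext i; rw [h5 i]; simp

/-- A local section is also a left inverse of the mirror map. -/
theorem eventually_section_mirrorMap {q : Fin μ → ℂ} (hq : q ∈ qSpace μ)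
    {s : (Fin μ → ℂ) → Fin μ → ℂ} (hs : ContinuousAt s (mirrorMap q)) (hsq : s (mirrorMap q) = q)
    (h : ∀ᶠ x in 𝓝 (mirrorMap q), s x ∈ qSpace μ ∧ mirrorMap (s x) = x) :
    ∀ᶠ q' in 𝓝 q, s (mirrorMap q') = q' := by
  have hm := continuousAt_mirrorMap hq
  have hsm : ContinuousAt (fun q' => s (mirrorMap q')) q := ContinuousAt.comp (g := s) hs hm
  -- The point s(x(q')) lies in the orbit of q'. At q it equals q, which by freeness differs from σq
  -- for σ ≠ 1, so by continuity and finiteness of the group only σ = 1 survives nearby.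
  have e1 : ∀ σ : Equiv.Perm (Fin (μ + 1)), ∀ᶠ q' in 𝓝 q,
      σ ≠ 1 → s (mirrorMap q') ≠ permQ σ q' := fun σ => by
    by_cases hσ : σ = 1
    · simp [hσ]
    · have := (hsm.ne_iff_eventually_ne (analyticAt_permQ hq.1 σ).continuousAt).1
        (by rw [hsq]; exact fun e => hσ (eq_one_of_permQ_eq hq e.symm))
      filter_upwards [this] with q' h' _ using h'
  filter_upwards [eventually_all.2 e1, hm.eventually h, isOpen_qSpace.mem_nhds hq] with q' h1 h2 h3
  obtain ⟨σ, hσ⟩ := exists_permQ_of_mirrorMap_eq h3 h2.1 h2.2.symm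
  have : σ = 1 := by
    by_contra hne
    exact h1 σ hne hσ
  rw [hσ, this, permQ_one h3.1]

/-! ### Mirror branches as local inverses of v ↦ x(e(v)) -/

theorem expQ_injOn {v v' : Fin μ → ℂ} (h : expQ v = expQ v') (hd : ‖v - v'‖ < 1) : v = v' := by
  obtain ⟨n, hn⟩ := exists_int_of_expQ_eq h
  ext k
  have h1 : ‖((n k : ℤ) : ℂ)‖ < 1 := by
    have : (v - v') k = (n k : ℂ) := by rw [Pi.sub_apply, hn]; ring
    rw [← this]; exact (norm_le_pi_norm _ k).trans_lt hd
  rw [Complex.norm_intCast] at h1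
  have h2 : n k = 0 := Int.abs_lt_one_iff.1 (by exact_mod_cast h1)
  rw [hn, h2]; simp

/-- Mirror branches with prescribed value; they are local inverses of `v ↦ x (e (v))`. -/
theorem exists_mirrorBranch {v : Fin μ → ℂ} (hv : expQ v ∈ qSpace μ) :
    ∃ W : (Fin μ → ℂ) → Fin μ → ℂ, IsMirrorBranchAt W (mirrorMap (expQ v)) ∧
      W (mirrorMap (expQ v)) = v ∧ ∀ᶠ v' in 𝓝 v, W (mirrorMap (expQ v')) = v' := by
  obtain ⟨s, hs, hsq, hse⟩ := exists_local_section hv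
  set x₀ := mirrorMap (expQ v) with hx₀
  -- Dividing by the value at the base point keeps the argument of the principal logarithm near 1,
  -- so W is holomorphic with W(x₀) = v.
  let W : (Fin μ → ℂ) → Fin μ → ℂ := fun x k =>
    v k + (2 * Real.pi * Complex.I)⁻¹ * Complex.log (s x k / expQ v k)
  have hne := expQ_ne_zero v
  have hWx : W x₀ = v := by
    ext k
    simp only [W, hsq, div_self (hne k), Complex.log_one, mul_zero, add_zero]
  have hW : AnalyticAt ℂ W x₀ := by
    refine analyticAt_pi_iff.2 fun k => ?_
    refine analyticAt_const.add (analyticAt_const.mul ?_)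
    refine ((analyticAt_pi_iff.1 hs k).div analyticAt_const (hne k)).clog ?_
    change s x₀ k / expQ v k ∈ _
    rw [hsq, div_self (hne k)]; exact Complex.one_mem_slitPlane
  have hexp : ∀ x, s x ∈ qSpace μ → expQ (W x) = s x := fun x hx => by
    ext k
    simp only [W, expQ, mul_add, mul_inv_cancel_left₀ two_pi_I_ne_zero, Complex.exp_add]
    rw [Complex.exp_log (div_ne_zero (hx.1 k) (Complex.exp_ne_zero _)),
      mul_div_cancel₀ _ (Complex.exp_ne_zero _)]
  refine ⟨W, ⟨hW, ?_⟩, hWx, ?_⟩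
  · filter_upwards [hse] with x hx
    rw [hexp x hx.1]; exact hx
  · have hΦ : ContinuousAt (fun v' => mirrorMap (expQ v')) v :=
      ContinuousAt.comp (g := mirrorMap) (continuousAt_mirrorMap hv) continuous_expQ.continuousAt
    have hWΦ : ContinuousAt (fun v' => W (mirrorMap (expQ v'))) v :=
      ContinuousAt.comp (g := W) hW.continuousAt hΦ
    -- Closeness upgrades the equality of exponentials to equality, since an integral shift of norm
    -- less than 1 is zero.
    have e1 : ∀ᶠ v' in 𝓝 v, ‖W (mirrorMap (expQ v')) - v'‖ < 1 := by
      refine (hWΦ.sub continuousAt_id).norm.eventually_lt continuousAt_const ?_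
      change ‖W x₀ - v‖ < 1
      rw [hWx, sub_self, norm_zero]; exact one_pos
    filter_upwards [e1, continuous_expQ.continuousAt.eventually
      (eventually_section_mirrorMap hv hs.continuousAt hsq hse), hΦ.eventually hse] with v' h1 h2 h3
    exact expQ_injOn (by rw [hexp _ h3.1, h2]) h1

theorem IsMirrorBranchAt.eventually {W : (Fin μ → ℂ) → Fin μ → ℂ} {x₀ : Fin μ → ℂ}
    (h : IsMirrorBranchAt W x₀) : ∀ᶠ x in 𝓝 x₀, IsMirrorBranchAt W x := by
  filter_upwards [h.1.eventually_analyticAt, h.2.eventually_nhds] with x h1 h2 using ⟨h1, h2⟩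

theorem IsMirrorBranchAt.congr {W W' : (Fin μ → ℂ) → Fin μ → ℂ} {x₀ : Fin μ → ℂ}
    (h : IsMirrorBranchAt W x₀) (e : W =ᶠ[𝓝 x₀] W') : IsMirrorBranchAt W' x₀ := by
  refine ⟨h.1.congr e, ?_⟩
  filter_upwards [h.2, e] with x h1 h2
  rwa [← h2]

/-- A mirror branch is determined by its value at the base point. -/
theorem IsMirrorBranchAt.eventuallyEq {W W' : (Fin μ → ℂ) → Fin μ → ℂ} {x₀ : Fin μ → ℂ}
    (h : IsMirrorBranchAt W x₀) (h' : IsMirrorBranchAt W' x₀) (e : W x₀ = W' x₀) :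
    W =ᶠ[𝓝 x₀] W' := by
  have hv := h.2.self_of_nhds
  -- V is a left inverse of v ↦ x(e(v)) near the common value. Since W and W' are right inverses of
  -- that map, both coincide with V near x₀.
  obtain ⟨V, -, -, hV⟩ := exists_mirrorBranch hv.1
  filter_upwards [h.1.continuousAt.eventually hV, h'.1.continuousAt.eventually (e ▸ hV), h.2,
    h'.2] with x h1 h2 h3 h4
  rw [← h1, h3.2, ← h2, h4.2]

theorem analyticAt_partialSum {E : Type*} [NormedAddCommGroup E] [NormedSpace ℂ E]
    {q : E → Fin μ → ℂ} {x₀ : E} (hq : AnalyticAt ℂ q x₀) (j : Fin (μ + 1)) :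
    AnalyticAt ℂ (fun x => Fin.partialSum (q x) j) x₀ := by
  induction j using Fin.induction with
  | zero => simp only [Fin.partialSum_zero]; exact analyticAt_const
  | succ i ih => simp only [Fin.partialSum_succ]; exact ih.add (analyticAt_pi_iff.1 hq i)

theorem IsMirrorBranchAt.permW_add_int {W : (Fin μ → ℂ) → Fin μ → ℂ} {x₀ : Fin μ → ℂ}
    (h : IsMirrorBranchAt W x₀) (σ : Equiv.Perm (Fin (μ + 1))) (n : Fin μ → ℤ) :
    IsMirrorBranchAt (fun x k => permW σ (W x) k + (n k : ℂ)) x₀ := by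
  refine ⟨analyticAt_pi_iff.2 fun k => ?_, ?_⟩
  · exact ((analyticAt_partialSum h.1 _).sub (analyticAt_partialSum h.1 _)).add analyticAt_const
  · filter_upwards [h.2] with x hx
    rw [expQ_permW_add_int]
    exact ⟨permQ_mem_qSpace hx.1 σ, (mirrorMap_permQ hx.1.1 σ).trans hx.2⟩

/-! ### The mirror map is a covering -/

/-- The finite symmetric group acts freely and continuously on the locally compact space V. The
mirror map is open because it has local sections through every point, so it is the quotient map by
this action. -/
theorem isCoveringMap_mirrorMap : IsCoveringMap (mirrorMap_mapsTo (μ := μ)).restrict := by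
  let act : MulAction (Equiv.Perm (Fin (μ + 1))) (qSpace μ) :=
    { smul := fun σ q => ⟨permQ σ q.1, permQ_mem_qSpace q.2 σ⟩
      one_smul := fun q => Subtype.ext (permQ_one q.2.1)
      mul_smul := fun σ τ q => Subtype.ext (permQ_mul q.2.1 σ τ) }
  have hcs : ContinuousConstSMul (Equiv.Perm (Fin (μ + 1))) (qSpace μ) :=
    ⟨fun σ => Continuous.subtype_mk (continuous_iff_continuousAt.2 fun q =>
      ContinuousAt.comp (g := permQ σ) (analyticAt_permQ q.2.1 σ).continuousAt
        continuousAt_subtype_val) _⟩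
  have hfree : IsCancelSMul (Equiv.Perm (Fin (μ + 1))) (qSpace μ) :=
    { left_cancel' := fun σ _ _ h => MulAction.injective σ h
      right_cancel' := fun _ _ q h => permQ_injective q.2 (congrArg Subtype.val h) }
  have hlc : LocallyCompactSpace (qSpace μ) := isOpen_qSpace.locallyCompactSpace
  have hcont : Continuous (mirrorMap_mapsTo (μ := μ)).restrict :=
    Continuous.subtype_mk (continuous_iff_continuousAt.2 fun q =>
      ContinuousAt.comp (g := mirrorMap) (continuousAt_mirrorMap q.2) continuousAt_subtype_val) _
  have hsurj : Function.Surjective (mirrorMap_mapsTo (μ := μ)).restrict := fun x => by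
    obtain ⟨q, hq, h⟩ := exists_mirrorMap_eq x.2
    exact ⟨⟨q, hq⟩, Subtype.ext h⟩
  have hopen : IsOpenMap (mirrorMap_mapsTo (μ := μ)).restrict := by
    refine isOpenMap_iff_nhds_le.2 fun q N hN => ?_
    obtain ⟨s, hs, hsq, hse⟩ := exists_local_section q.2
    rw [mem_map, nhds_subtype, mem_comap] at hN
    obtain ⟨M, hM, hMN⟩ := hN
    rw [nhds_subtype, mem_comap]
    refine ⟨{x | s x ∈ M ∧ s x ∈ qSpace μ ∧ mirrorMap (s x) = x}, ?_, ?_⟩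
    · exact (hs.continuousAt.eventually (by rw [hsq]; exact hM)).and hse
    · rintro x ⟨h1, h2, h3⟩
      have := hMN (show (⟨s x, h2⟩ : qSpace μ) ∈ _ from h1)
      have e : Set.MapsTo.restrict mirrorMap _ _ mirrorMap_mapsTo ⟨s x, h2⟩ = x := Subtype.ext h3
      rw [← e]; exact this
  refine (IsQuotientMap.isQuotientCoveringMap_of_properlyDiscontinuousSMul
    (G := Equiv.Perm (Fin (μ + 1))) (hopen.isQuotientMap hcont hsurj) ?_).isCoveringMap
  intro e₁ e₂
  rw [MulAction.mem_orbit_iff, Subtype.ext_iff]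
  refine (eq_comm.trans (mirrorMap_eq_iff e₂.2 e₁.2)).trans (exists_congr fun σ => ?_)
  rw [Subtype.ext_iff]
  exact eq_comm

theorem surjective_mirrorMap : Function.Surjective (mirrorMap_mapsTo (μ := μ)).restrict :=
  fun x => by
    obtain ⟨q, hq, h⟩ := exists_mirrorMap_eq x.2
    exact ⟨⟨q, hq⟩, Subtype.ext h⟩

/-! ### Path connectedness -/

/-- The complement of the zero locus of an entire function is path connected. -/
theorem joinedIn_ne_zero_of_analytic {E : Type*} [NormedAddCommGroup E] [NormedSpace ℂ E]
    {g : E → ℂ} (hg : ∀ x, AnalyticAt ℂ g x) {x y : E} (hx : g x ≠ 0) (hy : g y ≠ 0) :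
    JoinedIn {z | g z ≠ 0} x y := by
  -- On the complex line through x and y, g restricts to an entire function of one variable that is
  -- not identically zero, so its zeros form a discrete, hence countable, set.
  let l : ℂ → E := fun z => x + z • (y - x)
  have hl : ∀ z, AnalyticAt ℂ l z := fun z => by
    have : Differentiable ℂ l := by fun_prop
    exact analyticAt_const.add (analyticAt_id.smul analyticAt_const)
  have hgl : AnalyticOnNhd ℂ (fun z => g (l z)) Set.univ := fun z _ =>
    AnalyticAt.comp (g := g) (hg _) (hl z)
  have h0 : l 0 = x := by simp [l]
  have h1 : l 1 = y := by simp [l]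
  have hcod := hgl.preimage_zero_mem_codiscrete (x := 0) (by simpa [h0] using hx)
  have hdisc : IsDiscrete ((fun z => g (l z)) ⁻¹' {0}) :=
    (isDiscrete_of_codiscreteWithin hcod).mono fun z hz => ⟨hz, trivial⟩
  have hcount : ((fun z => g (l z)) ⁻¹' {0}).Countable :=
    (HereditarilyLindelofSpace.isLindelof _).countable_of_isDiscrete hdisc
  -- The complement of a countable set in ℂ is path connected because the real dimension exceeds
  -- one.
  have hpc := hcount.isPathConnected_compl_of_one_lt_rank (by
    rw [Complex.rank_real_complex]; exact Nat.one_lt_ofNat)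
  have hj := hpc.joinedIn 0 (by simpa [h0] using hx) 1 (by simpa [h1] using hy)
  obtain ⟨γ, hγ⟩ := hj
  have hlc : Continuous l := continuous_iff_continuousAt.2 fun z => (hl z).continuousAt
  refine ⟨(γ.map hlc).cast h0.symm h1.symm, fun t => ?_⟩
  have := hγ t
  simpa using this

/-- An entire function that vanishes exactly off `e⁻¹(V)`. -/
def qSpaceFun (v : Fin μ → ℂ) : ℂ :=
  (∏ i, qCoeff (expQ v) i) * ∏ i : Fin (μ + 1), ∏ j : Fin (μ + 1),
    if i = j then 1 else Fin.partialProd (expQ v) i - Fin.partialProd (expQ v) j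

theorem qSpaceFun_ne_zero_iff (v : Fin μ → ℂ) : qSpaceFun v ≠ 0 ↔ expQ v ∈ qSpace μ := by
  simp only [qSpaceFun, ne_eq, mul_eq_zero, Finset.prod_eq_zero_iff, Finset.mem_univ, true_and,
    not_or, not_exists]
  constructor
  · rintro ⟨h1, h2⟩
    refine ⟨expQ_ne_zero v, fun i j hij => ?_, h1⟩
    by_contra hne
    have := h2 i j
    rw [if_neg hne] at this
    exact this (sub_eq_zero.2 hij)
  · intro h
    refine ⟨h.2.2, fun i j => ?_⟩
    split_ifs with hij
    · exact one_ne_zero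
    · exact sub_ne_zero.2 (h.2.1.ne hij)

theorem analyticAt_qSpaceFun (v : Fin μ → ℂ) : AnalyticAt ℂ (qSpaceFun (μ := μ)) v := by
  have he : ∀ k, AnalyticAt ℂ (fun v : Fin μ → ℂ => expQ v k) v :=
    analyticAt_pi_iff.1 (analyticAt_expQ analyticAt_id)
  refine AnalyticAt.mul ?_ ?_
  · exact Finset.analyticAt_fun_prod _ fun i _ => analyticAt_qCoeff he i
  · refine Finset.analyticAt_fun_prod _ fun i _ => Finset.analyticAt_fun_prod _ fun j _ => ?_
    split_ifs
    · exact analyticAt_const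
    · exact (analyticAt_partialProd he i).sub (analyticAt_partialProd he j)

/-- Joining points before exponentiating says more than connectedness of V: it also realises every
integral shift of the logarithms. -/
theorem joinedIn_expQ_mem_qSpace {v v' : Fin μ → ℂ} (hv : expQ v ∈ qSpace μ)
    (hv' : expQ v' ∈ qSpace μ) : JoinedIn {u | expQ u ∈ qSpace μ} v v' := by
  have := joinedIn_ne_zero_of_analytic (g := qSpaceFun (μ := μ)) analyticAt_qSpaceFun
    ((qSpaceFun_ne_zero_iff v).2 hv) ((qSpaceFun_ne_zero_iff v').2 hv')
  simpa only [qSpaceFun_ne_zero_iff] using this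

theorem isPathConnected_qSpace (hne : (qSpace μ).Nonempty) : IsPathConnected (qSpace μ) := by
  obtain ⟨q, hq⟩ := hne
  refine ⟨q, hq, fun {q'} hq' => ?_⟩
  obtain ⟨v, rfl⟩ := exists_expQ_eq hq.1
  obtain ⟨v', rfl⟩ := exists_expQ_eq hq'.1
  obtain ⟨γ, hγ⟩ := joinedIn_expQ_mem_qSpace hq hq'
  exact ⟨γ.map continuous_expQ, hγ⟩

/-! ### Analytic continuation -/

/-- A continuous family of values lifts to an analytic continuation by mirror branches. -/
theorem exists_isContinuationAlong {x₀ x₁ : Fin μ → ℂ} (γ : Path x₀ x₁)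
    {v : unitInterval → Fin μ → ℂ} (hv : Continuous v) (hvq : ∀ t, expQ (v t) ∈ qSpace μ)
    (hγ : ∀ t, mirrorMap (expQ (v t)) = γ t) :
    ∃ F, IsContinuationAlong γ F ∧ ∀ t, IsMirrorBranchAt (F t) (γ t) ∧ F t (γ t) = v t := by
  choose F hF hFv hFinv using fun t => exists_mirrorBranch (hvq t)
  simp only [hγ] at hF hFv
  refine ⟨F, fun t => ⟨(hF t).1, ?_⟩, fun t => ⟨hF t, hFv t⟩⟩
  -- For s near t the germ of F t at γ(s) already takes the value v(s), because F t inverts v ↦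
  -- x(e(v)) near v(t). A mirror branch is determined by its value, so F s and F t agree there.
  filter_upwards [hv.continuousAt.eventually (hFinv t),
    γ.continuous.continuousAt.eventually (hF t).eventually] with s h1 h2
  refine (hF s).eventuallyEq h2 ?_
  rw [hFv, ← hγ, h1]

/-- The parameters at which the two germs agree form an open and closed subset of the interval.
Closedness is the identity theorem on a ball around γ(t) where both germs are analytic. -/
theorem IsContinuationAlong.eventuallyEq {x₀ x₁ : Fin μ → ℂ} {γ : Path x₀ x₁}
    {F G : unitInterval → (Fin μ → ℂ) → Fin μ → ℂ} (hF : IsContinuationAlong γ F)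
    (hG : IsContinuationAlong γ G) (h0 : F 0 =ᶠ[𝓝 x₀] G 0) (t : unitInterval) :
    F t =ᶠ[𝓝 (γ t)] G t := by
  let A : Set unitInterval := {t | F t =ᶠ[𝓝 (γ t)] G t}
  have hopen : IsOpen A := isOpen_iff_mem_nhds.2 fun t ht => by
    filter_upwards [(hF t).2, (hG t).2, γ.continuous.continuousAt.eventually
      (Filter.Eventually.eventually_nhds ht)] with s h1 h2 h3
    exact h1.trans (EventuallyEq.trans h3 h2.symm)
  have hclosed : IsClosed A := isClosed_iff_clusterPt.2 fun t ht => by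
    have han := (hF t).1.eventually_analyticAt.and (hG t).1.eventually_analyticAt
    obtain ⟨ε, hε, hball⟩ := Metric.eventually_nhds_iff_ball.1 han
    have hev := (hF t).2.and ((hG t).2.and (γ.continuous.continuousAt.eventually
      (Metric.ball_mem_nhds (γ t) hε)))
    obtain ⟨s, ⟨h1, h2, h3⟩, h4⟩ := (clusterPt_principal_iff.1 ht) _ hev
    have heq : F t =ᶠ[𝓝 (γ s)] G t := h1.symm.trans (EventuallyEq.trans h4 h2)
    have := AnalyticOnNhd.eqOn_of_preconnected_of_eventuallyEq (fun x hx => (hball x hx).1)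
      (fun x hx => (hball x hx).2) (convex_ball (γ t) ε).isPreconnected h3 heq
    exact this.eventuallyEq_of_mem (Metric.ball_mem_nhds _ hε)
  have hA : A = Set.univ := IsClopen.eq_univ ⟨hclosed, hopen⟩ ⟨0, by simpa [A] using h0⟩
  have : t ∈ A := by rw [hA]; trivial
  exact this

/-- Paths off the discriminant lift through `v ↦ x (e (v))`. -/
theorem exists_lift {v₀ x₀ x₁ : Fin μ → ℂ} (hv₀ : expQ v₀ ∈ qSpace μ)
    (hx₀ : mirrorMap (expQ v₀) = x₀) (γ : Path x₀ x₁) (hγ : ∀ t, γ t ∈ xSpace μ) :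
    ∃ v : unitInterval → Fin μ → ℂ, Continuous v ∧ v 0 = v₀ ∧ (∀ t, expQ (v t) ∈ qSpace μ) ∧
      ∀ t, mirrorMap (expQ (v t)) = γ t := by
  let γ' : C(unitInterval, xSpace μ) := ⟨fun t => ⟨γ t, hγ t⟩, γ.continuous.subtype_mk _⟩
  obtain ⟨δ, hδ, hδ0⟩ := isCoveringMap_mirrorMap.exists_path_lifts γ' ⟨expQ v₀, hv₀⟩
    (Subtype.ext (by simp [γ', hx₀]))
  have hδγ : ∀ t, mirrorMap (δ t).1 = γ t := fun t => congrArg Subtype.val (congrFun hδ t)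
  -- After lifting through the mirror map, each coordinate of the lift avoids 0 and is lifted once
  -- more through the exponential covering of ℂ*.
  have hcomp : ∀ k : Fin μ, ∃ u : unitInterval → ℂ, Continuous u ∧
      u 0 = 2 * Real.pi * Complex.I * v₀ k ∧ ∀ t, Complex.exp (u t) = (δ t).1 k := fun k => by
    let η : C(unitInterval, {z : ℂ // z ≠ 0}) := ⟨fun t => ⟨(δ t).1 k, (δ t).2.1 k⟩,
      ((continuous_apply k).comp (continuous_subtype_val.comp δ.continuous)).subtype_mk _⟩
    obtain ⟨u, hu, hu0⟩ := Complex.isCoveringMap_exp.exists_path_lifts η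
      (2 * Real.pi * Complex.I * v₀ k) (Subtype.ext (by simp [η, hδ0, expQ]))
    exact ⟨u, u.continuous, hu0, fun t => congrArg Subtype.val (congrFun hu t)⟩
  choose u hu hu0 hue using hcomp
  have he : ∀ t, expQ (fun k => (2 * Real.pi * Complex.I)⁻¹ * u k t) = (δ t).1 := fun t => by
    ext k
    rw [expQ, mul_inv_cancel_left₀ two_pi_I_ne_zero, hue]
  refine ⟨fun t k => (2 * Real.pi * Complex.I)⁻¹ * u k t,
    continuous_pi fun k => continuous_const.mul (hu k), ?_, fun t => ?_, fun t => ?_⟩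
  · ext k; simp only [hu0]; rw [inv_mul_cancel_left₀ two_pi_I_ne_zero]
  · rw [he]; exact (δ t).2
  · rw [he]; exact hδγ t

theorem eq_of_mirrorMap_eq {δ δ' : unitInterval → Fin μ → ℂ} (hδ : Continuous δ)
    (hδ' : Continuous δ') (hq : ∀ t, δ t ∈ qSpace μ) (hq' : ∀ t, δ' t ∈ qSpace μ)
    (h : ∀ t, mirrorMap (δ t) = mirrorMap (δ' t)) (h0 : δ 0 = δ' 0) (t : unitInterval) :
    δ t = δ' t := by
  have := isCoveringMap_mirrorMap.eq_of_comp_eq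
    (g₁ := fun t => (⟨δ t, hq t⟩ : qSpace μ)) (g₂ := fun t => (⟨δ' t, hq' t⟩ : qSpace μ))
    (hδ.subtype_mk _) (hδ'.subtype_mk _) (funext fun t => Subtype.ext (h t)) 0 (Subtype.ext h0)
  exact congrArg Subtype.val (congrFun this t)

/-! ### Monodromy of a mirror branch -/

section Monodromy

variable {W : (Fin μ → ℂ) → Fin μ → ℂ} {x₀ : Fin μ → ℂ} (hW : IsMirrorBranchAt W x₀)
include hW

/-- A mirror branch continues along every path off the discriminant, by mirror branches. -/
theorem IsMirrorBranchAt.exists_continuation {x₁ : Fin μ → ℂ} (γ : Path x₀ x₁)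
    (hγ : ∀ t, γ t ∈ xSpace μ) : ∃ F, IsContinuationAlong γ F ∧ F 0 =ᶠ[𝓝 x₀] W ∧
      (∀ t, IsMirrorBranchAt (F t) (γ t)) ∧ Continuous fun t => F t (γ t) := by
  obtain ⟨hv, hx⟩ := hW.2.self_of_nhds
  obtain ⟨v, hvc, hv0, hvq, hvγ⟩ := exists_lift hv hx γ hγ
  obtain ⟨F, hF, hFv⟩ := exists_isContinuationAlong γ hvc hvq hvγ
  refine ⟨F, hF, ?_, fun t => (hFv t).1, by simpa only [(hFv _).2] using hvc⟩
  have h0 := hFv 0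
  rw [γ.source, hv0] at h0
  exact h0.1.eventuallyEq hW h0.2

/-- By uniqueness of continuation, any continuation agrees with the one built from a lifted path,
and so inherits its properties. -/
theorem IsMirrorBranchAt.continuation {x₁ : Fin μ → ℂ} {γ : Path x₀ x₁}
    (hγ : ∀ t, γ t ∈ xSpace μ) {F} (hF : IsContinuationAlong γ F) (h0 : F 0 =ᶠ[𝓝 x₀] W)  :
    (∀ t, IsMirrorBranchAt (F t) (γ t)) ∧ Continuous fun t => F t (γ t) := by
  obtain ⟨G, hG, hG0, hGb, hGc⟩ := hW.exists_continuation γ hγ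
  have h := hG.eventuallyEq hF (hG0.trans h0.symm)
  refine ⟨fun t => (hGb t).congr (h t), ?_⟩
  simpa only [(h _).eq_of_nhds] using hGc

/-- The final germ is again a mirror branch at x₀. Its exponential lies in the fibre of e(W(x₀)),
which yields σ, and the kernel of the exponential yields n. Freeness of the action on V makes σ, and
then n, unique. -/
theorem IsMirrorBranchAt.existsUnique_monodromy {γ : Path x₀ x₀} (hγ : ∀ t, γ t ∈ xSpace μ)
    {F} (hF : IsContinuationAlong γ F) (h0 : F 0 =ᶠ[𝓝 x₀] W) :
    ∃! p : Equiv.Perm (Fin (μ + 1)) × (Fin μ → ℤ),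
      F 1 =ᶠ[𝓝 x₀] fun x k => permW p.1 (W x) k + (p.2 k : ℂ) := by
  have h1 := (hW.continuation hγ hF h0).1 1
  rw [γ.target] at h1
  have hq := hW.2.self_of_nhds
  have hq1 := h1.2.self_of_nhds
  obtain ⟨σ, hσ⟩ := exists_permQ_of_mirrorMap_eq hq.1 hq1.1 (hq.2.trans hq1.2.symm)
  rw [← expQ_permW] at hσ
  obtain ⟨n, hn⟩ := exists_int_of_expQ_eq hσ
  refine ⟨(σ, n), h1.eventuallyEq (hW.permW_add_int σ n) (funext hn), ?_⟩
  rintro ⟨τ, m⟩ h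
  have hτ := h.eq_of_nhds
  have e : permQ τ (expQ (W x₀)) = permQ σ (expQ (W x₀)) := by
    rw [← expQ_permW_add_int τ _ m, ← hτ, hσ, expQ_permW]
  have hστ := permQ_injective hq.1 e
  subst hστ
  congr 1
  ext k
  have h2 := congrFun hτ k
  rw [hn] at h2
  exact (Int.cast_injective (add_left_cancel h2)).symm

/-- The path t ↦ e(F_t(γ(t))) is the unique lift of γ starting at e(W(x₀)). It closes up exactly
when F_1 and W have the same exponential at x₀, that is, differ by an integral shift. -/
theorem IsMirrorBranchAt.lift_loop_iff {γ : Path x₀ x₀} (hγ : ∀ t, γ t ∈ xSpace μ)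
    {F} (hF : IsContinuationAlong γ F) (h0 : F 0 =ᶠ[𝓝 x₀] W) :
    (∃ δ : Path (expQ (W x₀)) (expQ (W x₀)), ∀ t, δ t ∈ qSpace μ ∧ mirrorMap (δ t) = γ t) ↔
      ∃ n : Fin μ → ℤ, F 1 =ᶠ[𝓝 x₀] fun x k => W x k + (n k : ℂ) := by
  obtain ⟨hb, hc⟩ := hW.continuation hγ hF h0
  have hq := fun t => (hb t).2.self_of_nhds
  have hec : Continuous fun t => expQ (F t (γ t)) := continuous_expQ.comp hc
  have e0 : F 0 (γ 0) = W x₀ := by rw [γ.source]; exact h0.eq_of_nhds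
  have h1 := hb 1
  rw [γ.target] at h1
  constructor
  · rintro ⟨δ, hδ⟩
    have := eq_of_mirrorMap_eq hec δ.continuous (fun t => (hq t).1) (fun t => (hδ t).1)
      (fun t => (hq t).2.trans (hδ t).2.symm) (by rw [e0, δ.source]) 1
    rw [γ.target, δ.target] at this
    obtain ⟨n, hn⟩ := exists_int_of_expQ_eq this
    refine ⟨n, h1.eventuallyEq ?_ (funext hn)⟩
    have hone : ∀ v : Fin μ → ℂ, permW 1 v = v := fun v => by
      ext k; simp [permW, Fin.partialSum_succ]
    have := hW.permW_add_int 1 n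
    simpa only [hone] using this
  · rintro ⟨n, hn⟩
    refine ⟨⟨⟨fun t => expQ (F t (γ t)), hec⟩, ?_, ?_⟩, fun t => hq t⟩
    · simp only [e0]
    · simp only [γ.target, hn.eq_of_nhds, expQ_add_int]

/-- A path joining W(x₀) to σW(x₀) + n over V maps to a loop at x₀, since both ends lie over x₀, and
continuation along this loop follows the chosen path. -/
theorem IsMirrorBranchAt.exists_loop (σ : Equiv.Perm (Fin (μ + 1))) (n : Fin μ → ℤ) :
    ∃ γ : Path x₀ x₀, (∀ t, γ t ∈ xSpace μ) ∧ ∃ F, IsContinuationAlong γ F ∧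
      F 0 =ᶠ[𝓝 x₀] W ∧ F 1 =ᶠ[𝓝 x₀] fun x k => permW σ (W x) k + (n k : ℂ) := by
  have hq := hW.2.self_of_nhds
  have hW' := hW.permW_add_int σ n
  have hq' := hW'.2.self_of_nhds
  obtain ⟨v, hv⟩ := joinedIn_expQ_mem_qSpace hq.1 hq'.1
  have hc : Continuous fun t => mirrorMap (expQ (v t)) := continuous_iff_continuousAt.2 fun t =>
    ContinuousAt.comp (g := mirrorMap) (continuousAt_mirrorMap (hv t))
      (continuous_expQ.comp v.continuous).continuousAt
  let γ : Path x₀ x₀ := ⟨⟨fun t => mirrorMap (expQ (v t)), hc⟩, by simp only [v.source, hq.2], by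
    simp only [v.target, hq'.2]⟩
  obtain ⟨F, hF, hFv⟩ := exists_isContinuationAlong γ v.continuous hv fun t => rfl
  refine ⟨γ, fun t => mirrorMap_mapsTo (hv t), F, hF, ?_, ?_⟩
  · have h := hFv 0
    rw [γ.source, v.source] at h
    exact h.1.eventuallyEq hW h.2
  · have h := hFv 1
    rw [γ.target, v.target] at h
    exact h.1.eventuallyEq hW' h.2

end Monodromy

/-! ### Partial derivatives of analytic germs -/

section PartialDerivatives

variable {n : ℕ} {f g : (Fin n → ℂ) → ℂ} {a : Fin n → ℂ}

theorem partialD_congr (i : Fin n) (h : f =ᶠ[𝓝 a] g) : partialD i f =ᶠ[𝓝 a] partialD i g := by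
  filter_upwards [h.fderiv (𝕜 := ℂ)] with b hb
  rw [partialD, partialD, hb]

theorem analyticAt_partialD (i : Fin n) (hf : AnalyticAt ℂ f a) :
    AnalyticAt ℂ (partialD i f) a := by
  have h := hf.fderiv
  exact ((ContinuousLinearMap.apply ℂ ℂ (Pi.single i (1 : ℂ))).analyticAt _).comp h

theorem analyticAt_iterate_partialD (i : Fin n) (k : ℕ) (hf : AnalyticAt ℂ f a) :
    AnalyticAt ℂ ((partialD i)^[k] f) a := by
  induction k with
  | zero => exact hf
  | succ k ih => rw [Function.iterate_succ_apply']; exact analyticAt_partialD i ih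

theorem iterate_partialD_congr (i : Fin n) (k : ℕ) (h : f =ᶠ[𝓝 a] g) :
    (partialD i)^[k] f =ᶠ[𝓝 a] (partialD i)^[k] g := by
  induction k with
  | zero => exact h
  | succ k ih => rw [Function.iterate_succ_apply', Function.iterate_succ_apply']
                 exact partialD_congr i ih

theorem partialD_comm_apply (i j : Fin n) (hf : AnalyticAt ℂ f a) :
    partialD i (partialD j f) a = partialD j (partialD i f) a := by
  have hsymm : IsSymmSndFDerivAt ℂ f a := (hf.contDiffAt (n := ⊤)).isSymmSndFDerivAt (by simp)
  have e : ∀ i j : Fin n, partialD i (partialD j f) a =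
      fderiv ℂ (fderiv ℂ f) a (Pi.single i 1) (Pi.single j 1) := fun i j => by
    have h : HasFDerivAt (fderiv ℂ f) (fderiv ℂ (fderiv ℂ f) a) a :=
      hf.fderiv.differentiableAt.hasFDerivAt
    have h2 : HasFDerivAt (partialD j f) _ a :=
      h.clm_apply (hasFDerivAt_const (Pi.single j (1 : ℂ) : Fin n → ℂ) a)
    rw [partialD, h2.fderiv]
    simp
  rw [e, e, hsymm]

theorem partialD_comm (i j : Fin n) (hf : AnalyticAt ℂ f a) :
    partialD i (partialD j f) =ᶠ[𝓝 a] partialD j (partialD i f) := by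
  filter_upwards [hf.eventually_analyticAt] with b hb using partialD_comm_apply i j hb

theorem partialD_iterate_comm (i j : Fin n) (k : ℕ) (hf : AnalyticAt ℂ f a) :
    partialD i ((partialD j)^[k] f) =ᶠ[𝓝 a] (partialD j)^[k] (partialD i f) := by
  induction k with
  | zero => rfl
  | succ k ih =>
    rw [Function.iterate_succ_apply', Function.iterate_succ_apply']
    exact (partialD_comm i j (analyticAt_iterate_partialD j k hf)).trans (partialD_congr j ih)

theorem analyticAt_foldr (m : Fin n → ℕ) (l : List (Fin n)) (hf : AnalyticAt ℂ f a) :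
    AnalyticAt ℂ (l.foldr (fun i g => (partialD i)^[m i] g) f) a := by
  induction l with
  | nil => exact hf
  | cons j l ih => exact analyticAt_iterate_partialD j _ ih

theorem monomialD_zero : monomialD 0 f = f := by
  have : ∀ l : List (Fin n), l.foldr (fun i g => (partialD i)^[(0 : Fin n → ℕ) i] g) f = f := by
    intro l
    induction l with
    | nil => rfl
    | cons j l ih => rw [List.foldr_cons, ih]; rfl
  exact this _

theorem monomialD_congr (m : Fin n → ℕ) (h : f =ᶠ[𝓝 a] g) :
    monomialD m f =ᶠ[𝓝 a] monomialD m g := by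
  have : ∀ l : List (Fin n), l.foldr (fun i g => (partialD i)^[m i] g) f =ᶠ[𝓝 a]
      l.foldr (fun i g => (partialD i)^[m i] g) g := by
    intro l
    induction l with
    | nil => exact h
    | cons j l ih => exact iterate_partialD_congr j _ ih
  exact this _

/-- `monomialD` applies the derivatives in a fixed order, so the additional ∂_i must be moved past
those with earlier indices. This uses symmetry of second derivatives; as i occurs once in the list,
it is inserted once. -/
theorem monomialD_add_single (m : Fin n → ℕ) (i : Fin n) (hf : AnalyticAt ℂ f a) :
    monomialD (m + Pi.single i 1) f =ᶠ[𝓝 a] partialD i (monomialD m f) := by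
  have key : ∀ l : List (Fin n), l.Nodup →
      (i ∉ l → l.foldr (fun i' g => (partialD i')^[(m + Pi.single i 1 : Fin n → ℕ) i'] g) f =
        l.foldr (fun i' g => (partialD i')^[m i'] g) f) ∧
      (i ∈ l → l.foldr (fun i' g => (partialD i')^[(m + Pi.single i 1 : Fin n → ℕ) i'] g) f =ᶠ[𝓝 a]
        partialD i (l.foldr (fun i' g => (partialD i')^[m i'] g) f)) := by
    intro l
    induction l with
    | nil => intro _; exact ⟨fun _ => rfl, fun h => absurd h List.not_mem_nil⟩
    | cons j l ih =>
      intro hl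
      obtain ⟨hj, hl⟩ := List.nodup_cons.1 hl
      obtain ⟨ih1, ih2⟩ := ih hl
      simp only [List.foldr_cons]
      by_cases hij : j = i
      · subst hij
        refine ⟨fun h => absurd List.mem_cons_self h, fun _ => ?_⟩
        rw [ih1 hj, Pi.add_apply, Pi.single_eq_same, Function.iterate_succ_apply']
      · have hm : (m + Pi.single i 1 : Fin n → ℕ) j = m j := by simp [hij]
        rw [hm]
        refine ⟨fun h => by rw [ih1 fun h' => h (List.mem_cons_of_mem _ h')], fun h => ?_⟩
        have h' : i ∈ l := (List.mem_cons.1 h).resolve_left (Ne.symm hij)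
        exact (iterate_partialD_congr j _ (ih2 h')).trans
          (partialD_iterate_comm i j _ (analyticAt_foldr m l hf)).symm
  exact (key _ (List.nodup_finRange n)).2 (List.mem_finRange i)

theorem partialD_add (i : Fin n) (hf : AnalyticAt ℂ f a) (hg : AnalyticAt ℂ g a) :
    partialD i (fun b => f b + g b) =ᶠ[𝓝 a] fun b => partialD i f b + partialD i g b := by
  filter_upwards [hf.eventually_analyticAt, hg.eventually_analyticAt] with b h1 h2
  rw [partialD, fderiv_fun_add h1.differentiableAt h2.differentiableAt]
  rfl

theorem partialD_const_mul (i : Fin n) (c : ℂ) (hf : AnalyticAt ℂ f a) :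
    partialD i (fun b => c * f b) =ᶠ[𝓝 a] fun b => c * partialD i f b := by
  filter_upwards [hf.eventually_analyticAt] with b h1
  rw [partialD, fderiv_const_mul h1.differentiableAt]
  rfl

theorem partialD_mul_apply (i : Fin n) (hf : AnalyticAt ℂ f a) (hg : AnalyticAt ℂ g a) :
    partialD i (fun b => f b * g b) a = f a * partialD i g a + g a * partialD i f a := by
  rw [partialD, fderiv_fun_mul hf.differentiableAt hg.differentiableAt]
  rfl

theorem partialD_comp_apply (i : Fin n) {φ : ℂ → ℂ} {φ' : ℂ} (hφ : HasDerivAt φ φ' (f a))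
    (hf : AnalyticAt ℂ f a) : partialD i (fun b => φ (f b)) a = φ' * partialD i f a := by
  have h := hφ.comp_hasFDerivAt a hf.differentiableAt.hasFDerivAt
  have h2 : HasFDerivAt (fun b => φ (f b)) _ a := h
  rw [partialD, h2.fderiv]
  rfl

theorem partialD_const (i : Fin n) (c : ℂ) : partialD i (fun _ : Fin n → ℂ => c) = fun _ => 0 := by
  ext b; simp [partialD]

theorem partialD_sum_apply {ι : Type*} (s : Finset ι) {F : ι → (Fin n → ℂ) → ℂ} (i : Fin n)
    (hF : ∀ k ∈ s, AnalyticAt ℂ (F k) a) :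
    partialD i (fun b => ∑ k ∈ s, F k b) a = ∑ k ∈ s, partialD i (F k) a := by
  rw [partialD, fderiv_fun_sum fun k hk => (hF k hk).differentiableAt]
  simp [partialD]

theorem partialD_proj (i j : Fin n) (b : Fin n → ℂ) :
    partialD i (fun b : Fin n → ℂ => b j) b = if i = j then 1 else 0 := by
  have h : HasFDerivAt (fun b : Fin n → ℂ => b j)
      (ContinuousLinearMap.proj (R := ℂ) (φ := fun _ : Fin n => ℂ) j) b :=
    (ContinuousLinearMap.proj (R := ℂ) (φ := fun _ : Fin n => ℂ) j).hasFDerivAt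
  rw [partialD, h.fderiv]
  simp [Pi.single_apply, eq_comm]

theorem monomialD_linear (m : Fin n → ℕ) (c d : ℂ) (hf : AnalyticAt ℂ f a)
    (hg : AnalyticAt ℂ g a) : monomialD m (fun b => c * f b + d * g b) =ᶠ[𝓝 a]
      fun b => c * monomialD m f b + d * monomialD m g b := by
  have step : ∀ (i : Fin n) {f g : (Fin n → ℂ) → ℂ}, AnalyticAt ℂ f a → AnalyticAt ℂ g a →
      partialD i (fun b => c * f b + d * g b) =ᶠ[𝓝 a]
        fun b => c * partialD i f b + d * partialD i g b := fun i f g hf hg =>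
    (partialD_add i (analyticAt_const.mul hf) (analyticAt_const.mul hg)).trans
      ((partialD_const_mul i c hf).add (partialD_const_mul i d hg))
  have steps : ∀ (i : Fin n) (k : ℕ) {f g : (Fin n → ℂ) → ℂ}, AnalyticAt ℂ f a →
      AnalyticAt ℂ g a → (partialD i)^[k] (fun b => c * f b + d * g b) =ᶠ[𝓝 a]
        fun b => c * (partialD i)^[k] f b + d * (partialD i)^[k] g b := by
    intro i k f g hf hg
    induction k with
    | zero => rfl
    | succ k ih =>
      simp only [Function.iterate_succ_apply']
      exact (partialD_congr i ih).trans
        (step i (analyticAt_iterate_partialD i k hf) (analyticAt_iterate_partialD i k hg))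
  have : ∀ l : List (Fin n), l.foldr (fun i g => (partialD i)^[m i] g)
      (fun b => c * f b + d * g b) =ᶠ[𝓝 a] fun b =>
      c * l.foldr (fun i g => (partialD i)^[m i] g) f b +
      d * l.foldr (fun i g => (partialD i)^[m i] g) g b := by
    intro l
    induction l with
    | nil => rfl
    | cons j l ih => exact (iterate_partialD_congr j _ ih).trans
                      (steps j _ (analyticAt_foldr m l hf) (analyticAt_foldr m l hg))
  exact this _

theorem box_linear (l : Fin n → ℤ) (c d : ℂ) (hf : AnalyticAt ℂ f a) (hg : AnalyticAt ℂ g a) :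
    box l (fun b => c * f b + d * g b) a = c * box l f a + d * box l g a := by
  rw [box, box, box, (monomialD_linear _ c d hf hg).eq_of_nhds,
    (monomialD_linear _ c d hf hg).eq_of_nhds]
  ring

theorem box_congr (l : Fin n → ℤ) (h : f =ᶠ[𝓝 a] g) : box l f a = box l g a := by
  rw [box, box, (monomialD_congr _ h).eq_of_nhds, (monomialD_congr _ h).eq_of_nhds]

end PartialDerivatives

/-! ### The box operators -/

section Box

variable {f g ρ : (Fin (μ + 2) → ℂ) → ℂ} {a : Fin (μ + 2) → ℂ}

theorem mem_relationLattice_iff (l : Fin (μ + 2) → ℤ) :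
    l ∈ relationLattice μ ↔ ∑ i, l i = 0 ∧ ∑ i, l i * (i : ℤ) = 0 := by
  simp [relationLattice, nu, Prod.ext_iff, Prod.fst_sum, Prod.snd_sum]

/-- Both sides equal ρ^{m+i} ∂_0²g + (m+i) ρ^{m+i-1} ∂_0ρ ∂_0g at each nearby point. This lets any
∂_i be traded for ∂_0 at the cost of a factor ρ^i inside. -/
theorem partialD_pow_mul (hg : AnalyticAt ℂ g a) (hρ : AnalyticAt ℂ ρ a)
    (hgi : ∀ᶠ b in 𝓝 a, ∀ i : Fin (μ + 2), partialD i g b = ρ b ^ (i : ℕ) * partialD 0 g b)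
    (hρi : ∀ᶠ b in 𝓝 a, ∀ i : Fin (μ + 2), partialD i ρ b = ρ b ^ (i : ℕ) * partialD 0 ρ b)
    (m : ℕ) (i : Fin (μ + 2)) :
    partialD i (fun b => ρ b ^ m * partialD 0 g b) =ᶠ[𝓝 a]
      partialD 0 (fun b => ρ b ^ (m + i) * partialD 0 g b) := by
  filter_upwards [hg.eventually_analyticAt, hρ.eventually_analyticAt, hgi.eventually_nhds, hρi]
    with b hgb hρb hgib hρib
  have hg0 := analyticAt_partialD 0 hgb
  have hρp : ∀ m : ℕ, AnalyticAt ℂ (fun b => ρ b ^ m) b := fun m => hρb.pow m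
  have hpow : ∀ (m : ℕ) (i : Fin (μ + 2)), partialD i (fun b => ρ b ^ m) b =
      (m * ρ b ^ (m - 1)) * partialD i ρ b := fun m i =>
    partialD_comp_apply i (hasDerivAt_pow m (ρ b)) hρb
  have h1 : partialD i (partialD 0 g) b = ρ b ^ (i : ℕ) * partialD 0 (partialD 0 g) b +
      partialD 0 g b * ((i : ℕ) * ρ b ^ ((i : ℕ) - 1) * partialD 0 ρ b) := by
    rw [partialD_comm_apply i 0 hgb]
    have e : partialD i g =ᶠ[𝓝 b] fun b => ρ b ^ (i : ℕ) * partialD 0 g b := by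
      filter_upwards [hgib] with c hc using hc i
    rw [(partialD_congr 0 e).eq_of_nhds, partialD_mul_apply 0 (hρp _) hg0, hpow]
  rw [partialD_mul_apply i (hρp m) hg0, partialD_mul_apply 0 (hρp (m + i)) hg0, hpow, hpow, h1,
    hρib i]
  -- The cases deal with the truncated exponents m - 1 and i - 1, whose coefficients vanish when m
  -- or i is 0.
  rcases Nat.eq_zero_or_pos m with rfl | hm
  · rcases Nat.eq_zero_or_pos (i : ℕ) with hi | hi
    · simp [hi]
    · obtain ⟨k, hk⟩ : ∃ k, (i : ℕ) = k + 1 := ⟨_, (Nat.sub_add_cancel hi).symm⟩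
      simp [hk]
  · obtain ⟨p, rfl⟩ : ∃ p, m = p + 1 := ⟨_, (Nat.sub_add_cancel hm).symm⟩
    rcases Nat.eq_zero_or_pos (i : ℕ) with hi | hi
    · simp [hi]
    · obtain ⟨k, hk⟩ : ∃ k, (i : ℕ) = k + 1 := ⟨_, (Nat.sub_add_cancel hi).symm⟩
      simp only [hk, Nat.add_sub_cancel, ← Nat.add_assoc]
      push_cast
      ring

/-- Trading the derivatives one at a time for ∂_0 leaves an expression that sees only the order s +
1 and the weight ∑ i m_i. One ∂_0 stays inside, next to the power of ρ, which is why the order must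
be positive. -/
theorem monomialD_eq (hg : AnalyticAt ℂ g a) (hρ : AnalyticAt ℂ ρ a)
    (hgi : ∀ᶠ b in 𝓝 a, ∀ i : Fin (μ + 2), partialD i g b = ρ b ^ (i : ℕ) * partialD 0 g b)
    (hρi : ∀ᶠ b in 𝓝 a, ∀ i : Fin (μ + 2), partialD i ρ b = ρ b ^ (i : ℕ) * partialD 0 ρ b)
    (s : ℕ) (m : Fin (μ + 2) → ℕ) (hm : ∑ i, m i = s + 1) :
    monomialD m g =ᶠ[𝓝 a]
      (partialD 0)^[s] (fun b => ρ b ^ (∑ i, m i * (i : ℕ)) * partialD 0 g b) := by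
  induction s generalizing m with
  | zero =>
    obtain ⟨i, -, hi⟩ := Finset.exists_ne_zero_of_sum_ne_zero
      (s := Finset.univ) (f := m) (by rw [hm]; simp)
    have hle : ∀ j, m j ≤ (Pi.single i 1 : Fin (μ + 2) → ℕ) j := fun j => by
      by_cases hj : j = i
      · subst hj
        have := Finset.single_le_sum (f := m) (fun _ _ => Nat.zero_le _) (Finset.mem_univ j)
        simp; omega
      · have : m i + m j ≤ ∑ i, m i := by
          rw [← Finset.sum_pair (Ne.symm hj)]
          exact Finset.sum_le_sum_of_subset (Finset.subset_univ _)
        have : m j = 0 := by omega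
        simp [this]
    have hms : m = 0 + Pi.single i 1 := by
      ext j
      have h1 := hle j
      by_cases hj : j = i
      · subst hj; simp at h1 ⊢; omega
      · simp [hj] at h1 ⊢; omega
    have e := monomialD_add_single 0 i hg
    rw [← hms, monomialD_zero] at e
    refine e.trans ?_
    filter_upwards [hgi] with b hb
    rw [hb i, hms]
    simp [Pi.single_apply]
  | succ s ih =>
    obtain ⟨i, -, hi⟩ := Finset.exists_ne_zero_of_sum_ne_zero
      (s := Finset.univ) (f := m) (by rw [hm]; simp)
    obtain ⟨m', rfl⟩ : ∃ m' : Fin (μ + 2) → ℕ, m = m' + Pi.single i 1 := by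
      refine ⟨m - Pi.single i 1, ?_⟩
      ext j
      by_cases hj : j = i
      · subst hj; simp; omega
      · simp [hj]
    have hm' : ∑ i, m' i = s + 1 := by
      simp only [Pi.add_apply, Finset.sum_add_distrib] at hm
      simp at hm
      omega
    have hw : ∑ j, (m' + Pi.single i 1 : Fin (μ + 2) → ℕ) j * (j : ℕ) =
        ∑ j, m' j * (j : ℕ) + i := by
      simp [add_mul, Finset.sum_add_distrib, Pi.single_apply]
    have hg0 := analyticAt_partialD 0 hg
    rw [hw, Function.iterate_succ_apply]
    refine (monomialD_add_single m' i hg).trans ((partialD_congr i (ih m' hm')).trans ?_)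
    refine (partialD_iterate_comm i 0 s ((hρ.pow _).mul hg0)).trans ?_
    exact iterate_partialD_congr 0 s (partialD_pow_mul hg hρ hgi hρi _ i)

/-- Membership in the relation lattice says exactly that l⁺ and l⁻ have the same order and the same
weight, which are all that a monomial derivative of g depends on. -/
theorem box_eq_zero (hg : AnalyticAt ℂ g a) (hρ : AnalyticAt ℂ ρ a)
    (hgi : ∀ᶠ b in 𝓝 a, ∀ i : Fin (μ + 2), partialD i g b = ρ b ^ (i : ℕ) * partialD 0 g b)
    (hρi : ∀ᶠ b in 𝓝 a, ∀ i : Fin (μ + 2), partialD i ρ b = ρ b ^ (i : ℕ) * partialD 0 ρ b)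
    {l : Fin (μ + 2) → ℤ} (hl : l ∈ relationLattice μ) : box l g a = 0 := by
  obtain ⟨h1, h2⟩ := (mem_relationLattice_iff l).1 hl
  have hsub : ∀ i, ((l i).toNat : ℤ) - ((-l i).toNat : ℤ) = l i := fun i => by omega
  have hs : ∑ i, (l i).toNat = ∑ i, (-l i).toNat := by
    zify
    rw [← sub_eq_zero, ← Finset.sum_sub_distrib]
    simpa only [hsub] using h1
  have hw : ∑ i, (l i).toNat * (i : ℕ) = ∑ i, (-l i).toNat * (i : ℕ) := by
    zify
    rw [← sub_eq_zero, ← Finset.sum_sub_distrib]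
    simpa only [← sub_mul, hsub] using h2
  rw [box, sub_eq_zero]
  -- Order zero means l = 0, which `monomialD_eq` does not cover.
  rcases Nat.eq_zero_or_pos (∑ i, (l i).toNat) with h0 | h0
  · have h0' := hs ▸ h0
    rw [Finset.sum_eq_zero_iff] at h0 h0'
    have e1 : (fun i => (l i).toNat) = 0 := funext fun i => h0 i (Finset.mem_univ i)
    have e2 : (fun i => (-l i).toNat) = 0 := funext fun i => h0' i (Finset.mem_univ i)
    rw [e1, e2]
  · obtain ⟨s, hs'⟩ : ∃ s, ∑ i, (l i).toNat = s + 1 := ⟨_, (Nat.sub_add_cancel h0).symm⟩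
    rw [(monomialD_eq hg hρ hgi hρi s _ hs').eq_of_nhds,
      (monomialD_eq hg hρ hgi hρi s _ (hs ▸ hs')).eq_of_nhds, hw]

end Box

/-! ### Logarithms of roots solve the GKZ system up to a constant weight -/

theorem eval_derivative_fSigma (a : Fin (μ + 2) → ℂ) (z : ℂ) :
    (fSigma a).derivative.eval z = ∑ i : Fin (μ + 2), a i * ((i : ℕ) * z ^ ((i : ℕ) - 1)) := by
  simp only [fSigma, Polynomial.derivative_sum, Polynomial.derivative_C_mul,
    Polynomial.derivative_X_pow, Polynomial.eval_finsetSum, Polynomial.eval_mul,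
    Polynomial.eval_C, Polynomial.eval_pow, Polynomial.eval_X]

theorem analyticAt_proj {n : ℕ} (a : Fin n → ℂ) (i : Fin n) :
    AnalyticAt ℂ (fun b : Fin n → ℂ => b i) a := analyticAt_pi_iff.1 analyticAt_id i

section Root

variable {ρ : (Fin (μ + 2) → ℂ) → ℂ} {a : Fin (μ + 2) → ℂ}

theorem partialD_root (hρ : AnalyticAt ℂ ρ a) (h : ∀ᶠ b in 𝓝 a, (fSigma b).eval (ρ b) = 0)
    (i : Fin (μ + 2)) : (fSigma a).derivative.eval (ρ a) * partialD i ρ a = -ρ a ^ (i : ℕ) := by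
  have h1 : (fun b => ∑ m : Fin (μ + 2), b m * ρ b ^ (m : ℕ)) =ᶠ[𝓝 a] fun _ => 0 := by
    filter_upwards [h] with b hb
    rw [← eval_fSigma, hb]
  have hpow : ∀ m : ℕ, AnalyticAt ℂ (fun b => ρ b ^ m) a := fun m => hρ.pow m
  have h2 := (partialD_congr i h1).eq_of_nhds
  rw [partialD_const, partialD_sum_apply (F := fun m b => b m * ρ b ^ (m : ℕ)) _ _
    fun m _ => (analyticAt_proj a m).mul (hpow m)] at h2
  have e : ∀ m : Fin (μ + 2), partialD i (fun b => b m * ρ b ^ (m : ℕ)) a =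
      a m * ((m : ℕ) * ρ a ^ ((m : ℕ) - 1)) * partialD i ρ a +
        ρ a ^ (m : ℕ) * (if i = m then 1 else 0) := fun m => by
    rw [partialD_mul_apply i (analyticAt_proj a m) (hpow m), partialD_proj,
      partialD_comp_apply i (hasDerivAt_pow (m : ℕ) (ρ a)) hρ]
    ring
  simp only [e, Finset.sum_add_distrib, ← Finset.sum_mul, ← eval_derivative_fSigma, mul_ite,
    mul_one, mul_zero, Finset.sum_ite_eq, Finset.mem_univ, if_true] at h2
  linear_combination h2

variable (hρ : AnalyticAt ℂ ρ a) (h0 : ρ a ≠ 0)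
  (h : ∀ᶠ b in 𝓝 a, (fSigma b).eval (ρ b) = 0 ∧ (fSigma b).derivative.eval (ρ b) ≠ 0)
include hρ h0 h

omit h in
theorem analyticAt_log_root : AnalyticAt ℂ (fun b => Complex.log (ρ b / ρ a)) a := by
  have : AnalyticAt ℂ (fun b => ρ b / ρ a) a := hρ.div analyticAt_const h0
  refine this.clog ?_
  rw [div_self h0]; exact Complex.one_mem_slitPlane

-- Differentiating ∑ b_m ρ^m = 0 gives P'(ρ) ∂_i ρ = -ρ^i. At a simple root P'(ρ) cancels in the
-- comparison with i = 0.
omit h0 in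
theorem eventually_partialD_root : ∀ᶠ b in 𝓝 a, ∀ i : Fin (μ + 2),
    partialD i ρ b = ρ b ^ (i : ℕ) * partialD 0 ρ b := by
  filter_upwards [hρ.eventually_analyticAt, h.eventually_nhds] with b h1 h2 i
  have e := partialD_root h1 (h2.mono fun _ h => h.1)
  have ei := e i
  have e0 := e 0
  have hne := h2.self_of_nhds.2
  refine mul_left_cancel₀ hne ?_
  rw [ei]
  simp only [Fin.val_zero, pow_zero] at e0
  linear_combination -(ρ b ^ (i : ℕ)) * e0

omit h in
theorem eventually_partialD_log_root : ∀ᶠ b in 𝓝 a, ∀ i : Fin (μ + 2),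
    partialD i (fun b => Complex.log (ρ b / ρ a)) b = (ρ b)⁻¹ * partialD i ρ b := by
  have hs : ∀ᶠ b in 𝓝 a, ρ b / ρ a ∈ Complex.slitPlane := by
    refine (hρ.continuousAt.div_const (ρ a)).eventually (Complex.isOpen_slitPlane.mem_nhds ?_)
    change ρ a / ρ a ∈ _
    rw [div_self h0]; exact Complex.one_mem_slitPlane
  filter_upwards [hρ.eventually_analyticAt, hs, hρ.continuousAt.eventually_ne h0] with b h1 h2 h3 i
  have hd : HasDerivAt (fun z => Complex.log (z / ρ a)) ((1 / ρ a) / (ρ b / ρ a)) (ρ b) :=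
    ((hasDerivAt_id (ρ b)).div_const (ρ a)).clog h2
  rw [partialD_comp_apply i hd h1]
  congr 1
  field_simp

/-- The first Euler sum is a multiple of ∑ b_i ρ^i = 0. The second is P'(ρ) ∂_0ρ = -1, reflecting
that the roots scale by t⁻¹ under b_i ↦ t^i b_i. Hence a single logarithm is not a solution, but a
difference of two is. -/
theorem log_root_solution : ∀ᶠ b in 𝓝 a,
    (∀ l ∈ relationLattice μ, box l (fun b => Complex.log (ρ b / ρ a)) b = 0) ∧
    (∑ i : Fin (μ + 2), b i * partialD i (fun b => Complex.log (ρ b / ρ a)) b = 0) ∧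
    (∑ i : Fin (μ + 2), ((i : ℕ) : ℂ) *
      (b i * partialD i (fun b => Complex.log (ρ b / ρ a)) b) = -1) := by
  have hR := eventually_partialD_root hρ h
  have hL := eventually_partialD_log_root hρ h0
  have hgi : ∀ᶠ b in 𝓝 a, ∀ i : Fin (μ + 2),
      partialD i (fun b => Complex.log (ρ b / ρ a)) b =
        ρ b ^ (i : ℕ) * partialD 0 (fun b => Complex.log (ρ b / ρ a)) b := by
    filter_upwards [hR, hL] with b h1 h2 i
    rw [h2, h2, h1 i]; ring
  filter_upwards [hR.eventually_nhds, hgi.eventually_nhds, hρ.eventually_analyticAt,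
    (analyticAt_log_root hρ h0).eventually_analyticAt, h.eventually_nhds, hL,
    hρ.continuousAt.eventually_ne h0] with b h1 h2 h3 h4 h5 h6 h7
  refine ⟨fun l hl => box_eq_zero h4 h3 h2 h1 hl, ?_, ?_⟩
  · have e : ∀ i : Fin (μ + 2), b i * partialD i (fun b => Complex.log (ρ b / ρ a)) b =
        (b i * ρ b ^ (i : ℕ)) * partialD 0 (fun b => Complex.log (ρ b / ρ a)) b := fun i => by
      rw [h2.self_of_nhds i]; ring
    rw [Finset.sum_congr rfl fun i _ => e i, ← Finset.sum_mul, ← eval_fSigma, h5.self_of_nhds.1, zero_mul]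
  · have e0 := partialD_root h3 (h5.mono fun _ h => h.1) 0
    have e : ∀ i : Fin (μ + 2), ((i : ℕ) : ℂ) *
        (b i * partialD i (fun b => Complex.log (ρ b / ρ a)) b) =
        (b i * ((i : ℕ) * ρ b ^ ((i : ℕ) - 1))) * partialD 0 ρ b := fun i => by
      rw [h6, h1.self_of_nhds i]
      rcases Nat.eq_zero_or_pos (i : ℕ) with hi | hi
      · simp [hi]
      · obtain ⟨k, hk⟩ : ∃ k, (i : ℕ) = k + 1 := ⟨_, (Nat.sub_add_cancel hi).symm⟩
        rw [hk, Nat.add_sub_cancel, pow_succ]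
        field_simp
    simp only [e, ← Finset.sum_mul]
    rw [← eval_derivative_fSigma, e0]
    simp

end Root

/-! ### Mirror branches solve the GKZ system -/

section Closure

variable {f g : (Fin (μ + 2) → ℂ) → ℂ} {a : Fin (μ + 2) → ℂ}

theorem IsGKZSolutionAt.congr (hf : IsGKZSolutionAt f a) (e : f =ᶠ[𝓝 a] g) :
    IsGKZSolutionAt g a := by
  refine ⟨hf.1.congr e, ?_⟩
  filter_upwards [hf.2, e.eventually_nhds] with b hb he
  have hp : ∀ i, partialD i g b = partialD i f b := fun i =>
    (partialD_congr i (show f =ᶠ[𝓝 b] g from he)).eq_of_nhds.symm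
  refine ⟨fun l hl => ?_, ?_, ?_⟩
  · rw [← box_congr l (show f =ᶠ[𝓝 b] g from he)]; exact hb.1 l hl
  · simpa only [hp] using hb.2.1
  · simpa only [hp] using hb.2.2

theorem partialD_linear_apply {n : ℕ} {f g : (Fin n → ℂ) → ℂ} {a : Fin n → ℂ}
    (c d : ℂ) (hf : AnalyticAt ℂ f a)
    (hg : AnalyticAt ℂ g a) (i : Fin n) :
    partialD i (fun b => c * f b + d * g b) a = c * partialD i f a + d * partialD i g a := by
  rw [(partialD_add (f := fun b => c * f b) (g := fun b => d * g b) i (analyticAt_const.mul hf)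
    (analyticAt_const.mul hg)).eq_of_nhds, (partialD_const_mul i c hf).eq_of_nhds, (partialD_const_mul i d hg).eq_of_nhds]

theorem IsGKZSolutionAt.linear (hf : IsGKZSolutionAt f a) (hg : IsGKZSolutionAt g a) (c d : ℂ) :
    IsGKZSolutionAt (fun b => c * f b + d * g b) a := by
  refine ⟨(analyticAt_const.mul hf.1).add (analyticAt_const.mul hg.1), ?_⟩
  filter_upwards [hf.2, hg.2, hf.1.eventually_analyticAt, hg.1.eventually_analyticAt]
    with b h1 h2 h3 h4
  refine ⟨fun l hl => by rw [box_linear l c d h3 h4, h1.1 l hl, h2.1 l hl]; simp, ?_, ?_⟩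
  · have e : ∀ i, b i * partialD i (fun b => c * f b + d * g b) b =
        c * (b i * partialD i f b) + d * (b i * partialD i g b) := fun i => by
      rw [partialD_linear_apply c d h3 h4]; ring
    simp only [e, Finset.sum_add_distrib, ← Finset.mul_sum, h1.2.1, h2.2.1]; simp
  · have e : ∀ i : Fin (μ + 2), ((i : ℕ) : ℂ) *
        (b i * partialD i (fun b => c * f b + d * g b) b) =
        c * (((i : ℕ) : ℂ) * (b i * partialD i f b)) +
        d * (((i : ℕ) : ℂ) * (b i * partialD i g b)) := fun i => by
      rw [partialD_linear_apply c d h3 h4]; ring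
    simp only [e, Finset.sum_add_distrib, ← Finset.mul_sum, h1.2.2, h2.2.2]; simp

theorem isGKZSolutionAt_const (c : ℂ) : IsGKZSolutionAt (fun _ : Fin (μ + 2) → ℂ => c) a := by
  refine ⟨analyticAt_const, Eventually.of_forall fun b => ⟨fun l hl => ?_, ?_, ?_⟩⟩
  · exact box_eq_zero (ρ := fun _ => 0) analyticAt_const analyticAt_const
      (Eventually.of_forall fun b i => by simp [partialD_const])
      (Eventually.of_forall fun b i => by simp [partialD_const]) hl
  · simp [partialD_const]
  · simp [partialD_const]

theorem isGKZSolutionAt_combination {ι : Type*} (s : Finset ι) {F : ι → (Fin (μ + 2) → ℂ) → ℂ}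
    (hF : ∀ k, IsGKZSolutionAt (F k) a) (c : ℂ) (d : ι → ℂ) :
    IsGKZSolutionAt (fun b => c + ∑ k ∈ s, d k * F k b) a := by
  classical
  induction s using Finset.induction with
  | empty => simpa using isGKZSolutionAt_const c
  | insert k s hk ih =>
    refine (ih.linear (hF k) 1 (d k)).congr (Eventually.of_forall fun b => ?_)
    simp only [Finset.sum_insert hk]; ring

end Closure

/-- The root parameters near a point of the regular locus that are attached to a mirror branch. -/
theorem exists_root_germs {a : Fin (μ + 2) → ℂ} (ha : a ∈ regularLocus μ)
    {W : (Fin μ → ℂ) → Fin μ → ℂ} (hW : IsMirrorBranchAt W (xCoord a)) :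
    ∃ r : (Fin (μ + 2) → ℂ) → Fin (μ + 1) → ℂ, (∀ j, AnalyticAt ℂ (fun b => r b j) a) ∧
      ∀ᶠ b in 𝓝 a, (∀ j, r b j ≠ 0) ∧ (∀ j, (fSigma b).eval (-1 / r b j) = 0 ∧
        (fSigma b).derivative.eval (-1 / r b j) ≠ 0) ∧ ratio (r b) = expQ (W (xCoord b)) := by
  have hx : AnalyticAt ℂ (xCoord (μ := μ)) a := analyticAt_xCoord (analyticAt_proj a) ha.1
  have hWx : AnalyticAt ℂ (fun b => W (xCoord b)) a := AnalyticAt.comp (g := W) hW.1 hx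
  have hq : ∀ k, AnalyticAt ℂ (fun b => expQ (W (xCoord b)) k) a :=
    analyticAt_pi_iff.1 (analyticAt_expQ hWx)
  have hqa := hW.2.self_of_nhds.1
  -- The scalar is the t in b_i = s t^i a_i(q), read off from the entries 0 and 1 and a_0(q) = 1.
  -- The root parameters of b are then t λ_j.
  refine ⟨fun b j => b 1 / (b 0 * qCoeff (expQ (W (xCoord b))) 1) *
    Fin.partialProd (expQ (W (xCoord b))) j, fun j => ?_, ?_⟩
  · refine AnalyticAt.mul ?_ (analyticAt_partialProd hq j)
    exact (analyticAt_proj a 1).div ((analyticAt_proj a 0).mul (analyticAt_qCoeff hq 1))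
      (mul_ne_zero (ha.1 0) (hqa.2.2 1))
  · have hne : ∀ᶠ b in 𝓝 a, ∀ i, b i ≠ 0 := eventually_all.2 fun i =>
      (continuous_apply i).continuousAt.eventually_ne (ha.1 i)
    filter_upwards [hne, hx.continuousAt.eventually hW.2] with b hb hWb
    obtain ⟨hQ, hm⟩ := hWb
    generalize hQd : expQ (W (xCoord b)) = q at *
    have hlam := partialProd_ne_zero hQ.1
    obtain ⟨s, t, hs, ht, hst⟩ := eq_scale_of_xCoord_eq hb hQ.2.2 hm.symm
    have hs0 : b 0 = s := by
      rw [hst 0, qCoeff_eq, rootCoeff_zero]; simp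
    have ht0 : b 1 / (b 0 * qCoeff q 1) = t := by
      rw [hs0, hst 1]
      have := hQ.2.2 1
      simp only [Fin.val_one, pow_one]
      field_simp
    simp only [ht0]
    have hr0 : ∀ j, t * Fin.partialProd q j ≠ 0 := fun j => mul_ne_zero ht (hlam j)
    have hpoly : fSigma b = Polynomial.C s * prodPoly fun j => t * Fin.partialProd q j := by
      refine fSigma_eq_of_coeff ((Polynomial.natDegree_C_mul_le _ _).trans
        (natDegree_prodPoly_le _)) fun i => ?_
      rw [Polynomial.coeff_C_mul]
      exact (hst i).trans (by rw [qCoeff_eq, ← rootCoeff_smul]; rfl)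
    have hsep : (fSigma b).Separable := by
      rw [hpoly]
      exact (separable_prodPoly fun i j hij => hQ.2.1 (mul_left_cancel₀ ht hij)).unit_mul
        (Polynomial.isUnit_C.2 hs.isUnit)
    have hroot : ∀ j, (fSigma b).eval (-1 / (t * Fin.partialProd q j)) = 0 := fun j => by
      rw [hpoly, Polynomial.eval_mul, eval_prodPoly, Finset.prod_eq_zero (Finset.mem_univ j),
        mul_zero]
      have := hr0 j
      have h1 : t * Fin.partialProd q j * (-1 / (t * Fin.partialProd q j)) = -1 :=
        mul_div_cancel₀ _ this
      rw [h1]; ring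
    refine ⟨hr0, fun j => ⟨hroot j, eval_derivative_ne_zero hsep (hroot j)⟩, ?_⟩
    rw [← ratio_partialProd hQ.1]
    ext k
    simp only [ratio]
    rw [mul_div_mul_left _ _ ht, ratio_partialProd hQ.1]

/-- Up to a constant, 2πi W_k is a difference of logarithms of two roots, so the two values -1 of
the second Euler operator cancel. -/
theorem isGKZSolutionAt_mirrorBranch {a : Fin (μ + 2) → ℂ} (ha : a ∈ regularLocus μ)
    {W : (Fin μ → ℂ) → Fin μ → ℂ} (hW : IsMirrorBranchAt W (xCoord a)) (k : Fin μ) :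
    IsGKZSolutionAt (fun b => W (xCoord b) k) a := by
  obtain ⟨r, hr, hre⟩ := exists_root_germs ha hW
  have hra := hre.self_of_nhds
  have hρ : ∀ j, AnalyticAt ℂ (fun b => -1 / r b j) a := fun j =>
    analyticAt_const.div (hr j) (hra.1 j)
  have hρ0 : ∀ j, -1 / r a j ≠ 0 := fun j => div_ne_zero (by norm_num) (hra.1 j)
  have hsol := fun j => log_root_solution (hρ j) (hρ0 j) (hre.mono fun b hb => hb.2.1 j)
  have hlog := fun j => analyticAt_log_root (hρ j) (hρ0 j)
  set g : Fin (μ + 1) → (Fin (μ + 2) → ℂ) → ℂ :=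
    fun j b => Complex.log ((-1 / r b j) / (-1 / r a j)) with hg
  have hx : AnalyticAt ℂ (xCoord (μ := μ)) a := analyticAt_xCoord (analyticAt_proj a) ha.1
  have hWx : AnalyticAt ℂ (fun b => W (xCoord b)) a := AnalyticAt.comp (g := W) hW.1 hx
  -- The roots are -1/r_j, so log r_{k+1} - log r_k is the logarithm of root k minus that of root k
  -- + 1. V is this candidate normalised to agree with W at a; it has the same exponential, so it
  -- equals W nearby.
  let V : (Fin (μ + 2) → ℂ) → Fin μ → ℂ := fun b k => W (xCoord a) k +
    (2 * Real.pi * Complex.I)⁻¹ * (g k.castSucc b - g k.succ b)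
  have hga : ∀ j, g j a = 0 := fun j => by simp only [hg, div_self (hρ0 j), Complex.log_one]
  have hVa : V a = W (xCoord a) := by ext k; simp [V, hga]
  have hVan : AnalyticAt ℂ V a := analyticAt_pi_iff.2 fun k =>
    analyticAt_const.add (analyticAt_const.mul ((hlog _).sub (hlog _)))
  have hexp : ∀ᶠ b in 𝓝 a, expQ (V b) = expQ (W (xCoord b)) := by
    filter_upwards [hre] with b hb
    rw [← hb.2.2]
    ext k
    have h1 := hb.1 k.castSucc; have h2 := hb.1 k.succ
    have h3 := hra.1 k.castSucc; have h4 := hra.1 k.succ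
    have e1 : ∀ j, Complex.exp (g j b) = (-1 / r b j) / (-1 / r a j) := fun j =>
      Complex.exp_log (div_ne_zero (div_ne_zero (by norm_num) (hb.1 j)) (hρ0 j))
    have e2 : Complex.exp (2 * Real.pi * Complex.I * W (xCoord a) k) =
        r a k.succ / r a k.castSucc := (congrFun hra.2.2 k).symm
    simp only [expQ, V, mul_add, mul_inv_cancel_left₀ two_pi_I_ne_zero, Complex.exp_add,
      Complex.exp_sub, e1, e2, ratio]
    field_simp
  have heq : ∀ᶠ b in 𝓝 a, V b = W (xCoord b) := by
    have hsmall : ∀ᶠ b in 𝓝 a, ‖V b - W (xCoord b)‖ < 1 := by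
      refine (hVan.continuousAt.sub hWx.continuousAt).norm.eventually_lt continuousAt_const ?_
      change ‖V a - W (xCoord a)‖ < 1
      rw [hVa, sub_self, norm_zero]; exact one_pos
    filter_upwards [hexp, hsmall] with b h1 h2 using expQ_injOn h1 h2
  have hdiff : IsGKZSolutionAt (fun b => 1 * g k.castSucc b + (-1) * g k.succ b) a := by
    refine ⟨(analyticAt_const.mul (hlog _)).add (analyticAt_const.mul (hlog _)), ?_⟩
    filter_upwards [hsol k.castSucc, hsol k.succ, (hlog k.castSucc).eventually_analyticAt,
      (hlog k.succ).eventually_analyticAt] with b h1 h2 h3 h4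
    refine ⟨fun l hl => ?_, ?_, ?_⟩
    · rw [box_linear l 1 (-1) h3 h4, h1.1 l hl, h2.1 l hl]; simp
    · have e : ∀ i, b i * partialD i (fun b => 1 * g k.castSucc b + (-1) * g k.succ b) b =
          (b i * partialD i (g k.castSucc) b) - (b i * partialD i (g k.succ) b) := fun i => by
        rw [partialD_linear_apply 1 (-1) h3 h4]; ring
      simp only [e, Finset.sum_sub_distrib]
      rw [h1.2.1, h2.2.1, sub_zero]
    · have e : ∀ i : Fin (μ + 2), ((i : ℕ) : ℂ) *
          (b i * partialD i (fun b => 1 * g k.castSucc b + (-1) * g k.succ b) b) =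
          ((i : ℕ) : ℂ) * (b i * partialD i (g k.castSucc) b) -
          ((i : ℕ) : ℂ) * (b i * partialD i (g k.succ) b) := fun i => by
        rw [partialD_linear_apply 1 (-1) h3 h4]; ring
      simp only [e, Finset.sum_sub_distrib]
      rw [h1.2.2, h2.2.2, sub_self]
  refine ((isGKZSolutionAt_const (W (xCoord a) k)).linear hdiff 1
    (2 * Real.pi * Complex.I)⁻¹).congr ?_
  filter_upwards [heq] with b hb
  rw [← hb]
  simp only [V]; ring

/-! ### The solution space has dimension at most `μ + 1` -/

section Pfaffian

-- P = ∑ a_i X^i is coprime to X P', because P is separable and P(0) ≠ 0. Reducing the cofactor of X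
-- P' modulo P bounds its degree, and comparing degrees then bounds the cofactor of P as long as m ≤
-- 2(μ+1).
open Polynomial in
theorem exists_bezout_X_pow {a : Fin (μ + 2) → ℂ} (ha : a ∈ regularLocus μ) {m : ℕ}
    (hm : m ≤ 2 * (μ + 1)) : ∃ A B : ℂ[X], A.natDegree ≤ μ + 1 ∧ B.natDegree ≤ μ + 1 ∧
      X ^ m = A * fSigma a + B * (X * derivative (fSigma a)) := by
  set P := fSigma a with hP
  have hdeg : P.natDegree = μ + 1 := natDegree_fSigma ha.1
  have hP0 : P ≠ 0 := ne_zero_of_natDegree_gt (n := 0) (by omega)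
  have hc : IsCoprime P (X * derivative P) := by
    refine IsCoprime.mul_right ?_ ha.2
    have hX : IsCoprime (X : ℂ[X]) P :=
      (Polynomial.irreducible_X.coprime_iff_not_dvd).2 fun h => by
        rw [X_dvd_iff] at h
        exact ha.1 0 ((coeff_fSigma a 0).symm.trans h)
    exact hX.symm
  obtain ⟨u, v, huv⟩ := hc
  have hB : (v * X ^ m % P).natDegree < μ + 1 := by
    have := natDegree_mod_lt (v * X ^ m) (q := P) (by omega)
    omega
  have hdm := EuclideanDomain.div_add_mod (v * X ^ m) P
  have hQ : (X * derivative P).natDegree ≤ μ + 1 := by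
    refine natDegree_mul_le.trans ?_
    have := natDegree_derivative_lt (p := P) (by omega)
    rw [natDegree_X]; omega
  refine ⟨u * X ^ m + (v * X ^ m / P) * (X * derivative P), v * X ^ m % P, ?_, hB.le, ?_⟩
  · set A := u * X ^ m + (v * X ^ m / P) * (X * derivative P) with hA
    have key : A * P = X ^ m - (v * X ^ m % P) * (X * derivative P) := by
      linear_combination X ^ m * huv + X * derivative P * hdm
    by_cases hA0 : A = 0
    · rw [hA0]; simp
    · have h1 := natDegree_mul hA0 hP0
      have h2 : (A * P).natDegree ≤ 2 * (μ + 1) := by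
        rw [key]
        refine (natDegree_sub_le _ _).trans (max_le ?_ ?_)
        · rw [natDegree_X_pow]; exact hm
        · refine natDegree_mul_le.trans ?_
          omega
      omega
  · linear_combination -X ^ m * huv - X * derivative P * hdm

open Polynomial in
/-- The Hankel-type system attached to a regular point can be solved for the unknowns `g m`. -/
theorem exists_hankel_coeff {a : Fin (μ + 2) → ℂ} (ha : a ∈ regularLocus μ) :
    ∃ α β : ℕ → Fin (μ + 2) → ℂ, ∀ (g : ℕ → ℂ) (m : ℕ), m ≤ 2 * (μ + 1) →
      g m = ∑ j, α m j * (∑ i : Fin (μ + 2), a i * g (i + j)) +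
        ∑ j, β m j * (∑ i : Fin (μ + 2), ((i : ℕ) : ℂ) * (a i * g (i + j))) := by
  have hex : ∀ m : ℕ, ∃ A B : ℂ[X], m ≤ 2 * (μ + 1) → A.natDegree ≤ μ + 1 ∧
      B.natDegree ≤ μ + 1 ∧ X ^ m = A * fSigma a + B * (X * derivative (fSigma a)) := fun m => by
    by_cases hm : m ≤ 2 * (μ + 1)
    · obtain ⟨A, B, h⟩ := exists_bezout_X_pow ha hm
      exact ⟨A, B, fun _ => h⟩
    · exact ⟨0, 0, fun h => absurd h hm⟩
  choose A B hAB using hex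
  refine ⟨fun m j => (A m).coeff j, fun m j => (B m).coeff j, fun g m hm => ?_⟩
  obtain ⟨hA, hB, hX⟩ := hAB m hm
  -- The functional X^n ↦ g_n turns the Bézout identity for X^m into the desired expression for g_m.
  let G : ℂ[X] →ₗ[ℂ] ℂ := Polynomial.lsum fun n => g n • LinearMap.id
  have hG : ∀ (c : ℂ) (n : ℕ), G (C c * X ^ n) = c * g n := fun c n => by
    rw [C_mul_X_pow_eq_monomial]
    simp [G, Polynomial.lsum_apply, Polynomial.sum_monomial_index, mul_comm]
  have hexp : ∀ D : ℂ[X], D.natDegree ≤ μ + 1 →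
      D = ∑ j : Fin (μ + 2), C (D.coeff j) * X ^ (j : ℕ) := fun D hD =>
    (fSigma_eq_of_coeff (a := fun i => D.coeff i) hD fun _ => rfl).symm
  have hder : X * derivative (fSigma a) =
      ∑ i : Fin (μ + 2), C (((i : ℕ) : ℂ) * a i) * X ^ (i : ℕ) := by
    rw [fSigma, derivative_sum, Finset.mul_sum]
    refine Finset.sum_congr rfl fun i _ => ?_
    rw [derivative_C_mul_X_pow]
    rcases Nat.eq_zero_or_pos (i : ℕ) with hi | hi
    · simp [hi]
    · obtain ⟨k, hk⟩ : ∃ k, (i : ℕ) = k + 1 := ⟨_, (Nat.sub_add_cancel hi).symm⟩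
      simp only [hk, Nat.add_sub_cancel, pow_succ, C_mul]
      ring
  have hmul : ∀ (D : ℂ[X]) (d : Fin (μ + 2) → ℂ), D.natDegree ≤ μ + 1 →
      G (D * ∑ i : Fin (μ + 2), C (d i) * X ^ (i : ℕ)) =
        ∑ j : Fin (μ + 2), D.coeff j * ∑ i : Fin (μ + 2), d i * g (i + j) := fun D d hD => by
    conv_lhs => rw [hexp D hD]
    rw [Finset.sum_mul_sum, map_sum]
    refine Finset.sum_congr rfl fun j _ => ?_
    rw [map_sum, Finset.mul_sum]
    refine Finset.sum_congr rfl fun i _ => ?_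
    have : C (D.coeff j) * X ^ (j : ℕ) * (C (d i) * X ^ (i : ℕ)) =
        C (D.coeff j * d i) * X ^ ((i : ℕ) + j) := by
      rw [C_mul, pow_add]; ring
    rw [this, hG]; ring
  have h1 : g m = G (X ^ m) := by
    have := hG 1 m
    simpa using this.symm
  rw [h1, hX, map_add, hder]
  have h2 := hmul (A m) a hA
  have h3 := hmul (B m) (fun i => ((i : ℕ) : ℂ) * a i) hB
  change G (A m * fSigma a) = _ at h2
  rw [h2, h3]
  simp only [mul_assoc]

variable {f : (Fin (μ + 2) → ℂ) → ℂ} {a : Fin (μ + 2) → ℂ}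

theorem monomialD_pair (hf : AnalyticAt ℂ f a) (i j : Fin (μ + 2)) :
    monomialD (Pi.single i 1 + Pi.single j 1) f a = partialD i (partialD j f) a := by
  rw [add_comm (Pi.single i 1 : Fin (μ + 2) → ℕ), (monomialD_add_single _ i hf).eq_of_nhds]
  have h := monomialD_add_single 0 j hf
  rw [zero_add, monomialD_zero] at h
  exact (partialD_congr i h).eq_of_nhds

/-- The box operators force the second derivatives to depend only on the sum of the indices. -/
theorem partialD_pair_eq (hf : AnalyticAt ℂ f a) (hbox : ∀ l ∈ relationLattice μ, box l f a = 0)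
    {i j k l : Fin (μ + 2)} (h : (i : ℕ) + j = k + l) :
    partialD i (partialD j f) a = partialD k (partialD l f) a := by
  by_cases hik : i = k
  · have : j = l := Fin.ext (by rw [hik] at h; omega)
    rw [hik, this]
  by_cases hil : i = l
  · have : j = k := Fin.ext (by rw [hil] at h; omega)
    rw [hil, this, partialD_comm_apply _ _ hf]
  have hjk : j ≠ k := fun e => hil (Fin.ext (by rw [e] at h; omega))
  have hjl : j ≠ l := fun e => hik (Fin.ext (by rw [e] at h; omega))
  -- This is the relation e_i + e_j - e_k - e_l. Once the coincidences are excluded, {i, j} and {k,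
  -- l} are disjoint, so no cancellation disturbs its positive and negative parts.
  let L : Fin (μ + 2) → ℤ := fun p => ((Pi.single i 1 + Pi.single j 1 : Fin (μ + 2) → ℕ) p : ℤ) -
    ((Pi.single k 1 + Pi.single l 1 : Fin (μ + 2) → ℕ) p : ℤ)
  have hs : ∀ p q : Fin (μ + 2), ((Pi.single p 1 : Fin (μ + 2) → ℕ) q) = if q = p then 1 else 0 :=
    fun p q => Pi.single_apply p 1 q
  have hL : L ∈ relationLattice μ := by
    rw [mem_relationLattice_iff]
    constructor
    · simp [L, Finset.sum_sub_distrib, Finset.sum_add_distrib, hs]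
    · simp only [L, sub_mul, Finset.sum_sub_distrib, Pi.add_apply, Nat.cast_add, add_mul,
        Finset.sum_add_distrib, hs, Nat.cast_ite, Nat.cast_one, Nat.cast_zero, ite_mul, one_mul,
        zero_mul, Finset.sum_ite_eq', Finset.mem_univ, if_true]
      omega
  have e1 : (fun p => (L p).toNat) = Pi.single i 1 + Pi.single j 1 := by
    ext p
    simp only [L, Pi.add_apply, hs]
    by_cases h1 : p = i
    · subst h1; simp only [if_true, if_neg hik, if_neg hil]; omega
    · by_cases h2 : p = j
      · subst h2; simp only [if_true, if_neg hjk, if_neg hjl]; omega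
      · simp only [if_neg h1, if_neg h2]; omega
  have e2 : (fun p => (-L p).toNat) = Pi.single k 1 + Pi.single l 1 := by
    ext p
    simp only [L, Pi.add_apply, hs]
    by_cases h1 : p = i
    · subst h1; simp only [if_true, if_neg hik, if_neg hil]; omega
    · by_cases h2 : p = j
      · subst h2; simp only [if_true, if_neg hjk, if_neg hjl]; omega
      · simp only [if_neg h1, if_neg h2]; omega
  have := hbox L hL
  rw [box, e1, e2, monomialD_pair hf, monomialD_pair hf, sub_eq_zero] at this
  exact this

/-- The derivatives of the Euler equations. -/
theorem partialD_euler (hf : AnalyticAt ℂ f a) (c : Fin (μ + 2) → ℂ)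
    (h : ∀ᶠ b in 𝓝 a, ∑ i, c i * (b i * partialD i f b) = 0) (j : Fin (μ + 2)) :
    ∑ i, c i * (a i * partialD i (partialD j f) a) = -(c j * partialD j f a) := by
  have h1 : (fun b => ∑ i, c i * (b i * partialD i f b)) =ᶠ[𝓝 a] fun _ => 0 := h
  have h2 := (partialD_congr j h1).eq_of_nhds
  have hp := fun i => analyticAt_partialD i hf
  have han : ∀ i, AnalyticAt ℂ (fun b => b i * partialD i f b) a := fun i =>
    (analyticAt_proj a i).mul (hp i)
  rw [partialD_const, partialD_sum_apply (F := fun i b => c i * (b i * partialD i f b)) _ _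
    fun i _ => analyticAt_const.mul (han i)] at h2
  have e : ∀ i, partialD j (fun b => c i * (b i * partialD i f b)) a =
      c i * (a i * partialD i (partialD j f) a) + c i * (partialD i f a * if j = i then 1 else 0) :=
    fun i => by
      rw [(partialD_const_mul j (c i) (han i)).eq_of_nhds,
        partialD_mul_apply j (analyticAt_proj a i) (hp i), partialD_proj,
        partialD_comm_apply j i hf]
      ring
  simp only [e, Finset.sum_add_distrib, mul_ite, mul_one, mul_zero, Finset.sum_ite_eq,
    Finset.mem_univ, if_true] at h2
  linear_combination h2

/-- The vector of first derivatives. -/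
def gradient {n : ℕ} (f : (Fin n → ℂ) → ℂ) (b : Fin n → ℂ) : Fin n → ℂ := fun i => partialD i f b

/-- Near a regular point the second derivatives of a solution are bounded by the first ones. -/
theorem exists_bound_second (ha : a ∈ regularLocus μ) (hf : IsGKZSolutionAt f a) :
    ∃ K : ℝ, ∀ᶠ b in 𝓝 a, ∀ i j : Fin (μ + 2),
      ‖partialD i (partialD j f) b‖ ≤ K * ‖gradient f b‖ := by
  obtain ⟨α, β, hαβ⟩ := exists_hankel_coeff ha
  set n : ℝ := (μ : ℝ) + 2 with hn
  have hn0 : 0 < n := by positivity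
  let K : ℝ := ∑ m ∈ Finset.range (2 * (μ + 1) + 1), (∑ j, ‖α m j‖ + ∑ j, ‖β m j‖) * n
  have hK0 : 0 ≤ K := by positivity
  -- The linear system is inverted only at a. Replacing its coefficients b by a costs an error
  -- proportional to ‖a - b‖, and this bound allows the error to be absorbed.
  have hsmall : ∀ᶠ b in 𝓝 a, K * (n * ‖a - b‖) ≤ 1 / 2 := by
    have : Tendsto (fun b => K * (n * ‖a - b‖)) (𝓝 a) (𝓝 (K * (n * ‖a - a‖))) :=
      (Continuous.tendsto (by fun_prop) a)
    rw [sub_self, norm_zero, mul_zero, mul_zero] at this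
    exact (this.eventually_lt_const (by norm_num : (0 : ℝ) < 1 / 2)).mono fun _ h => h.le
  refine ⟨2 * K, ?_⟩
  filter_upwards [hsmall, hf.1.eventually_analyticAt, hf.2.eventually_nhds] with b hb hfb hsol
  obtain ⟨hbox, -, -⟩ := hsol.self_of_nhds
  -- For m ≤ 2(μ+1) the indices `ix m` and `ix (m - ix m)` add up to m, so g m represents all second
  -- derivatives of index sum m.
  let ix : ℕ → Fin (μ + 2) := fun m => ⟨min m (μ + 1), by omega⟩
  let g : ℕ → ℂ := fun m => partialD (ix m) (partialD (ix (m - ix m)) f) b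
  have hg : ∀ i j : Fin (μ + 2), partialD i (partialD j f) b = g ((i : ℕ) + j) := fun i j => by
    refine partialD_pair_eq hfb hbox ?_
    simp only [ix]
    omega
  let M : ℝ := ‖fun m : Fin (2 * (μ + 1) + 1) => g m‖
  let N : ℝ := ‖gradient f b‖
  have hM : ∀ m : ℕ, m ≤ 2 * (μ + 1) → ‖g m‖ ≤ M := fun m hm =>
    norm_le_pi_norm (fun m : Fin (2 * (μ + 1) + 1) => g m) ⟨m, by omega⟩
  have hN : ∀ j, ‖partialD j f b‖ ≤ N := fun j => norm_le_pi_norm (gradient f b) j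
  have hM0 : 0 ≤ M := norm_nonneg _
  have hN0 : 0 ≤ N := norm_nonneg _
  have hrow : ∀ (c : Fin (μ + 2) → ℂ), (∀ i, ‖c i‖ ≤ n) →
      (∀ᶠ b in 𝓝 b, ∑ i, c i * (b i * partialD i f b) = 0) → ∀ j : Fin (μ + 2),
      ‖∑ i, c i * (a i * g (i + j))‖ ≤ n * (N + n * ‖a - b‖ * M) := by
    intro c hc hE j
    have h1 := partialD_euler hfb c hE j
    simp only [hg] at h1
    have h2 : ∑ i, c i * (a i * g (i + j)) =
        -(c j * partialD j f b) + ∑ i, c i * ((a i - b i) * g (i + j)) := by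
      rw [← h1, ← Finset.sum_add_distrib]
      refine Finset.sum_congr rfl fun i _ => ?_
      ring
    rw [h2]
    refine (norm_add_le _ _).trans ?_
    rw [norm_neg, norm_mul, mul_add]
    refine add_le_add (mul_le_mul (hc j) (hN j) (norm_nonneg _) hn0.le) ?_
    refine (norm_sum_le _ _).trans ?_
    have h3 : ∀ i : Fin (μ + 2), ‖c i * ((a i - b i) * g (i + j))‖ ≤ n * (‖a - b‖ * M) :=
      fun i => by
        rw [norm_mul, norm_mul]
        have h4 : ‖a i - b i‖ ≤ ‖a - b‖ := norm_le_pi_norm (a - b) i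
        have h5 := hM (i + j) (by omega)
        gcongr
        exact hc i
    refine (Finset.sum_le_card_nsmul _ _ _ fun i _ => h3 i).trans (le_of_eq ?_)
    simp only [Finset.card_univ, Fintype.card_fin, nsmul_eq_mul, hn]
    push_cast
    ring
  have hE1 := hrow (fun _ => 1) (fun i => by
    rw [norm_one, hn]; have : (0 : ℝ) ≤ μ := Nat.cast_nonneg _; linarith) (by
      filter_upwards [hsol] with b hb
      simpa only [one_mul] using hb.2.1)
  have hE2 := hrow (fun i => ((i : ℕ) : ℂ)) (fun i => by
    rw [Complex.norm_natCast, hn]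
    have : (i : ℕ) ≤ μ + 2 := i.2.le
    exact_mod_cast this) (by
      filter_upwards [hsol] with b hb using hb.2.2)
  simp only [one_mul] at hE1
  have hgm : ∀ m : ℕ, m ≤ 2 * (μ + 1) → ‖g m‖ ≤ K * (N + n * ‖a - b‖ * M) := fun m hm => by
    have hS : 0 ≤ N + n * ‖a - b‖ * M := by positivity
    have hKm : (∑ j, ‖α m j‖ + ∑ j, ‖β m j‖) * n ≤ K :=
      Finset.single_le_sum (f := fun m => (∑ j, ‖α m j‖ + ∑ j, ‖β m j‖) * n)
        (fun _ _ => by positivity) (Finset.mem_range.2 (by omega))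
    refine le_trans ?_ (mul_le_mul_of_nonneg_right hKm hS)
    rw [hαβ g m hm]
    refine (norm_add_le _ _).trans ?_
    rw [mul_assoc, add_mul, Finset.sum_mul, Finset.sum_mul]
    refine add_le_add ((norm_sum_le _ _).trans (Finset.sum_le_sum fun j _ => ?_))
      ((norm_sum_le _ _).trans (Finset.sum_le_sum fun j _ => ?_))
    · rw [norm_mul]
      exact mul_le_mul_of_nonneg_left (hE1 j) (norm_nonneg _)
    · rw [norm_mul]
      exact mul_le_mul_of_nonneg_left (hE2 j) (norm_nonneg _)
  have hMK : M ≤ K * (N + n * ‖a - b‖ * M) :=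
    (pi_norm_le_iff_of_nonneg (by positivity)).2 fun m => hgm m (by omega)
  -- M ≤ K N + M/2, so the second term is absorbed on the left.
  have hMN : M ≤ 2 * K * N := by
    have : K * (n * ‖a - b‖) * M ≤ 1 / 2 * M := mul_le_mul_of_nonneg_right hb hM0
    nlinarith
  intro i j
  rw [hg]
  exact (hM _ (by omega)).trans hMN

/-- A solution at a regular point with vanishing value and vanishing first derivatives vanishes. -/
theorem IsGKZSolutionAt.eq_zero (ha : a ∈ regularLocus μ) (hf : IsGKZSolutionAt f a)
    (h0 : f a = 0) (h1 : ∀ i, partialD i f a = 0) : f =ᶠ[𝓝 a] fun _ => 0 := by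
  obtain ⟨K, hK⟩ := exists_bound_second ha hf
  obtain ⟨ε, hε, hball⟩ := Metric.eventually_nhds_iff_ball.1 (hK.and hf.1.eventually_analyticAt)
  have hgrad : ∀ b ∈ Metric.ball a ε, gradient f b = 0 := by
    intro b hb
    -- Along the segment from a to b the gradient satisfies a linear differential inequality with
    -- zero initial value, so it vanishes by Grönwall's inequality.
    let c : ℝ → Fin (μ + 2) → ℂ := fun t => a + (t : ℂ) • (b - a)
    have hc : ∀ t ∈ Set.Icc (0 : ℝ) 1, c t ∈ Metric.ball a ε := fun t ht => by
      rw [mem_ball_iff_norm] at hb ⊢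
      simp only [c, add_sub_cancel_left, norm_smul, Complex.norm_real, Real.norm_eq_abs,
        abs_of_nonneg ht.1]
      exact (mul_le_of_le_one_left (norm_nonneg _) ht.2).trans_lt hb
    have hcd : ∀ t, HasDerivAt c (b - a) t := fun t => by
      have := ((hasDerivAt_id t).ofReal_comp.smul_const (b - a)).const_add a
      rwa [Complex.ofReal_one, one_smul] at this
    have hderiv : ∀ t ∈ Set.Icc (0 : ℝ) 1, HasDerivAt (fun t => gradient f (c t))
        (fun j => ∑ i, (b - a) i * partialD i (partialD j f) (c t)) t := fun t ht => by
      refine hasDerivAt_pi.2 fun j => ?_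
      have han := analyticAt_partialD j (hball _ (hc t ht)).2
      have hF : HasFDerivAt (partialD j f) ((fderiv ℂ (partialD j f) (c t)).restrictScalars ℝ)
        (c t) := han.differentiableAt.hasFDerivAt.restrictScalars ℝ
      have h2 := hF.comp_hasDerivAt t (hcd t)
      suffices e : fderiv ℂ (partialD j f) (c t) (b - a) =
          ∑ i, (b - a) i * partialD i (partialD j f) (c t) by
        rw [← e]; exact h2
      conv_lhs => rw [pi_eq_sum_univ' (b - a)]
      rw [map_sum]
      refine Finset.sum_congr rfl fun i _ => ?_
      rw [map_smul, smul_eq_mul, partialD]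
    have hz := eq_zero_of_abs_deriv_le_mul_abs_self_of_eq_zero_right
      (f := fun t => gradient f (c t)) (K := (μ + 2) * ‖b - a‖ * K) (a := 0) (b := 1)
      (fun t ht => (hderiv t ht).continuousAt.continuousWithinAt)
      (fun t ht => (hderiv t ⟨ht.1, ht.2.le⟩).hasDerivWithinAt)
      (by ext i; simp [c, gradient, h1 i]) (fun t ht => by
        have hbd := (hball _ (hc t ⟨ht.1, ht.2.le⟩)).1
        -- The sign of K is not given; nonnegativity of the product is read off from the bound
        -- itself.
        have hKg : 0 ≤ K * ‖gradient f (c t)‖ := (norm_nonneg _).trans (hbd 0 0)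
        refine (pi_norm_le_iff_of_nonneg (by rw [mul_assoc]; positivity)).2 fun j => ?_
        refine (norm_sum_le _ _).trans ((Finset.sum_le_card_nsmul _ _
          (‖b - a‖ * (K * ‖gradient f (c t)‖)) fun i _ => ?_).trans (le_of_eq ?_))
        · rw [norm_mul]
          exact mul_le_mul (norm_le_pi_norm (b - a) i) (hbd i j) (norm_nonneg _) (norm_nonneg _)
        · simp only [Finset.card_univ, Fintype.card_fin, nsmul_eq_mul]
          push_cast
          ring) 1 ⟨zero_le_one, le_rfl⟩
    simpa [c] using hz
  have hfd : ∀ b ∈ Metric.ball a ε, fderiv ℂ f b = 0 := fun b hb => by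
    ext v
    rw [pi_eq_sum_univ' v, map_sum]
    refine Finset.sum_eq_zero fun i _ => ?_
    rw [map_smul]
    have := congrFun (hgrad b hb) i
    simp only [gradient, partialD, Pi.zero_apply] at this
    rw [this, smul_zero]
  filter_upwards [Metric.ball_mem_nhds a hε] with b hb
  rw [← h0]
  exact Metric.isOpen_ball.is_const_of_fderiv_eq_zero (convex_ball a ε).isPreconnected
    (fun b hb => (hball b hb).2.differentiableAt.differentiableWithinAt) hfd hb
    (Metric.mem_ball_self hε)

end Pfaffian

/-! ### The solution space is spanned by `1` and the mirror coordinates -/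

/-- The kernel of the differential of the coordinates is spanned by the torus directions. -/
theorem exists_of_fderiv_xCoord_eq_zero {a : Fin (μ + 2) → ℂ} (ha : ∀ i, a i ≠ 0)
    {u : Fin (μ + 2) → ℂ} (hu : fderiv ℂ (xCoord (μ := μ)) a u = 0) :
    ∃ A B : ℂ, ∀ i : Fin (μ + 2), u i = A * a i + B * ((i : ℕ) * a i) := by
  have hx : AnalyticAt ℂ (xCoord (μ := μ)) a := analyticAt_xCoord (analyticAt_proj a) ha
  have hline : HasDerivAt (fun s : ℂ => a + s • u) u 0 := by
    have := ((hasDerivAt_id (0 : ℂ)).smul_const u).const_add a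
    rwa [one_smul] at this
  have hxa : HasFDerivAt (xCoord (μ := μ)) (fderiv ℂ (xCoord (μ := μ)) a) (a + (0 : ℂ) • u) := by
    rw [zero_smul, add_zero]; exact hx.differentiableAt.hasFDerivAt
  have hcomp := hxa.comp_hasDerivAt (0 : ℂ) hline
  rw [hu] at hcomp
  -- Logarithmic differentiation of x_k: the second differences of u_i / a_i vanish, so this
  -- sequence is an arithmetic progression.
  have hrec : ∀ k : Fin μ, u k.castSucc.castSucc / a k.castSucc.castSucc +
      u k.succ.succ / a k.succ.succ = 2 * (u k.succ.castSucc / a k.succ.castSucc) := fun k => by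
    have h1 := hasDerivAt_pi.1 hcomp k
    have hl : ∀ i, HasDerivAt (fun s : ℂ => a i + s * u i) (u i) 0 := fun i =>
      hasDerivAt_pi.1 hline i
    have hne := ha k.succ.castSucc
    have h2 := ((hl k.castSucc.castSucc).mul (hl k.succ.succ)).div ((hl k.succ.castSucc).pow 2)
      (by simpa using hne)
    have h3 := h1.unique h2
    simp only [Pi.zero_apply, zero_mul, add_zero, Pi.mul_apply, Pi.pow_apply] at h3
    have hp := ha k.castSucc.castSucc
    have hs := ha k.succ.succ
    rw [eq_comm, div_eq_zero_iff] at h3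
    have h4 := h3.resolve_right (by positivity)
    push_cast at h4
    field_simp
    refine mul_left_cancel₀ hne ?_
    linear_combination h4
  refine ⟨u 0 / a 0, u 1 / a 1 - u 0 / a 0, ?_⟩
  have key : ∀ n : ℕ, ∀ (h0 : n < μ + 2), u ⟨n, h0⟩ / a ⟨n, h0⟩ =
      u 0 / a 0 + n * (u 1 / a 1 - u 0 / a 0) := by
    intro n
    induction n using Nat.strong_induction_on with
    | _ n ih =>
      intro hn
      match n, hn with
      | 0, _ => simp
      | 1, _ =>
        have : (⟨1, by omega⟩ : Fin (μ + 2)) = 1 := by ext; simp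
        rw [this]; simp
      | k + 2, hn =>
        have h1 := ih (k + 1) (by omega) (by omega)
        have h2 := ih k (by omega) (by omega)
        have h3 := hrec ⟨k, by omega⟩
        have c1 : (⟨k, by omega⟩ : Fin μ).castSucc.castSucc = ⟨k, by omega⟩ := rfl
        have c2 : (⟨k, by omega⟩ : Fin μ).succ.castSucc = ⟨k + 1, by omega⟩ := rfl
        have c3 : (⟨k, by omega⟩ : Fin μ).succ.succ = ⟨k + 2, by omega⟩ := rfl
        rw [c1, c2, c3, h1, h2] at h3
        push_cast at h3 ⊢
        linear_combination h3
  intro i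
  have h1 := key i i.2
  rw [div_eq_iff (ha _)] at h1
  rw [show u i = _ from h1]
  ring

theorem sum_fderiv_apply {n : ℕ} (ℓ : (Fin n → ℂ) →L[ℂ] ℂ) (u : Fin n → ℂ) :
    ℓ u = ∑ i, u i * ℓ (Pi.single i 1) := by
  conv_lhs => rw [pi_eq_sum_univ' u]
  rw [map_sum]
  exact Finset.sum_congr rfl fun i _ => by rw [map_smul, smul_eq_mul]

/-- The Euler equations say that df kills the torus directions, so df at a factors through dx. As W
is a local coordinate system on x-space, some combination of 1 and the W_k has the same value and
gradient as f, and therefore equals f. Uniqueness holds because an affine function vanishing near a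
point is zero. -/
theorem isGKZSolutionAt_iff {a : Fin (μ + 2) → ℂ} (ha : a ∈ regularLocus μ)
    {W : (Fin μ → ℂ) → Fin μ → ℂ} (hW : IsMirrorBranchAt W (xCoord a))
    (f : (Fin (μ + 2) → ℂ) → ℂ) : IsGKZSolutionAt f a ↔
      ∃! c : ℂ × (Fin μ → ℂ), f =ᶠ[𝓝 a] fun b => c.1 + ∑ k, c.2 k * W (xCoord b) k := by
  have hx : AnalyticAt ℂ (xCoord (μ := μ)) a := analyticAt_xCoord (analyticAt_proj a) ha.1
  obtain ⟨β, hβ, hβa, hβe⟩ := exists_xCoord_section ha.1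
  have hcomb : ∀ (c₀ : ℂ) (c : Fin μ → ℂ),
      IsGKZSolutionAt (fun b => c₀ + ∑ k, c k * W (xCoord b) k) a := fun c₀ c =>
    isGKZSolutionAt_combination Finset.univ (isGKZSolutionAt_mirrorBranch ha hW) c₀ c
  constructor
  · intro hf
    set x₀ := xCoord a with hx₀
    set v₀ := W x₀ with hv₀
    have hq₀ := hW.2.self_of_nhds
    rw [← hv₀] at hq₀
    have hΦ : AnalyticAt ℂ (fun v : Fin μ → ℂ => mirrorMap (expQ v)) v₀ :=
      analyticAt_mirrorMap (analyticAt_pi_iff.1 (analyticAt_expQ analyticAt_id)) hq₀.1.2.2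
    have hT := hx.differentiableAt.hasFDerivAt
    set T := fderiv ℂ (xCoord (μ := μ)) a
    have hS := hβ.differentiableAt.hasFDerivAt
    set S := fderiv ℂ β x₀
    have hL := hW.1.differentiableAt.hasFDerivAt
    set L := fderiv ℂ W x₀
    have hD := hΦ.differentiableAt.hasFDerivAt
    set D := fderiv ℂ (fun v : Fin μ → ℂ => mirrorMap (expQ v)) v₀
    have hTS : ∀ y, T (S y) = y := fun y => by
      have h1 : HasFDerivAt (fun x => xCoord (β x)) (T.comp S) x₀ :=
        HasFDerivAt.comp (g := xCoord (μ := μ)) x₀ (by rw [hβa]; exact hT) hS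
      have h2 : HasFDerivAt (fun x => xCoord (β x)) (ContinuousLinearMap.id ℂ _) x₀ :=
        (hasFDerivAt_id x₀).congr_of_eventuallyEq (hβe.mono fun x hx => hx.2)
      exact congrArg (fun F => F y) (h1.unique h2)
    have hDL : ∀ y, D (L y) = y := fun y => by
      have h1 : HasFDerivAt (fun x => mirrorMap (expQ (W x))) (D.comp L) x₀ :=
        HasFDerivAt.comp x₀ hD hL
      have h2 : HasFDerivAt (fun x => mirrorMap (expQ (W x))) (ContinuousLinearMap.id ℂ _) x₀ :=
        (hasFDerivAt_id x₀).congr_of_eventuallyEq (hW.2.mono fun x hx => hx.2)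
      exact congrArg (fun F => F y) (h1.unique h2)
    set ℓ := fderiv ℂ f a with hℓ
    have hker : ∀ u, T u = 0 → ℓ u = 0 := fun u hu => by
      obtain ⟨A, B, hAB⟩ := exists_of_fderiv_xCoord_eq_zero ha.1 hu
      have hE := hf.2.self_of_nhds.2
      rw [sum_fderiv_apply]
      have e : ∀ i, u i * ℓ (Pi.single i 1) = A * (a i * partialD i f a) +
          B * (((i : ℕ) : ℂ) * (a i * partialD i f a)) := fun i => by
        rw [hAB, partialD]; ring
      simp only [e, Finset.sum_add_distrib, ← Finset.mul_sum, hE.1, hE.2]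
      simp
    have hST : ∀ u, ℓ (S (T u)) = ℓ u := fun u => by
      have := hker (S (T u) - u) (by rw [map_sub, hTS, sub_self])
      rwa [map_sub, sub_eq_zero] at this
    -- Since D is a right inverse of nothing but the left inverse of L, with D L = 1, expanding ℓ S
    -- D in coordinates and evaluating at L y gives ℓ S y. These are the coefficients of df in the
    -- basis dW_k.
    let c : Fin μ → ℂ := fun k => ℓ (S (D (Pi.single k 1)))
    have hc : ∀ y : Fin μ → ℂ, ∑ k, c k * (L y) k = ℓ (S y) := fun y => by
      have := sum_fderiv_apply ((ℓ.comp S).comp D) (L y)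
      simp only [ContinuousLinearMap.comp_apply, hDL] at this
      rw [this]
      exact Finset.sum_congr rfl fun k _ => mul_comm _ _
    let c₀ : ℂ := f a - ∑ k, c k * W x₀ k
    let h : (Fin (μ + 2) → ℂ) → ℂ := fun b => c₀ + ∑ k, c k * W (xCoord b) k
    have hhd : fderiv ℂ h a = ℓ := by
      have h1 : HasFDerivAt (fun b => W (xCoord b)) (L.comp T) a := HasFDerivAt.comp a hL hT
      have h2 : ∀ k, HasFDerivAt (fun b => W (xCoord b) k)
          ((ContinuousLinearMap.proj k).comp (L.comp T)) a := fun k => hasFDerivAt_pi'.1 h1 k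
      have h3 : HasFDerivAt h (∑ k, c k • (ContinuousLinearMap.proj k).comp (L.comp T)) a :=
        (HasFDerivAt.fun_sum fun k _ => (h2 k).const_mul (c k)).const_add c₀
      rw [h3.fderiv]
      ext u
      rw [sum_apply, ← hST, ← hc]
      rfl
    have hd := hf.linear (hcomb c₀ c) 1 (-1)
    have hzero := hd.eq_zero ha (by
      simp only [c₀, ← hx₀]; ring) (fun i => by
      rw [partialD_linear_apply 1 (-1) hf.1 (hcomb c₀ c).1]
      have : partialD i h a = partialD i f a := by rw [partialD, hhd]; rfl
      change 1 * partialD i f a + -1 * partialD i h a = 0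
      rw [this]; ring)
    refine ⟨(c₀, c), ?_, ?_⟩
    · filter_upwards [hzero] with b hb
      linear_combination hb
    · rintro ⟨d₀, d⟩ hd
      have hev : ∀ᶠ b in 𝓝 a, d₀ + ∑ k, d k * W (xCoord b) k =
          c₀ + ∑ k, c k * W (xCoord b) k := by
        filter_upwards [hzero, hd] with b hb hdb
        rw [← show f b = _ from hdb]; linear_combination hb
      -- W agrees with a branch that is also a left inverse, so v = W(x) takes all values near v₀.
      -- The identity thus becomes one between affine functions of v.
      obtain ⟨W', hW', hW'v, hW'inv⟩ := exists_mirrorBranch hq₀.1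
      rw [hq₀.2] at hW' hW'v
      have hWW := hW.eventuallyEq hW' (by rw [hW'v])
      have hΦc : Tendsto (fun v : Fin μ → ℂ => mirrorMap (expQ v)) (𝓝 v₀) (𝓝 x₀) := by
        have := hΦ.continuousAt.tendsto
        simpa only [hq₀.2] using this
      have hβc : Tendsto β (𝓝 x₀) (𝓝 a) := by
        have := hβ.continuousAt.tendsto
        rwa [hβa] at this
      have hv : ∀ᶠ v in 𝓝 v₀, d₀ + ∑ k, d k * v k = c₀ + ∑ k, c k * v k := by
        filter_upwards [hΦc.eventually (hβc.eventually hev), hΦc.eventually hβe,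
          hΦc.eventually hWW, hW'inv] with v h1 h2 h3 h4
        rwa [h2.2, h3, h4] at h1
      have hlin : ∀ k, d k = c k := fun k => by
        have hline : Tendsto (fun s : ℂ => v₀ + s • (Pi.single k 1 : Fin μ → ℂ)) (𝓝[≠] 0)
            (𝓝 v₀) := by
          have : Continuous fun s : ℂ => v₀ + s • (Pi.single k 1 : Fin μ → ℂ) := by fun_prop
          have h := this.tendsto 0
          rw [zero_smul, add_zero] at h
          exact h.mono_left nhdsWithin_le_nhds
        obtain ⟨s, h1, hs⟩ := ((hline.eventually hv).and self_mem_nhdsWithin).exists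
        have h0 := hv.self_of_nhds
        simp only [Pi.add_apply, Pi.smul_apply, smul_eq_mul, mul_add, Finset.sum_add_distrib,
          Pi.single_apply, mul_ite, mul_one, mul_zero, Finset.sum_ite_eq', Finset.mem_univ,
          if_true] at h1
        have h2 : s * d k = s * c k := by linear_combination h1 - h0
        exact mul_left_cancel₀ hs h2
      have hdc : d = c := funext hlin
      have h0 := hv.self_of_nhds
      rw [hdc] at h0 ⊢
      rw [add_right_cancel h0]
  · rintro ⟨c, hc, -⟩
    exact (hcomb c.1 c.2).congr hc.symm

/-! ### The coefficients near the large complex structure limit -/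

/-- The quotient of the coefficient of `X ^ i` in `∏ j < n, (1 + λ_j X)`, where
`λ_j = ∏ l < j, Q l`, by `λ_0 ⋯ λ_{i-1}`. -/
def unitCoeff (Q : ℕ → ℂ) : ℕ → ℕ → ℂ
  | _, 0 => 1
  | 0, _ + 1 => 0
  | n + 1, i + 1 => unitCoeff Q n (i + 1) + (∏ l ∈ Finset.Ico i n, Q l) * unitCoeff Q n i

theorem unitCoeff_of_lt (Q : ℕ → ℂ) {n i : ℕ} (h : n < i) : unitCoeff Q n i = 0 := by
  induction n generalizing i with
  | zero => cases i with
    | zero => omega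
    | succ i => rfl
  | succ n ih => cases i with
    | zero => omega
    | succ i => rw [unitCoeff, ih (by omega), ih (by omega)]; ring

/-- The leading monomial of the i-th elementary symmetric function is λ_0⋯λ_{i-1}. Adjoining λ_n
multiplies coefficient i by λ_n, and after division by the leading monomial of degree i + 1 this
leaves λ_n / λ_i = ∏_{i ≤ l < n} Q_l, a polynomial in Q. -/
theorem coeff_prod_eq_unitCoeff (Q : ℕ → ℂ) (n i : ℕ) :
    (∏ j ∈ Finset.range n, (1 + Polynomial.C (∏ l ∈ Finset.range j, Q l) * Polynomial.X)).coeff i =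
      (∏ j ∈ Finset.range i, ∏ l ∈ Finset.range j, Q l) * unitCoeff Q n i := by
  induction n generalizing i with
  | zero => cases i with
    | zero => simp [unitCoeff]
    | succ i => simp [unitCoeff, Polynomial.coeff_one]
  | succ n ih =>
    rw [Finset.prod_range_succ, mul_add, mul_one, Polynomial.coeff_add, ih]
    cases i with
    | zero => simp [unitCoeff]
    | succ i =>
      rw [← mul_assoc, Polynomial.coeff_mul_X, Polynomial.coeff_mul_C, ih, unitCoeff]
      rcases Nat.lt_or_ge n i with h | h
      · simp [unitCoeff_of_lt Q h]
      · rw [Finset.prod_range_succ (fun j => ∏ l ∈ Finset.range j, Q l),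
          ← Finset.prod_range_mul_prod_Ico Q h]
        ring

/-- The extension of a vector by zero. -/
def extendZero (q : Fin μ → ℂ) (l : ℕ) : ℂ := if h : l < μ then q ⟨l, h⟩ else 0

theorem partialProd_eq_prod_range (q : Fin μ → ℂ) (j : Fin (μ + 1)) :
    Fin.partialProd q j = ∏ l ∈ Finset.range j, extendZero q l := by
  induction j using Fin.induction with
  | zero => simp
  | succ i ih =>
    rw [Fin.partialProd_succ, ih, Fin.val_succ, Finset.prod_range_succ, Fin.val_castSucc]
    simp [extendZero]

/-- The quotient of `qCoeff q i` by `λ_0 ⋯ λ_{i-1}`. -/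
def unitFactor (q : Fin μ → ℂ) (i : Fin (μ + 2)) : ℂ := unitCoeff (extendZero q) (μ + 1) i

theorem qCoeff_eq_unitFactor (q : Fin μ → ℂ) (i : Fin (μ + 2)) :
    qCoeff q i = (∏ j ∈ Finset.range i, ∏ l ∈ Finset.range j, extendZero q l) * unitFactor q i := by
  rw [unitFactor, ← coeff_prod_eq_unitCoeff, qCoeff]
  congr 1
  rw [← Fin.prod_univ_eq_prod_range
    (fun j => (1 + Polynomial.C (∏ l ∈ Finset.range j, extendZero q l) * Polynomial.X))]
  simp only [partialProd_eq_prod_range]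

theorem analyticAt_unitFactor (q : Fin μ → ℂ) (i : Fin (μ + 2)) :
    AnalyticAt ℂ (fun q => unitFactor q i) q := by
  have key : ∀ n i : ℕ, AnalyticAt ℂ (fun q : Fin μ → ℂ => unitCoeff (extendZero q) n i) q := by
    intro n
    induction n with
    | zero => intro i; cases i <;> exact analyticAt_const
    | succ n ih =>
      intro i
      cases i with
      | zero => exact analyticAt_const
      | succ i =>
        refine (ih (i + 1)).add (AnalyticAt.mul (Finset.analyticAt_fun_prod _ fun l _ => ?_) (ih i))
        simp only [extendZero]
        split_ifs with h
        · exact analyticAt_apply _ _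
        · exact analyticAt_const
  exact key _ _

theorem unitFactor_zero (i : Fin (μ + 2)) : unitFactor (0 : Fin μ → ℂ) i = 1 := by
  have key : ∀ n i : ℕ, i ≤ n → unitCoeff (extendZero (0 : Fin μ → ℂ)) n i = 1 := by
    intro n
    induction n with
    | zero => intro i hi; obtain rfl : i = 0 := by omega
              rfl
    | succ n ih =>
      intro i hi
      cases i with
      | zero => rfl
      | succ i =>
        have h0 : ∀ l, extendZero (0 : Fin μ → ℂ) l = 0 := fun l => by simp [extendZero]
        rw [unitCoeff, ih i (by omega)]
        rcases Nat.lt_or_ge i n with h | h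
        · rw [ih (i + 1) h, Finset.prod_eq_zero (Finset.mem_Ico.2 ⟨le_rfl, h⟩) (h0 i)]; ring
        · rw [unitCoeff_of_lt _ (by omega), Finset.Ico_eq_empty (by omega)]; simp
  exact key _ _ (by omega)

/-- The leading monomials contribute λ_{k+1} / λ_k = q_k to x_k. The remaining factor is regular and
equal to 1 at q = 0, so the map extends across the coordinate hyperplanes. -/
theorem mirrorMap_eq_mul_unitFactor {q : Fin μ → ℂ} (hq : ∀ k, q k ≠ 0) (k : Fin μ) :
    mirrorMap q k = q k * (unitFactor q k.castSucc.castSucc * unitFactor q k.succ.succ /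
      unitFactor q k.succ.castSucc ^ 2) := by
  have hl : ∀ j : Fin (μ + 1), ∏ l ∈ Finset.range j, extendZero q l ≠ 0 := fun j => by
    rw [← partialProd_eq_prod_range]; exact partialProd_ne_zero hq j
  have hb : ∏ j ∈ Finset.range (k : ℕ), ∏ l ∈ Finset.range j, extendZero q l ≠ 0 :=
    Finset.prod_ne_zero_iff.2 fun j hj => hl ⟨j, by have := Finset.mem_range.1 hj; omega⟩
  have h1 := hl k.castSucc
  have hk := hq k
  simp only [Fin.val_castSucc] at h1
  have e : extendZero q k = q k := by simp [extendZero]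
  simp only [mirrorMap, xCoord, qCoeff_eq_unitFactor, Fin.val_castSucc, Fin.val_succ,
    Finset.prod_range_succ, e]
  by_cases h0 : unitFactor q k.succ.castSucc = 0
  · rw [h0]
    simp only [mul_zero, zero_pow two_ne_zero, div_zero]
  field_simp

/-- Near the large complex structure limit, the mirror map extends over the coordinate hyperplanes
and is invertible there. -/
theorem exists_inverse_mul_unitFactor (μ : ℕ) :
    ∃ ψ : (Fin μ → ℂ) → Fin μ → ℂ, AnalyticAt ℂ ψ 0 ∧ ψ 0 = 0 ∧ ∀ᶠ x in 𝓝 0, ∀ k,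
      ψ x k * (unitFactor (ψ x) k.castSucc.castSucc * unitFactor (ψ x) k.succ.succ /
        unitFactor (ψ x) k.succ.castSucc ^ 2) = x k := by
  let u : (Fin μ → ℂ) → Fin μ → ℂ := fun q k =>
    unitFactor q k.castSucc.castSucc * unitFactor q k.succ.succ / unitFactor q k.succ.castSucc ^ 2
  let Ξ : (Fin μ → ℂ) → Fin μ → ℂ := fun q k => q k * u q k
  have hu : ∀ k, AnalyticAt ℂ (fun q => u q k) 0 := fun k =>
    ((analyticAt_unitFactor _ _).mul (analyticAt_unitFactor _ _)).div
      ((analyticAt_unitFactor _ _).pow 2) (by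
        change unitFactor 0 _ ^ 2 ≠ 0
        rw [unitFactor_zero]; norm_num)
  have hu0 : ∀ k, u 0 k = 1 := fun k => by simp [u, unitFactor_zero]
  have hΞ : AnalyticAt ℂ Ξ 0 := analyticAt_pi_iff.2 fun k => (analyticAt_apply _ _).mul (hu k)
  have hΞ0 : Ξ 0 = 0 := by ext k; simp [Ξ]
  -- Each component is q_k times a function equal to 1 at 0, so the derivative there is the identity
  -- and the inverse function theorem applies.
  have hd : HasFDerivAt Ξ ((ContinuousLinearEquiv.refl ℂ (Fin μ → ℂ) :
      (Fin μ → ℂ) ≃L[ℂ] (Fin μ → ℂ)) : (Fin μ → ℂ) →L[ℂ] (Fin μ → ℂ)) 0 := by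
    refine hasFDerivAt_pi'.2 fun k => ?_
    have h1 : HasFDerivAt (fun q : Fin μ → ℂ => q k)
        (ContinuousLinearMap.proj (R := ℂ) (φ := fun _ : Fin μ => ℂ) k) 0 :=
      (ContinuousLinearMap.proj (R := ℂ) (φ := fun _ : Fin μ => ℂ) k).hasFDerivAt
    have := h1.mul (hu k).differentiableAt.hasFDerivAt
    refine this.congr_fderiv ?_
    ext v
    simp [hu0]
  have hn : (⊤ : WithTop ℕ∞) ≠ 0 := by simp
  have hc : ContDiffAt ℂ ⊤ Ξ 0 := hΞ.contDiffAt
  have hs := hc.hasStrictFDerivAt' hd hn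
  refine ⟨hc.localInverse hd hn, ?_, ?_, ?_⟩
  · have := (hc.to_localInverse hd hn).analyticAt
    rwa [hΞ0] at this
  · have := hc.localInverse_apply_image hd hn
    rwa [hΞ0] at this
  · have := hs.eventually_right_inverse
    rw [hΞ0] at this
    filter_upwards [this] with x hx k
    exact congrFun hx k

/-- Sufficiently small `q` with nonzero coordinates lie in the `q`-space. -/
theorem mem_qSpace_of_norm_lt {q : Fin μ → ℂ} (h0 : ∀ k, q k ≠ 0) (h1 : ∀ k, ‖q k‖ < 1)
    (hF : ∀ i, unitFactor q i ≠ 0) : q ∈ qSpace μ := by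
  have hl : ∀ j : Fin (μ + 1), ∏ l ∈ Finset.range j, extendZero q l ≠ 0 := fun j => by
    rw [← partialProd_eq_prod_range]; exact partialProd_ne_zero h0 j
  refine ⟨h0, ?_, fun i => ?_⟩
  -- The absolute values of the λ_j decrease strictly, so the λ_j are distinct.
  · have : StrictAnti fun j => ‖Fin.partialProd q j‖ := by
      refine Fin.strictAnti_iff_succ_lt.2 fun k => ?_
      simp only [Fin.partialProd_succ, norm_mul]
      exact mul_lt_of_lt_one_right (norm_pos_iff.2 (partialProd_ne_zero h0 _)) (h1 k)
    exact fun i j h => this.injective (congrArg norm h)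
  · rw [qCoeff_eq_unitFactor]
    refine mul_ne_zero (Finset.prod_ne_zero_iff.2 fun j hj => hl ⟨j, ?_⟩) (hF i)
    have := Finset.mem_range.1 hj; omega

/-! ### Constant terms of Laurent series -/

/-- The mean value of an absolutely convergent Laurent series over the unit circle is its constant
term. -/
theorem hasSum_constantTerm {ι : Type*} [Countable ι] {c : ι → ℂ} {e : ι → ℤ} {F : ℝ → ℂ}
    (hc : Summable fun s => ‖c s‖)
    (hF : ∀ θ : ℝ, HasSum (fun s => c s * Complex.exp (θ * Complex.I) ^ e s) (F θ)) :
    HasSum (fun s => if e s = 0 then c s else 0)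
      ((2 * Real.pi : ℂ)⁻¹ * ∫ θ in (0 : ℝ)..2 * Real.pi, F θ) := by
  have hn : ∀ s (θ : ℝ), ‖c s * Complex.exp (θ * Complex.I) ^ e s‖ = ‖c s‖ := fun s θ => by
    rw [norm_mul, norm_zpow, Complex.norm_exp_ofReal_mul_I, one_zpow, mul_one]
  have h := intervalIntegral.hasSum_integral_of_dominated_convergence
    (μ := MeasureTheory.volume) (a := 0) (b := 2 * Real.pi)
    (F := fun s θ => c s * Complex.exp ((θ : ℂ) * Complex.I) ^ e s) (f := F) (fun s _ => ‖c s‖)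
    (fun s => Continuous.aestronglyMeasurable (continuous_const.mul
      (Continuous.zpow₀ (by fun_prop) _ fun _ => Or.inl (Complex.exp_ne_zero _))))
    (fun s => .of_forall fun θ _ => (hn s θ).le) (.of_forall fun _ _ => hc)
    intervalIntegrable_const (.of_forall fun θ _ => hF θ)
  have hpi : (2 * Real.pi : ℂ) ≠ 0 := by
    have := Real.pi_ne_zero
    exact mul_ne_zero two_ne_zero (Complex.ofReal_ne_zero.2 this)
  refine (h.mul_left ((2 * Real.pi : ℂ)⁻¹)).congr_fun fun s => ?_
  rw [intervalIntegral.integral_const_mul]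
  split_ifs with hs
  · simp only [hs, zpow_zero, intervalIntegral.integral_const, sub_zero]
    rw [Complex.real_smul, Complex.ofReal_mul, Complex.ofReal_ofNat]
    field_simp
  · have e1 : ∀ θ : ℝ, Complex.exp (θ * Complex.I) ^ e s =
        Complex.exp (((e s : ℂ) * Complex.I) * θ) := fun θ => by
      rw [← Complex.exp_int_mul]; congr 1; ring
    simp only [e1]
    rw [integral_exp_mul_complex (mul_ne_zero (Int.cast_ne_zero.2 hs) Complex.I_ne_zero)]
    have e2 : Complex.exp ((e s : ℂ) * Complex.I * ((2 * Real.pi : ℝ) : ℂ)) = 1 := by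
      rw [Complex.exp_eq_one_iff]
      exact ⟨e s, by push_cast; ring⟩
    rw [e2]
    simp

/-- The coefficients of `log (1 + ∑ y_j)` as a power series in the `y_j`. -/
def logCoeff {ι : Type*} [Fintype ι] (L : ι → ℕ) : ℂ :=
  (-1) ^ (∑ j, L j + 1) / (∑ j, L j : ℕ) * Nat.multinomial Finset.univ L

theorem sum_piAntidiag_logCoeff {ι : Type*} [Fintype ι] [DecidableEq ι] (y : ι → ℂ) (n : ℕ) :
    ∑ L ∈ Finset.piAntidiag Finset.univ n, logCoeff L * ∏ j, y j ^ L j =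
      (-1) ^ (n + 1) * (∑ j, y j) ^ n / n := by
  rw [Finset.sum_pow_eq_sum_piAntidiag, Finset.mul_sum, Finset.sum_div]
  refine Finset.sum_congr rfl fun L hL => ?_
  rw [logCoeff, (Finset.mem_piAntidiag.1 hL).1]
  ring

/-- In total degree n the absolute values are dominated by the multinomial expansion of (∑ ‖y_j‖)^n.
For L = 0 the coefficient is 0 because it is a quotient by 0, matching the missing constant term of
the logarithm. -/
theorem summable_norm_logCoeff {ι : Type*} [Fintype ι] {y : ι → ℂ} (hy : ∑ j, ‖y j‖ < 1) :
    Summable fun L : ι → ℕ => ‖logCoeff L * ∏ j, y j ^ L j‖ := by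
  classical
  refine summable_of_sum_le (c := ∑' n : ℕ, (∑ j, ‖y j‖) ^ n) (fun _ => norm_nonneg _) fun s => ?_
  have hs := summable_geometric_of_lt_one (Finset.sum_nonneg fun j _ => norm_nonneg (y j)) hy
  calc ∑ L ∈ s, ‖logCoeff L * ∏ j, y j ^ L j‖
      ≤ ∑ n ∈ s.image fun L => ∑ j, L j, (∑ j, ‖y j‖) ^ n := by
        rw [← Finset.sum_fiberwise_of_maps_to (g := fun L => ∑ j, L j)
          (t := s.image fun L => ∑ j, L j) fun L hL => Finset.mem_image_of_mem _ hL]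
        refine Finset.sum_le_sum fun n _ => ?_
        rw [Finset.sum_pow_eq_sum_piAntidiag]
        refine (Finset.sum_le_sum (g := fun L => (Nat.multinomial Finset.univ L : ℝ) *
          ∏ j, ‖y j‖ ^ L j) fun L hL => ?_).trans
          (Finset.sum_le_sum_of_subset_of_nonneg ?_ ?_)
        · rw [logCoeff, norm_mul, norm_mul, norm_div, norm_pow, norm_neg, norm_one, one_pow,
            norm_prod]
          simp only [norm_pow, Complex.norm_natCast]
          refine mul_le_mul_of_nonneg_right (mul_le_of_le_one_left (by positivity) ?_)
            (by positivity)
          rcases Nat.eq_zero_or_pos (∑ j, L j) with h | h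
          · simp [h]
          · rw [div_le_one (by exact_mod_cast h)]; exact_mod_cast h
        · intro L hL
          simpa using (Finset.mem_filter.1 hL).2
        · intro L _ _; positivity
    _ ≤ ∑' n : ℕ, (∑ j, ‖y j‖) ^ n :=
        hs.sum_le_tsum _ fun n _ => pow_nonneg (Finset.sum_nonneg fun j _ => norm_nonneg (y j)) _

/-- The multinomial expansion of the logarithm. -/
theorem hasSum_logCoeff {ι : Type*} [Fintype ι] {y : ι → ℂ} (hy : ∑ j, ‖y j‖ < 1) :
    HasSum (fun L : ι → ℕ => logCoeff L * ∏ j, y j ^ L j) (Complex.log (1 + ∑ j, y j)) := by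
  classical
  have hs := (summable_norm_logCoeff hy).of_norm
  have h := hs.hasSum.tsum_fiberwise fun L => ∑ j, L j
  have hl := Complex.hasSum_taylorSeries_log ((norm_sum_le _ _).trans_lt hy)
  have e : (fun n : ℕ => (-1) ^ (n + 1) * (∑ j, y j) ^ n / (n : ℂ)) = fun n : ℕ =>
      ∑' L : (fun L : ι → ℕ => ∑ j, L j) ⁻¹' {n}, logCoeff (L : ι → ℕ) *
        ∏ j, y j ^ (L : ι → ℕ) j := by
    ext n
    have : (fun L : ι → ℕ => ∑ j, L j) ⁻¹' {n} = ↑(Finset.piAntidiag (Finset.univ : Finset ι) n) := by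
      ext L; simp
    rw [this, Finset.tsum_subtype' _ fun L => logCoeff L * ∏ j, y j ^ L j, sum_piAntidiag_logCoeff]
  rw [e] at hl
  rw [hl.unique h]
  exact hs.hasSum

theorem norm_exp_zpow (θ : ℝ) (m : ℤ) : ‖Complex.exp (θ * Complex.I) ^ m‖ = 1 := by
  rw [norm_zpow, Complex.norm_exp_ofReal_mul_I, one_zpow]

/-- Every exponent s·n with n ≥ 1 is nonzero, and the Taylor series has no term n = 0. Hence the
constant term is 0. -/
theorem integral_log_one_add {η : ℂ} (hη : ‖η‖ < 1) {s : ℤ} (hs : s ≠ 0) :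
    ∫ θ in (0 : ℝ)..2 * Real.pi, Complex.log (1 + η * Complex.exp (θ * Complex.I) ^ s) = 0 := by
  have h := hasSum_constantTerm (ι := ℕ) (c := fun n => (-1) ^ (n + 1) * η ^ n / n)
    (e := fun n => s * n)
    (F := fun θ => Complex.log (1 + η * Complex.exp (θ * Complex.I) ^ s)) ?_ fun θ => ?_
  · have e : (fun n : ℕ => if s * (n : ℤ) = 0 then (-1) ^ (n + 1) * η ^ n / (n : ℂ) else 0) =
        fun _ => 0 := by
      ext n
      split_ifs with h
      · obtain rfl : n = 0 := by simpa [hs] using h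
        simp
      · rfl
    rw [e] at h
    have := h.unique hasSum_zero
    have hpi : (2 * Real.pi : ℂ)⁻¹ ≠ 0 :=
      inv_ne_zero (mul_ne_zero two_ne_zero (Complex.ofReal_ne_zero.2 Real.pi_ne_zero))
    exact (mul_eq_zero.1 this).resolve_left hpi
  · refine (summable_geometric_of_lt_one (norm_nonneg η) hη).of_nonneg_of_le
      (fun _ => norm_nonneg _) fun n => ?_
    rw [norm_div, norm_mul, norm_pow, norm_pow, norm_neg, norm_one, one_pow, one_mul,
      Complex.norm_natCast]
    rcases Nat.eq_zero_or_pos n with h | h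
    · simp [h]
    · exact div_le_self (by positivity) (by exact_mod_cast h)
  · have := Complex.hasSum_taylorSeries_log (z := η * Complex.exp (θ * Complex.I) ^ s)
      (by rw [norm_mul, norm_exp_zpow, mul_one]; exact hη)
    refine this.congr_fun fun n => ?_
    rw [mul_pow, zpow_mul, zpow_natCast]
    ring

theorem continuous_log_one_add {η : ℂ} (hη : ‖η‖ < 1) (s : ℤ) :
    Continuous fun θ : ℝ => Complex.log (1 + η * Complex.exp (θ * Complex.I) ^ s) := by
  refine Continuous.clog (continuous_const.add (continuous_const.mul
      (Continuous.zpow₀ (by fun_prop) _ fun _ => Or.inl (Complex.exp_ne_zero _)))) fun θ => ?_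
  refine Complex.mem_slitPlane_of_norm_lt_one ?_
  rw [norm_mul, norm_exp_zpow, mul_one]; exact hη

theorem ne_zero_of_norm_sub_one_lt {z : ℂ} (hz : ‖z - 1‖ < 1) : z ≠ 0 := by
  rintro rfl
  simp at hz

/-- The constant term of the logarithm of a Laurent polynomial that factors. -/
theorem hasSum_logCoeff_constantTerm {ι κ : Type*} [Fintype ι] [Fintype κ] {β : ι → ℂ} {e : ι → ℤ}
    {η : κ → ℂ} {s : κ → ℤ} {C : ℂ} (hβ : ∑ j, ‖β j‖ ≤ 1 / 2) (hη : ∑ j, ‖η j‖ ≤ 1 / 2)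
    (hs : ∀ j, s j ≠ 0) (hC : ‖C - 1‖ ≤ 1 / 2)
    (h : ∀ z : ℂ, z ≠ 0 → C * (1 + ∑ j, β j * z ^ e j) = ∏ j, (1 + η j * z ^ s j)) :
    HasSum (fun L : ι → ℕ => if ∑ j, (L j : ℤ) * e j = 0 then logCoeff L * ∏ j, β j ^ L j else 0)
      (-Complex.log C) := by
  have hη' : ∀ j, ‖η j‖ ≤ 1 / 2 := fun j =>
    (Finset.single_le_sum (f := fun j => ‖η j‖) (fun j _ => norm_nonneg _)
      (Finset.mem_univ j)).trans hη
  have hC0 : C ≠ 0 := ne_zero_of_norm_sub_one_lt (by linarith)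
  -- The factorisation gives this identity modulo 2πi. The three terms have norms at most 3/4, so
  -- both imaginary parts lie strictly between -π and π and no multiple of 2πi can appear.
  have key : ∀ θ : ℝ, Complex.log (1 + ∑ j, β j * Complex.exp (θ * Complex.I) ^ e j) =
      -Complex.log C + ∑ j, Complex.log (1 + η j * Complex.exp (θ * Complex.I) ^ s j) := by
    intro θ
    set z := Complex.exp (θ * Complex.I) with hz
    have hz0 : z ≠ 0 := Complex.exp_ne_zero _
    have n1 : ‖∑ j, β j * z ^ e j‖ ≤ 1 / 2 := (norm_sum_le _ _).trans
      ((Finset.sum_le_sum fun j _ => by rw [norm_mul, hz, norm_exp_zpow, mul_one]).trans hβ)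
    have n2 : ∀ j, ‖η j * z ^ s j‖ ≤ 1 / 2 := fun j => by
      rw [norm_mul, hz, norm_exp_zpow, mul_one]; exact hη' j
    have n3 : ‖Complex.log C‖ ≤ 3 / 4 := by
      have := Complex.norm_log_one_add_half_le_self hC
      rw [add_sub_cancel] at this
      linarith
    have n4 : ‖∑ j, Complex.log (1 + η j * z ^ s j)‖ ≤ 3 / 4 := by
      refine (norm_sum_le _ _).trans ((Finset.sum_le_sum
        fun j _ => Complex.norm_log_one_add_half_le_self (n2 j)).trans ?_)
      simp only [norm_mul, hz, norm_exp_zpow, mul_one]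
      rw [← Finset.mul_sum]; linarith
    have n5 := Complex.norm_log_one_add_half_le_self n1
    have hpi := Real.pi_gt_three
    have b1 := (Complex.abs_im_le_norm (Complex.log (1 + ∑ j, β j * z ^ e j)))
    have b2 := (Complex.abs_im_le_norm (-Complex.log C + ∑ j, Complex.log (1 + η j * z ^ s j)))
    have b3 := norm_add_le (-Complex.log C) (∑ j, Complex.log (1 + η j * z ^ s j))
    rw [norm_neg] at b3
    rw [abs_le] at b1 b2
    refine Complex.exp_inj_of_neg_pi_lt_of_le_pi (by linarith) (by linarith) (by linarith)
      (by linarith) ?_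
    have ne : ∀ {y : ℂ}, ‖y‖ ≤ 1 / 2 → 1 + y ≠ 0 := fun {y} hy =>
      ne_zero_of_norm_sub_one_lt (by rw [add_sub_cancel_left]; linarith)
    rw [Complex.exp_log (ne n1), Complex.exp_add, Complex.exp_neg, Complex.exp_log hC0,
      Complex.exp_sum, Finset.prod_congr rfl fun j _ => Complex.exp_log (ne (n2 j)), ← h z hz0,
      inv_mul_cancel_left₀ hC0]
  have hsum : ∀ z : ℂ, ∀ L : ι → ℕ, z ≠ 0 → ∏ j, (β j * z ^ e j) ^ L j =
      (∏ j, β j ^ L j) * z ^ (∑ j, (L j : ℤ) * e j) := fun z L hz => by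
    simp only [mul_pow, Finset.prod_mul_distrib]
    congr 1
    have : ∀ s : Finset ι, ∏ j ∈ s, (z ^ e j) ^ L j = z ^ ∑ j ∈ s, (L j : ℤ) * e j := by
      classical
      intro s
      induction s using Finset.induction with
      | empty => simp
      | insert a s ha ih =>
        rw [Finset.prod_insert ha, Finset.sum_insert ha, zpow_add₀ hz, ih, mul_comm (L a : ℤ),
          zpow_mul, zpow_natCast]
    exact this _
  have H := hasSum_constantTerm (ι := ι → ℕ) (c := fun L => logCoeff L * ∏ j, β j ^ L j)
    (e := fun L => ∑ j, (L j : ℤ) * e j)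
    (F := fun θ => Complex.log (1 + ∑ j, β j * Complex.exp (θ * Complex.I) ^ e j))
    (summable_norm_logCoeff (by linarith)) fun θ => by
      have := hasSum_logCoeff (y := fun j => β j * Complex.exp (θ * Complex.I) ^ e j) (by
        simp only [norm_mul, norm_exp_zpow, mul_one]; linarith)
      refine this.congr_fun fun L => ?_
      rw [hsum _ _ (Complex.exp_ne_zero _)]
      ring
  convert! H using 1
  have hint : ∀ j, IntervalIntegrable (fun θ : ℝ =>
      Complex.log (1 + η j * Complex.exp (θ * Complex.I) ^ s j)) MeasureTheory.volume 0
      (2 * Real.pi) := fun j =>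
    (continuous_log_one_add ((hη' j).trans_lt (by norm_num)) _).intervalIntegrable _ _
  simp only [key]
  rw [intervalIntegral.integral_add intervalIntegrable_const
      (Continuous.intervalIntegrable (continuous_finsetSum _ fun j _ =>
        continuous_log_one_add ((hη' j).trans_lt (by norm_num)) _) _ _),
    intervalIntegral.integral_finsetSum fun j _ => hint j,
    Finset.sum_eq_zero fun j _ => integral_log_one_add ((hη' j).trans_lt (by norm_num)) (hs j),
    intervalIntegral.integral_const, sub_zero, add_zero, Complex.real_smul, Complex.ofReal_mul,
    Complex.ofReal_ofNat]
  have : (Real.pi : ℂ) ≠ 0 := Complex.ofReal_ne_zero.2 Real.pi_ne_zero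
  field_simp

/-! ### The unit factors as constant terms -/

theorem norm_prod_le_of_forall_le {ι : Type*} {s : Finset ι} (hs : s.Nonempty) {g : ι → ℂ} {κ : ℝ}
    (hκ : κ ≤ 1) (hg : ∀ l ∈ s, ‖g l‖ ≤ κ) : ‖∏ l ∈ s, g l‖ ≤ κ := by
  obtain ⟨l₀, hl₀⟩ := hs
  have hκ0 : 0 ≤ κ := (norm_nonneg _).trans (hg l₀ hl₀)
  rw [norm_prod]
  refine (Finset.prod_le_prod (fun _ _ => norm_nonneg _) hg).trans ?_
  rw [Finset.prod_const]
  exact pow_le_of_le_one hκ0 hκ (Finset.card_ne_zero_of_mem hl₀)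

/-- The products `q_1 ⋯ q_j` can be rescaled so that the first `i` of them become large and
the others small. -/
theorem exists_scale {q : Fin μ → ℂ} {κ : ℝ} (hκ : 0 < κ) (hκ1 : κ ≤ 1) (h0 : ∀ k, q k ≠ 0)
    (hq : ∀ k, ‖q k‖ ≤ κ ^ 2) (i : ℕ) (hi : i ≤ μ + 1) :
    ∃ t : ℂ, t ≠ 0 ∧ (∀ j < i, ‖(t * ∏ l ∈ Finset.range j, extendZero q l)⁻¹‖ ≤ κ) ∧
      ∀ j, i ≤ j → ‖t * ∏ l ∈ Finset.range j, extendZero q l‖ ≤ κ := by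
  set lam : ℕ → ℂ := fun j => ∏ l ∈ Finset.range j, extendZero q l with hlam
  have hstep : ∀ j, ‖lam (j + 1)‖ ≤ κ ^ 2 * ‖lam j‖ := fun j => by
    simp only [hlam, Finset.prod_range_succ, norm_mul]
    rw [mul_comm]
    refine mul_le_mul_of_nonneg_right ?_ (norm_nonneg _)
    simp only [extendZero]
    split_ifs with h
    · exact hq _
    · simp only [norm_zero]; positivity
  have hanti : Antitone fun j => ‖lam j‖ := antitone_nat_of_succ_le fun j =>
    (hstep j).trans (mul_le_of_le_one_left (norm_nonneg _) (pow_le_one₀ hκ.le hκ1))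
  have hne : ∀ j, j ≤ μ → lam j ≠ 0 := fun j hj => by
    have := partialProd_ne_zero h0 ⟨j, by omega⟩
    rwa [partialProd_eq_prod_range] at this
  cases i with
  | zero =>
    refine ⟨κ, Complex.ofReal_ne_zero.2 hκ.ne', fun j hj => absurd hj (by omega), fun j _ => ?_⟩
    rw [norm_mul, Complex.norm_real, Real.norm_of_nonneg hκ.le]
    have := hanti (Nat.zero_le j)
    simp only [hlam, Finset.range_zero, Finset.prod_empty, norm_one] at this
    exact mul_le_of_le_one_right hκ.le this
  | succ i =>
    have hi0 : 0 < ‖lam i‖ := norm_pos_iff.2 (hne i (by omega))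
    have ht : 0 < (κ * ‖lam i‖)⁻¹ := by positivity
    -- The last product to be made large, with index i here, gets norm exactly 1/κ. The next is
    -- smaller by at least κ², so its norm is at most κ.
    refine ⟨((κ * ‖lam i‖)⁻¹ : ℝ), Complex.ofReal_ne_zero.2 ht.ne', fun j hj => ?_, fun j hj => ?_⟩
    · rw [norm_inv, norm_mul, Complex.norm_real, Real.norm_of_nonneg ht.le, mul_inv, inv_inv]
      have h1 : ‖lam i‖ ≤ ‖lam j‖ := hanti (by omega)
      rw [mul_assoc]
      refine mul_le_of_le_one_right hκ.le ?_
      rw [← div_eq_mul_inv]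
      exact div_le_one_of_le₀ h1 (norm_nonneg _)
    · rw [norm_mul, Complex.norm_real, Real.norm_of_nonneg ht.le]
      have h1 : ‖lam j‖ ≤ κ ^ 2 * ‖lam i‖ := (hanti hj).trans (hstep i)
      calc (κ * ‖lam i‖)⁻¹ * ‖lam j‖ ≤ (κ * ‖lam i‖)⁻¹ * (κ ^ 2 * ‖lam i‖) :=
            mul_le_mul_of_nonneg_left h1 ht.le
        _ = κ := by field_simp

theorem prod_ite_lt {i : ℕ} (hi : i ≤ μ + 1) (g : ℕ → ℂ) :
    ∏ j : Fin (μ + 1), (if (j : ℕ) < i then g j else 1) = ∏ j ∈ Finset.range i, g j := by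
  rw [Fin.prod_univ_eq_prod_range (fun j => if j < i then g j else 1), ← Finset.prod_filter]
  congr 1
  ext j
  simp only [Finset.mem_filter, Finset.mem_range]
  omega

/-- For small `q`, the negative logarithm of a unit factor is the constant term of the logarithm of
a Laurent polynomial. -/
theorem hasSum_logCoeff_unitFactor {q : Fin μ → ℂ} {κ : ℝ} (hκ : 0 < κ)
    (hκ1 : κ * (4 * (μ + 2)) ≤ 1) (h0 : ∀ k, q k ≠ 0) (hq : ∀ k, ‖q k‖ ≤ κ ^ 2)
    (hF : ∀ i, ‖unitFactor q i - 1‖ ≤ 1 / 4) (i : Fin (μ + 2)) :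
    ∃ α : Fin (μ + 2) → ℂ, (∀ j, α j ≠ 0) ∧ α i = 1 ∧ xCoord α = mirrorMap q ∧
      HasSum (fun L : Fin (μ + 2) → ℕ => if ∑ j, (L j : ℤ) * ((j : ℤ) - (i : ℤ)) = 0 then
        logCoeff L * ∏ j, (if j = i then 0 else α j) ^ L j else 0)
        (-Complex.log (unitFactor q i)) := by
  have hμ : (0 : ℝ) ≤ μ := Nat.cast_nonneg μ
  have hκ1' : κ ≤ 1 := by nlinarith
  obtain ⟨t, ht, hlt, hge⟩ := exists_scale hκ hκ1' h0 hq i (by omega)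
  obtain ⟨r, hr⟩ : ∃ r : ℕ → ℂ, ∀ j, r j = t * ∏ l ∈ Finset.range j, extendZero q l :=
    ⟨_, fun _ => rfl⟩
  obtain ⟨R, hR⟩ : ∃ R : ℕ → ℂ, ∀ j, R j = ∏ l ∈ Finset.range j, r l := ⟨_, fun _ => rfl⟩
  simp only [← hr] at hlt hge
  have hr0 : ∀ j, j ≤ μ → r j ≠ 0 := fun j hj => by
    have := partialProd_ne_zero h0 ⟨j, by omega⟩
    rw [partialProd_eq_prod_range] at this
    rw [hr]
    exact mul_ne_zero ht this
  have hR0 : ∀ j : Fin (μ + 2), R j ≠ 0 := fun j => by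
    rw [hR]
    exact Finset.prod_ne_zero_iff.2 fun l hl => hr0 l (by have := Finset.mem_range.1 hl; omega)
  have hF0 : ∀ j, unitFactor q j ≠ 0 := fun j =>
    ne_zero_of_norm_sub_one_lt ((hF j).trans_lt (by norm_num))
  have hRa : ∀ j : Fin (μ + 2), t ^ (j : ℕ) * qCoeff q j = R j * unitFactor q j := fun j => by
    rw [qCoeff_eq_unitFactor, ← mul_assoc]
    simp only [hR, hr, Finset.prod_mul_distrib, Finset.prod_const, Finset.card_range]
  -- The coefficients are rescaled so that the i-th is 1. It dominates the others, each of norm at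
  -- most 2κ, and the bound on κ keeps their sum below 1/2.
  obtain ⟨α, hα⟩ : ∃ α : Fin (μ + 2) → ℂ,
      α = fun j : Fin (μ + 2) => (R i * unitFactor q i)⁻¹ * (t ^ (j : ℕ) * qCoeff q j) := ⟨_, rfl⟩
  have hα' : ∀ j, α j = (R i * unitFactor q i)⁻¹ * (R j * unitFactor q j) := fun j => by
    rw [hα, ← hRa j]
  have hc0 := mul_ne_zero (hR0 i) (hF0 i)
  have hαi : α i = 1 := by rw [hα', inv_mul_cancel₀ hc0]
  refine ⟨α, fun j => ?_, hαi, ?_, ?_⟩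
  · rw [hα']; exact mul_ne_zero (inv_ne_zero hc0) (mul_ne_zero (hR0 j) (hF0 j))
  · rw [hα]; exact xCoord_scale (inv_ne_zero hc0) ht _
  · refine hasSum_logCoeff_constantTerm (κ := Fin (μ + 1))
      (β := fun j => if j = i then 0 else α j) (e := fun j : Fin (μ + 2) => (j : ℤ) - (i : ℤ))
      (η := fun j => if (j : ℕ) < i then (r j)⁻¹ else r j)
      (s := fun j => if (j : ℕ) < i then -1 else 1) ?_ ?_ ?_ ?_ ?_
    · have hb : ∀ j : Fin (μ + 2), ‖if j = i then (0 : ℂ) else α j‖ ≤ 2 * κ := fun j => by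
        split_ifs with h
        · rw [norm_zero]; linarith
        have hFF : ‖unitFactor q j / unitFactor q i‖ ≤ 2 := by
          have h1 : ‖unitFactor q j‖ ≤ 5 / 4 := by
            have := norm_add_le (unitFactor q j - 1) 1
            rw [sub_add_cancel, norm_one] at this
            linarith [hF j]
          have h2 : 3 / 4 ≤ ‖unitFactor q i‖ := by
            have := norm_sub_le (unitFactor q i) (unitFactor q i - 1)
            rw [sub_sub_cancel, norm_one] at this
            linarith [hF i]
          rw [norm_div, div_le_iff₀ (by linarith)]
          linarith
        have e : α j = (R j / R i) * (unitFactor q j / unitFactor q i) := by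
          rw [hα']
          have := hR0 i
          have := hF0 i
          field_simp
        have hRR : ‖R j / R i‖ ≤ κ := by
          rcases lt_or_gt_of_ne h with h | h
          · have h' : (j : ℕ) < i := h
            have : R j / R i = ∏ l ∈ Finset.Ico (j : ℕ) i, (r l)⁻¹ := by
              rw [div_eq_iff (hR0 i), hR, hR, ← Finset.prod_range_mul_prod_Ico r h'.le,
                Finset.prod_inv_distrib, mul_comm (∏ k ∈ Finset.range (j : ℕ), r k),
                inv_mul_cancel_left₀]
              exact Finset.prod_ne_zero_iff.2 fun l hl =>
                hr0 l (by have := Finset.mem_Ico.1 hl; omega)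
            rw [this]
            exact norm_prod_le_of_forall_le (Finset.nonempty_Ico.2 h') hκ1' fun l hl =>
              hlt l (Finset.mem_Ico.1 hl).2
          · have h' : (i : ℕ) < j := h
            have : R j / R i = ∏ l ∈ Finset.Ico (i : ℕ) j, r l := by
              rw [div_eq_iff (hR0 i), hR, hR, ← Finset.prod_range_mul_prod_Ico r h'.le, mul_comm]
            rw [this]
            exact norm_prod_le_of_forall_le (Finset.nonempty_Ico.2 h') hκ1' fun l hl =>
              hge l (Finset.mem_Ico.1 hl).1
        rw [e, norm_mul, mul_comm 2 κ]
        exact mul_le_mul hRR hFF (norm_nonneg _) hκ.le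
      refine (Finset.sum_le_sum fun j _ => hb j).trans ?_
      simp only [Finset.sum_const, Finset.card_univ, Fintype.card_fin, nsmul_eq_mul]
      push_cast
      linarith
    · have hb : ∀ j : Fin (μ + 1), ‖if (j : ℕ) < i then (r j)⁻¹ else r j‖ ≤ κ := fun j => by
        split_ifs with h
        · exact hlt _ h
        · exact hge _ (by omega)
      refine (Finset.sum_le_sum fun j _ => hb j).trans ?_
      simp only [Finset.sum_const, Finset.card_univ, Fintype.card_fin, nsmul_eq_mul]
      push_cast
      nlinarith
    · intro j; split_ifs <;> norm_num
    · exact (hF i).trans (by norm_num)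
    · intro z hz
      have e1 : 1 + ∑ j : Fin (μ + 2), (if j = i then 0 else α j) * z ^ ((j : ℤ) - (i : ℤ)) =
          ∑ j : Fin (μ + 2), α j * z ^ ((j : ℤ) - (i : ℤ)) := by
        rw [← Finset.add_sum_erase _ _ (Finset.mem_univ i), ← Finset.add_sum_erase
          (f := fun j : Fin (μ + 2) => α j * z ^ ((j : ℤ) - (i : ℤ))) _ (Finset.mem_univ i)]
        simp only [if_true, zero_add, hαi, sub_self, zpow_zero, mul_one]
        congr 1
        refine Finset.sum_congr rfl fun j hj => ?_
        rw [if_neg (Finset.ne_of_mem_erase hj)]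
      have e2 : ∑ j : Fin (μ + 2), α j * z ^ ((j : ℤ) - (i : ℤ)) =
          (R i * unitFactor q i)⁻¹ * z ^ (-(i : ℤ)) * ∏ j : Fin (μ + 1), (1 + r j * z) := by
        have e3 : ∏ j : Fin (μ + 1), (1 + r j * z) =
            ∑ j : Fin (μ + 2), qCoeff q j * (t * z) ^ (j : ℕ) := by
          rw [← eval_fSigma, qCoeff_eq, fSigma_rootCoeff, eval_prodPoly]
          refine Finset.prod_congr rfl fun j _ => ?_
          rw [partialProd_eq_prod_range, hr]; ring
        rw [e3, Finset.mul_sum]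
        refine Finset.sum_congr rfl fun j _ => ?_
        rw [sub_eq_add_neg, zpow_add₀ hz, zpow_natCast, hα]
        ring
      -- For j < i the large factor is rewritten as 1 + r_j z = r_j z (1 + r_j⁻¹ z⁻¹). The extracted
      -- terms multiply to R_i z^i and every remaining factor is close to 1.
      have e4 : ∏ j : Fin (μ + 1), (1 + r j * z) = R i * z ^ (i : ℕ) * ∏ j : Fin (μ + 1),
          (1 + (if (j : ℕ) < i then (r j)⁻¹ else r j) * z ^ (if (j : ℕ) < i then (-1 : ℤ) else 1)) := by
        have : R i * z ^ (i : ℕ) = ∏ j ∈ Finset.range i, (r j * z) := by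
          simp only [hR, Finset.prod_mul_distrib, Finset.prod_const, Finset.card_range]
        rw [this, ← prod_ite_lt (μ := μ) (i := (i : ℕ)) (by omega), ← Finset.prod_mul_distrib]
        refine Finset.prod_congr rfl fun j _ => ?_
        have := hr0 j (by omega)
        split_ifs
        · rw [zpow_neg_one]; field_simp; ring
        · rw [zpow_one, one_mul]
      rw [e1, e2, e4, zpow_neg, zpow_natCast]
      have := hR0 i
      have := hF0 i
      field_simp

/-! ### Relations as exponents -/

theorem sum_mul_lVec {R : Type*} [CommRing R] (k : Fin μ) (g : Fin (μ + 2) → R) :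
    ∑ j, g j * (lVec k j : R) =
      g k.castSucc.castSucc - 2 * g k.succ.castSucc + g k.succ.succ := by
  have h : ∀ j, g j * (lVec k j : R) = (if j = k.castSucc.castSucc then g j else 0) -
      2 * (if j = k.succ.castSucc then g j else 0) + (if j = k.succ.succ then g j else 0) := by
    intro j
    simp only [lVec, Fin.ext_iff, Fin.val_castSucc, Fin.val_succ]
    split_ifs <;> first | omega | (push_cast; ring)
  simp only [h, Finset.sum_add_distrib, Finset.sum_sub_distrib, ← Finset.mul_sum,
    Finset.sum_ite_eq', Finset.mem_univ, if_true]

/-- The relation `∑ k, n_k l^{(k)}`. -/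
def relVec (n : Fin μ → ℕ) (j : Fin (μ + 2)) : ℤ := ∑ k, (n k : ℤ) * lVec k j

theorem sum_mul_relVec {R : Type*} [CommRing R] (n : Fin μ → ℕ) (g : Fin (μ + 2) → R) :
    ∑ j, g j * (relVec n j : R) = ∑ k, (n k : R) *
      (g k.castSucc.castSucc - 2 * g k.succ.castSucc + g k.succ.succ) := by
  simp only [← sum_mul_lVec, relVec, Int.cast_sum, Int.cast_mul, Int.cast_natCast, Finset.mul_sum]
  rw [Finset.sum_comm]
  exact Finset.sum_congr rfl fun k _ => Finset.sum_congr rfl fun j _ => by ring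

theorem sum_relVec (n : Fin μ → ℕ) : ∑ j, relVec n j = 0 := by
  have := sum_mul_relVec (R := ℤ) n fun _ => 1
  simpa using this

theorem sum_val_mul_relVec (n : Fin μ → ℕ) : ∑ j : Fin (μ + 2), (j : ℤ) * relVec n j = 0 := by
  have := sum_mul_relVec (R := ℤ) n fun j => (j : ℤ)
  refine this.trans (Finset.sum_eq_zero fun k _ => ?_)
  simp only [Fin.val_castSucc, Fin.val_succ]
  push_cast
  ring

/-- Pairing with l^{(k')} takes a second difference centred at k' + 1. The truncated function j ↦
max(k + 1 - j, 0) bends only at j = k + 1, so the pairing isolates n_k. -/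
theorem sum_sub_mul_relVec (n : Fin μ → ℕ) (k : Fin μ) :
    ∑ j : Fin (μ + 2), (((k : ℕ) + 1 - (j : ℕ) : ℕ) : ℤ) * relVec n j = n k := by
  have := sum_mul_relVec (R := ℤ) n fun j => (((k : ℕ) + 1 - (j : ℕ) : ℕ) : ℤ)
  refine this.trans ?_
  rw [Finset.sum_eq_single k]
  · simp only [Fin.val_castSucc, Fin.val_succ]
    have : (((k : ℕ) + 1 - (k : ℕ) : ℕ) : ℤ) - 2 * (((k : ℕ) + 1 - (k + 1 : ℕ) : ℕ) : ℤ) +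
      (((k : ℕ) + 1 - (k + 1 + 1 : ℕ) : ℕ) : ℤ) = 1 := by omega
    rw [this, mul_one]
  · intro k' _ hk
    have hk' : (k' : ℕ) ≠ k := fun h => hk (Fin.ext h)
    simp only [Fin.val_castSucc, Fin.val_succ]
    have : (((k : ℕ) + 1 - (k' : ℕ) : ℕ) : ℤ) - 2 * (((k : ℕ) + 1 - (k' + 1 : ℕ) : ℕ) : ℤ) +
      (((k : ℕ) + 1 - (k' + 1 + 1 : ℕ) : ℕ) : ℤ) = 0 := by omega
    rw [this, mul_zero]
  · simp

theorem relVec_injective : Function.Injective (relVec (μ := μ)) := fun n n' h => by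
  ext k
  have := sum_sub_mul_relVec n k
  rw [h, sum_sub_mul_relVec] at this
  exact_mod_cast this.symm

theorem relVec_zero : relVec (0 : Fin μ → ℕ) = 0 := by
  ext j; simp [relVec]

/-- An integral vector is determined by its positively truncated moments. -/
theorem eq_zero_of_truncated_moments {D : Fin (μ + 2) → ℤ}
    (h : ∀ p : ℕ, p ≤ μ + 2 → ∑ j : Fin (μ + 2), ((p - (j : ℕ) : ℕ) : ℤ) * D j = 0) : D = 0 := by
  ext i
  -- The indicator of j = i is the second difference in p of max(p - j, 0) at p = i. At i = 0 the
  -- truncated i - 1 is harmless because the term is 0 anyway.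
  have e : D i = ∑ j : Fin (μ + 2), (((i + 1 - (j : ℕ) : ℕ) : ℤ) - 2 * ((i - (j : ℕ) : ℕ) : ℤ) +
      ((i - 1 - (j : ℕ) : ℕ) : ℤ)) * D j := by
    rw [Finset.sum_eq_single i]
    · have : (((i : ℕ) + 1 - (i : ℕ) : ℕ) : ℤ) - 2 * (((i : ℕ) - (i : ℕ) : ℕ) : ℤ) +
        (((i : ℕ) - 1 - (i : ℕ) : ℕ) : ℤ) = 1 := by omega
      rw [this, one_mul]
    · intro j _ hj
      have hj' : (j : ℕ) ≠ i := fun h => hj (Fin.ext h)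
      have : (((i : ℕ) + 1 - (j : ℕ) : ℕ) : ℤ) - 2 * (((i : ℕ) - (j : ℕ) : ℕ) : ℤ) +
        (((i : ℕ) - 1 - (j : ℕ) : ℕ) : ℤ) = 0 := by omega
      rw [this, zero_mul]
    · simp
  rw [e]
  simp only [add_mul, sub_mul, mul_assoc, Finset.sum_add_distrib, Finset.sum_sub_distrib,
    ← Finset.mul_sum]
  rw [h _ (by omega), h _ (by omega), h _ (by omega)]
  rfl

/-- The multiplicity of l^{(k)} must be the truncated moment at p = k + 1, which is nonnegative by
assumption. For p ≥ μ + 1 the truncation is inactive, so both sides vanish by the two linear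
relations. -/
theorem exists_relVec_eq {D : Fin (μ + 2) → ℤ} (h0 : ∑ j, D j = 0)
    (h1 : ∑ j : Fin (μ + 2), (j : ℤ) * D j = 0)
    (hD : ∀ p : ℕ, 0 ≤ ∑ j : Fin (μ + 2), ((p - (j : ℕ) : ℕ) : ℤ) * D j) :
    ∃ n : Fin μ → ℕ, relVec n = D := by
  refine ⟨fun k => (∑ j : Fin (μ + 2), (((k : ℕ) + 1 - (j : ℕ) : ℕ) : ℤ) * D j).toNat, ?_⟩
  rw [← sub_eq_zero]
  refine eq_zero_of_truncated_moments fun p hp => ?_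
  have hlin : ∀ E : Fin (μ + 2) → ℤ, ∑ j, E j = 0 → ∑ j : Fin (μ + 2), (j : ℤ) * E j = 0 →
      μ + 1 ≤ p → ∑ j : Fin (μ + 2), ((p - (j : ℕ) : ℕ) : ℤ) * E j = 0 := by
    intro E e0 e1 hp
    have : ∀ j : Fin (μ + 2), ((p - (j : ℕ) : ℕ) : ℤ) * E j = p * E j - (j : ℤ) * E j := fun j => by
      rw [Nat.cast_sub (by omega)]; ring
    simp only [this, Finset.sum_sub_distrib, ← Finset.mul_sum, e0, e1]
    simp
  simp only [Pi.sub_apply, mul_sub, Finset.sum_sub_distrib]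
  rcases Nat.lt_or_ge μ p with hp | hp
  · rw [hlin _ (sum_relVec _) (sum_val_mul_relVec _) hp, hlin _ h0 h1 hp, sub_zero]
  cases p with
  | zero => simp
  | succ p =>
    have := sum_sub_mul_relVec (fun k : Fin μ =>
      (∑ j : Fin (μ + 2), (((k : ℕ) + 1 - (j : ℕ) : ℕ) : ℤ) * D j).toNat) ⟨p, by omega⟩
    rw [this, Int.toNat_of_nonneg (hD _), sub_self]

/-- The coefficient of `x ^ n` in the expansion of the negative logarithm of the `i`-th unit
factor. -/
def unitLogCoeff (i : Fin (μ + 2)) (n : Fin μ → ℕ) : ℂ :=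
  open Classical in
  if relVec n i < 0 ∧ ∀ j, j ≠ i → 0 ≤ relVec n j then logCoeff fun j => (relVec n j).toNat else 0

theorem prod_pow_xCoord {α : Fin (μ + 2) → ℂ} (hα : ∀ j, α j ≠ 0) (n : Fin μ → ℕ) :
    ∏ k, xCoord α k ^ n k = ∏ j, α j ^ relVec n j := by
  have e : ∀ j, α j = Complex.exp (Complex.log (α j)) := fun j => (Complex.exp_log (hα j)).symm
  have h1 : ∏ j, α j ^ relVec n j =
      Complex.exp (∑ j, Complex.log (α j) * (relVec n j : ℂ)) := by
    rw [Complex.exp_sum]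
    refine Finset.prod_congr rfl fun j _ => ?_
    rw [mul_comm, Complex.exp_int_mul, ← e]
  rw [h1, sum_mul_relVec, Complex.exp_sum]
  refine Finset.prod_congr rfl fun k _ => ?_
  rw [Complex.exp_nat_mul, Complex.exp_add, Complex.exp_sub, two_mul, Complex.exp_add, ← e, ← e,
    ← e, xCoord]
  have := hα k.succ.castSucc
  congr 1
  field_simp

/-- The series is reindexed: an exponent L ≠ 0 with L_i = 0 and mean index i corresponds to the
relation L - |L| e_i, whose only negative entry is the i-th. Since α_i = 1, that entry does not
affect the monomial. -/
theorem hasSum_unitLogCoeff {α : Fin (μ + 2) → ℂ} (hα : ∀ j, α j ≠ 0) {i : Fin (μ + 2)}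
    (hi : α i = 1) {A : ℂ}
    (h : HasSum (fun L : Fin (μ + 2) → ℕ => if ∑ j, (L j : ℤ) * ((j : ℤ) - (i : ℤ)) = 0 then
        logCoeff L * ∏ j, (if j = i then 0 else α j) ^ L j else 0) A) :
    HasSum (fun n => unitLogCoeff i n * ∏ k, xCoord α k ^ n k) A := by
  have hcond : ∀ n, unitLogCoeff i n * ∏ k, xCoord α k ^ n k ≠ 0 →
      relVec n i < 0 ∧ ∀ j, j ≠ i → 0 ≤ relVec n j := fun n hn => by
    by_contra hc
    exact hn (by rw [unitLogCoeff, if_neg hc, zero_mul])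
  refine (hasSum_iff_hasSum_of_ne_zero_bij (fun n j => (relVec n.1 j).toNat) ?_ ?_ ?_).1 h
  · rintro ⟨n, hn⟩ ⟨n', hn'⟩ hnn
    have c := hcond n hn
    have c' := hcond n' hn'
    have hj : ∀ j, j ≠ i → relVec n j = relVec n' j := fun j hj => by
      have := congrFun hnn j
      have h1 := c.2 j hj
      have h2 := c'.2 j hj
      simp only at this
      omega
    refine Subtype.ext (relVec_injective (funext fun j => ?_))
    by_cases hji : j = i
    · subst hji
      have s1 := sum_relVec n
      have s2 := sum_relVec n'
      rw [← Finset.add_sum_erase _ _ (Finset.mem_univ j)] at s1 s2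
      rw [Finset.sum_congr rfl fun l hl => hj l (Finset.ne_of_mem_erase hl)] at s1
      linarith
    · exact hj j hji
  · intro L hL
    rw [Function.mem_support] at hL
    have hL1 : ∑ j, (L j : ℤ) * ((j : ℤ) - (i : ℤ)) = 0 := by
      by_contra hc; exact hL (if_neg hc)
    rw [if_pos hL1] at hL
    have hL2 : L i = 0 := by
      by_contra hc
      refine hL (mul_eq_zero_of_right _ (Finset.prod_eq_zero (Finset.mem_univ i) ?_))
      rw [if_pos rfl, zero_pow hc]
    have hL3 : ∑ j, L j ≠ 0 := fun hc => hL (mul_eq_zero_of_left (by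
      rw [logCoeff, hc]; simp) _)
    set m : ℤ := ∑ j, (L j : ℤ) with hm
    have hm0 : 0 < m := by
      have : (0 : ℤ) < ((∑ j, L j : ℕ) : ℤ) := by exact_mod_cast Nat.pos_of_ne_zero hL3
      rwa [Nat.cast_sum] at this
    have hLi : ∑ j : Fin (μ + 2), (j : ℤ) * (L j : ℤ) = i * m := by
      simp only [mul_sub, Finset.sum_sub_distrib, ← Finset.sum_mul] at hL1
      rw [← hm] at hL1
      rw [Finset.sum_congr rfl fun (j : Fin (μ + 2)) _ => mul_comm (j : ℤ) (L j : ℤ)]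
      linarith
    have hsum : ∀ g : Fin (μ + 2) → ℤ, ∑ j, g j * ((L j : ℤ) - if j = i then m else 0) =
        ∑ j, g j * (L j : ℤ) - g i * m := fun g => by
      simp only [mul_sub, Finset.sum_sub_distrib, mul_ite, mul_zero, Finset.sum_ite_eq',
        Finset.mem_univ, if_true]
    obtain ⟨n, hn⟩ := exists_relVec_eq (D := fun j => (L j : ℤ) - if j = i then m else 0)
      (by
        have := hsum fun _ => 1
        simp only [one_mul] at this
        rw [this, ← hm, sub_self]) (by rw [hsum, hLi, sub_self]) fun p => by
        rw [hsum, sub_nonneg]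
        -- This is Jensen's inequality for the convex function max(p - j, 0): the weights L_j have
        -- mean index i.
        rcases Nat.lt_or_ge (i : ℕ) p with hp | hp
        · calc ((p - (i : ℕ) : ℕ) : ℤ) * m = ∑ j : Fin (μ + 2), ((p : ℤ) - (j : ℤ)) * (L j : ℤ) := by
                simp only [sub_mul, Finset.sum_sub_distrib, ← Finset.mul_sum, hLi, ← hm]
                rw [Nat.cast_sub hp.le]; ring
            _ ≤ _ := Finset.sum_le_sum fun j _ =>
                mul_le_mul_of_nonneg_right (by omega) (by positivity)
        · rw [Nat.sub_eq_zero_of_le hp, Nat.cast_zero, zero_mul]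
          exact Finset.sum_nonneg fun j _ => by positivity
    have hc : relVec n i < 0 ∧ ∀ j, j ≠ i → 0 ≤ relVec n j := by
      rw [hn]
      refine ⟨?_, fun j hj => ?_⟩
      · simp only [hL2, if_true]; push_cast; linarith
      · simp only [if_neg hj]; omega
    have hφ : (fun j => (relVec n j).toNat) = L := by
      ext j
      rw [hn]
      by_cases hj : j = i
      · subst hj; simp only [if_true, hL2]; push_cast; omega
      · simp only [if_neg hj]; omega
    refine ⟨⟨n, ?_⟩, hφ⟩
    rw [Function.mem_support, unitLogCoeff, if_pos hc, hφ]
    refine mul_ne_zero (left_ne_zero_of_mul hL) ?_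
    rw [prod_pow_xCoord hα]
    exact Finset.prod_ne_zero_iff.2 fun j _ => zpow_ne_zero _ (hα j)
  · rintro ⟨n, hn⟩
    have c := hcond n hn
    have hj : ∀ j, j ≠ i → ((relVec n j).toNat : ℤ) = relVec n j := fun j hj =>
      Int.toNat_of_nonneg (c.2 j hj)
    have e1 : ∑ j, ((relVec n j).toNat : ℤ) * ((j : ℤ) - (i : ℤ)) = 0 := by
      have : ∀ j, ((relVec n j).toNat : ℤ) * ((j : ℤ) - (i : ℤ)) =
          (j : ℤ) * relVec n j - i * relVec n j := fun j => by
        by_cases hji : j = i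
        · subst hji; ring
        · rw [hj j hji]; ring
      simp only [this, Finset.sum_sub_distrib, ← Finset.mul_sum, sum_relVec, sum_val_mul_relVec]
      simp
    simp only [e1, if_true]
    rw [unitLogCoeff, if_pos c, prod_pow_xCoord hα]
    congr 1
    refine Finset.prod_congr rfl fun j _ => ?_
    by_cases hji : j = i
    · subst hji
      rw [Int.toNat_of_nonpos c.1.le, hi, pow_zero, one_zpow]
    · rw [if_neg hji, ← zpow_natCast, hj j hji]

/-! ### The terms of the hypergeometric series -/

/-- Differentiating 1/Γ(s) = s/Γ(s+1) gives a recursion. The zero of 1/Γ at -m removes one of its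
terms, and the start at s = 0 is 1/Γ(1) = 1. -/
theorem deriv_inv_Gamma_neg_nat (m : ℕ) :
    deriv (fun s => (Complex.Gamma s)⁻¹) (-(m : ℂ)) = (-1) ^ m * m.factorial := by
  have hd := Complex.differentiable_one_div_Gamma
  have key : ∀ s, deriv (fun s => (Complex.Gamma s)⁻¹) s = (Complex.Gamma (s + 1))⁻¹ +
      s * deriv (fun s => (Complex.Gamma s)⁻¹) (s + 1) := fun s => by
    have h1 : HasDerivAt (fun s => s * (Complex.Gamma (s + 1))⁻¹)
        (1 * (Complex.Gamma (s + 1))⁻¹ + s * deriv (fun s => (Complex.Gamma s)⁻¹) (s + 1)) s :=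
      (hasDerivAt_id s).mul ((hd (s + 1)).hasDerivAt.comp_add_const s 1)
    rw [← funext Complex.one_div_Gamma_eq_self_mul_one_div_Gamma_add_one] at h1
    rw [h1.deriv, one_mul]
  induction m with
  | zero => rw [key]; simp
  | succ m ih =>
    have e : -((m + 1 : ℕ) : ℂ) + 1 = -m := by push_cast; ring
    rw [key, e, ih, Complex.Gamma_neg_nat_eq_zero, Nat.factorial_succ]
    push_cast
    ring

theorem inv_Gamma_one_add_of_nonneg {l : ℤ} (hl : 0 ≤ l) :
    (Complex.Gamma (1 + (l : ℂ)))⁻¹ = (l.toNat.factorial : ℂ)⁻¹ := by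
  obtain ⟨m, rfl⟩ := Int.eq_ofNat_of_zero_le hl
  rw [Int.cast_natCast, add_comm, Complex.Gamma_nat_eq_factorial, Int.toNat_natCast]

theorem one_add_intCast_of_neg {l : ℤ} (hl : l < 0) :
    1 + (l : ℂ) = -(((-l).toNat - 1 : ℕ) : ℂ) := by
  have : l = -(((-l).toNat - 1 : ℕ) : ℤ) - 1 := by omega
  conv_lhs => rw [this]
  push_cast
  ring

theorem inv_Gamma_one_add_of_neg {l : ℤ} (hl : l < 0) : (Complex.Gamma (1 + (l : ℂ)))⁻¹ = 0 := by
  rw [one_add_intCast_of_neg hl, Complex.Gamma_neg_nat_eq_zero, inv_zero]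

theorem exists_relVec_neg {n : Fin μ → ℕ} (hn : n ≠ 0) : ∃ j, relVec n j < 0 := by
  by_contra! h
  refine hn (relVec_injective ?_)
  rw [relVec_zero]
  ext j
  exact (Finset.sum_eq_zero_iff_of_nonneg fun j _ => h j).1 (sum_relVec n) j (Finset.mem_univ j)

theorem sum_lVec (k : Fin μ) : ∑ j, (lVec k j : ℂ) = 0 := by
  have := sum_mul_lVec (R := ℂ) k fun _ => 1
  simp only [one_mul] at this
  rw [this]; norm_num

/-- With |L| = m + 1 = -l_i, the multinomial coefficient divided by m + 1 is m! / ∏ l_j!. Its sign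
(-1)^{m+2} equals (-1)^m, so this matches the derivative of 1/Γ at -m times the other reciprocal
factorials. -/
theorem logCoeff_relVec {n : Fin μ → ℕ} {i : Fin (μ + 2)} (hi : relVec n i < 0)
    (hj : ∀ j, j ≠ i → 0 ≤ relVec n j) :
    logCoeff (fun j => (relVec n j).toNat) =
      (∏ j ∈ Finset.univ.erase i, (Complex.Gamma (1 + (relVec n j : ℂ)))⁻¹) *
        deriv (fun s => (Complex.Gamma s)⁻¹) (1 + (relVec n i : ℂ)) := by
  have hs : ∑ j, (relVec n j).toNat = (-relVec n i).toNat - 1 + 1 := by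
    have h1 := sum_relVec n
    rw [← Finset.add_sum_erase _ _ (Finset.mem_univ i)] at h1 ⊢
    have h2 : ((∑ j ∈ Finset.univ.erase i, (relVec n j).toNat : ℕ) : ℤ) =
        ∑ j ∈ Finset.univ.erase i, relVec n j := by
      rw [Nat.cast_sum]
      exact Finset.sum_congr rfl fun j hj' => Int.toNat_of_nonneg (hj j (Finset.ne_of_mem_erase hj'))
    omega
  have hm := Nat.multinomial_spec Finset.univ fun j => (relVec n j).toNat
  rw [← Finset.mul_prod_erase _ _ (Finset.mem_univ i), Int.toNat_of_nonpos hi.le,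
    Nat.factorial_zero, one_mul, hs] at hm
  rw [one_add_intCast_of_neg hi, deriv_inv_Gamma_neg_nat, logCoeff, hs]
  rw [Finset.prod_congr rfl fun j hj' =>
    inv_Gamma_one_add_of_nonneg (hj j (Finset.ne_of_mem_erase hj')), Finset.prod_inv_distrib]
  generalize (-relVec n i).toNat - 1 = m at *
  have hm' : (∏ j ∈ Finset.univ.erase i, ((relVec n j).toNat.factorial : ℂ)) *
      (Nat.multinomial Finset.univ fun j => (relVec n j).toNat : ℂ) =
        ((m : ℂ) + 1) * (m.factorial : ℂ) := by
    rw [Nat.factorial_succ] at hm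
    exact_mod_cast hm
  have hP : (∏ j ∈ Finset.univ.erase i, ((relVec n j).toNat.factorial : ℂ)) ≠ 0 :=
    Finset.prod_ne_zero_iff.2 fun j _ => Nat.cast_ne_zero.2 (Nat.factorial_ne_zero _)
  have hm1 : (m : ℂ) + 1 ≠ 0 := Nat.cast_add_one_ne_zero m
  push_cast
  rw [inv_mul_eq_div, eq_div_iff hP, div_mul_eq_mul_div, div_mul_eq_mul_div, div_eq_iff hm1]
  linear_combination (-1) ^ (m + 1 + 1) * hm'

theorem hasDerivAt_cCoeff (k : Fin μ) (n : Fin μ → ℕ) :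
    HasDerivAt (fun s : ℂ => cCoeff fun l => (n l : ℂ) + Pi.single (M := fun _ => ℂ) k s l)
      (∑ i, (∏ j ∈ Finset.univ.erase i, (Complex.Gamma (1 + (relVec n j : ℂ)))⁻¹) *
        (deriv (fun s => (Complex.Gamma s)⁻¹) (1 + (relVec n i : ℂ)) * (lVec k i : ℂ))) 0 := by
  have e : (fun s : ℂ => cCoeff fun l => (n l : ℂ) + Pi.single (M := fun _ => ℂ) k s l) =
      fun s : ℂ => ∏ i, (Complex.Gamma (1 + (relVec n i : ℂ) + s * (lVec k i : ℂ)))⁻¹ := by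
    ext s
    refine Finset.prod_congr rfl fun i _ => ?_
    congr 2
    simp only [add_mul, Finset.sum_add_distrib, relVec, Int.cast_sum, Int.cast_mul,
      Int.cast_natCast, add_assoc]
    congr 2
    rw [Finset.sum_eq_single k]
    · rw [Pi.single_eq_same]
    · intro l _ hl; rw [Pi.single_eq_of_ne hl, zero_mul]
    · simp
  rw [e]
  have h : ∀ i : Fin (μ + 2), HasDerivAt
      (fun s : ℂ => (Complex.Gamma (1 + (relVec n i : ℂ) + s * (lVec k i : ℂ)))⁻¹)
      (deriv (fun s => (Complex.Gamma s)⁻¹) (1 + (relVec n i : ℂ)) * (lVec k i : ℂ)) 0 := fun i => by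
    have h1 : HasDerivAt (fun s : ℂ => 1 + (relVec n i : ℂ) + s * (lVec k i : ℂ))
        (lVec k i : ℂ) 0 := by
      simpa using ((hasDerivAt_id (0 : ℂ)).mul_const (lVec k i : ℂ)).const_add
        (1 + (relVec n i : ℂ))
    have h2 : HasDerivAt (fun s => (Complex.Gamma s)⁻¹)
        (deriv (fun s => (Complex.Gamma s)⁻¹) (1 + (relVec n i : ℂ)))
        (1 + (relVec n i : ℂ) + 0 * (lVec k i : ℂ)) := by
      rw [zero_mul, add_zero]
      exact (Complex.differentiable_one_div_Gamma _).hasDerivAt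
    exact HasDerivAt.comp (h₂ := fun s => (Complex.Gamma s)⁻¹) (0 : ℂ) h2 h1
  have := HasDerivAt.fun_finsetProd (u := Finset.univ) fun i _ => h i
  simpa only [zero_mul, add_zero, smul_eq_mul] using this

/-- For n ≠ 0 the relation has a negative entry, so c(n) = 0 and the logarithmic term drops out. In
the product rule, differentiating the i-th factor contributes only if no other entry is negative.
For n = 0 the Γ'(1) terms cancel since the entries of l^{(k)} sum to 0, leaving log x_k. -/
theorem wTermD_eq {x : Fin μ → ℂ} (hx : ∀ k, x k ≠ 0) (k : Fin μ) (n : Fin μ → ℕ) :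
    wTermD k x n = (if n = 0 then Complex.log (x k) else 0) +
      ∑ i, (lVec k i : ℂ) * (unitLogCoeff i n * ∏ l, x l ^ n l) := by
  have hc := hasDerivAt_cCoeff k n
  have hp : HasDerivAt (fun s : ℂ => ∏ l, x l ^ ((n l : ℂ) + Pi.single (M := fun _ => ℂ) k s l))
      ((∏ l, x l ^ n l) * Complex.log (x k)) 0 := by
    have e : (fun s : ℂ => ∏ l, x l ^ ((n l : ℂ) + Pi.single (M := fun _ => ℂ) k s l)) =
        fun s : ℂ => (∏ l, x l ^ n l) * x k ^ s := by
      ext s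
      have : ∀ l, x l ^ ((n l : ℂ) + Pi.single (M := fun _ => ℂ) k s l) =
          x l ^ n l * if l = k then x k ^ s else 1 := fun l => by
        rw [Complex.cpow_add _ _ (hx l), Complex.cpow_natCast]
        split_ifs with h
        · subst h; rw [Pi.single_eq_same]
        · rw [Pi.single_eq_of_ne h, Complex.cpow_zero]
      simp only [this, Finset.prod_mul_distrib, Finset.prod_ite_eq', Finset.mem_univ, if_true]
    rw [e]
    have := (hasDerivAt_id (0 : ℂ)).const_cpow (c := x k) (Or.inl (hx k))
    simpa using this.const_mul (∏ l, x l ^ n l)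
  have h := hc.mul hp
  have e : wTermD k x n = deriv ((fun s : ℂ => cCoeff fun l => (n l : ℂ) +
      Pi.single (M := fun _ => ℂ) k s l) * fun s : ℂ => ∏ l, x l ^ ((n l : ℂ) +
      Pi.single (M := fun _ => ℂ) k s l)) 0 := rfl
  rw [e, h.deriv]
  have hp0 : ∏ l, x l ^ ((n l : ℂ) + Pi.single (M := fun _ => ℂ) k (0 : ℂ) l) = ∏ l, x l ^ n l := by
    simp
  have hc0 : (cCoeff fun l => (n l : ℂ) + Pi.single (M := fun _ => ℂ) k (0 : ℂ) l) =
      ∏ i, (Complex.Gamma (1 + (relVec n i : ℂ)))⁻¹ := by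
    simp [cCoeff, relVec]
  rw [hp0, hc0]
  by_cases hn : n = 0
  · subst hn
    have hu : ∀ i, unitLogCoeff i (0 : Fin μ → ℕ) = 0 := fun i => by
      rw [unitLogCoeff, if_neg]; rw [relVec_zero]; simp
    simp only [hu, relVec_zero, Pi.zero_apply, Int.cast_zero, add_zero, Complex.Gamma_one, inv_one,
      Finset.prod_const_one, one_mul, pow_zero, mul_one, if_true, mul_zero,
      Finset.sum_const_zero]
    rw [← Finset.mul_sum, sum_lVec, mul_zero, zero_add]
  · obtain ⟨j₀, hj₀⟩ := exists_relVec_neg hn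
    rw [Finset.prod_eq_zero (Finset.mem_univ j₀) (inv_Gamma_one_add_of_neg hj₀), zero_mul, add_zero,
      if_neg hn, zero_add, Finset.sum_mul]
    refine Finset.sum_congr rfl fun i _ => ?_
    rw [unitLogCoeff]
    split_ifs with hi
    · rw [logCoeff_relVec hi.1 hi.2]; ring
    · suffices h0 : ∏ j ∈ Finset.univ.erase i, (Complex.Gamma (1 + (relVec n j : ℂ)))⁻¹ = 0 by
        rw [h0]; ring
      obtain ⟨j, hj, hj'⟩ : ∃ j, j ≠ i ∧ relVec n j < 0 := by
        by_contra! hc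
        refine hi ⟨?_, hc⟩
        by_cases h : j₀ = i
        · rwa [← h]
        · exact absurd (hc j₀ h) (not_le.2 hj₀)
      exact Finset.prod_eq_zero (Finset.mem_erase.2 ⟨hj, Finset.mem_univ j⟩)
        (inv_Gamma_one_add_of_neg hj')

/-! ### The sum of the hypergeometric series -/

theorem hasSum_wTermD {q : Fin μ → ℂ} {κ : ℝ} (hκ : 0 < κ) (hκ1 : κ * (4 * (μ + 2)) ≤ 1)
    (h0 : ∀ k, q k ≠ 0) (hq : ∀ k, ‖q k‖ ≤ κ ^ 2) (hF : ∀ i, ‖unitFactor q i - 1‖ ≤ 1 / 4)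
    (hx : ∀ k, mirrorMap q k ≠ 0) (k : Fin μ) :
    HasSum (wTermD k (mirrorMap q)) (Complex.log (mirrorMap q k) +
      ∑ i, (lVec k i : ℂ) * -Complex.log (unitFactor q i)) := by
  have h1 : ∀ i, HasSum (fun n : Fin μ → ℕ => unitLogCoeff i n * ∏ l, mirrorMap q l ^ n l)
      (-Complex.log (unitFactor q i)) := fun i => by
    obtain ⟨α, hα, hi, hαx, h⟩ := hasSum_logCoeff_unitFactor hκ hκ1 h0 hq hF i
    rw [← hαx]
    exact hasSum_unitLogCoeff hα hi h
  have h2 : HasSum (fun n : Fin μ → ℕ => if n = 0 then Complex.log (mirrorMap q k) else 0)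
      (Complex.log (mirrorMap q k)) := hasSum_ite_eq 0 _
  have h3 := h2.add (hasSum_sum fun (i : Fin (μ + 2)) (_ : i ∈ Finset.univ) =>
    (h1 i).mul_left (lVec k i : ℂ))
  exact h3.congr_fun fun n => wTermD_eq hx k n

/-- Near the large complex structure limit the hypergeometric series converge and invert the
mirror map. -/
theorem exists_radius_hypergeometric (μ : ℕ) :
    ∃ ε : ℝ, 0 < ε ∧ ∀ x₀ : Fin μ → ℂ, (∀ k, x₀ k ≠ 0 ∧ ‖x₀ k‖ < ε) →
      (∀ k, Summable (wTermD k x₀)) ∧ expQ (w x₀) ∈ qSpace μ ∧ mirrorMap (expQ (w x₀)) = x₀ ∧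
      ((∀ k, x₀ k ∈ Complex.slitPlane) → IsMirrorBranchAt w x₀) := by
  obtain ⟨ψ, hψ, hψ0, hψx⟩ := exists_inverse_mul_unitFactor μ
  obtain ⟨κ, hκ, hκ1⟩ : ∃ κ : ℝ, 0 < κ ∧ κ * (4 * (μ + 2)) ≤ 1 :=
    ⟨(4 * ((μ : ℝ) + 2))⁻¹, by positivity, (inv_mul_cancel₀ (by positivity)).le⟩
  have hκlt : κ ^ 2 < 1 := by
    have hμ : (0 : ℝ) ≤ μ := Nat.cast_nonneg μ
    have : κ < 1 := by nlinarith
    nlinarith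
  have hF : ∀ᶠ x in 𝓝 0, ∀ i, ‖unitFactor (ψ x) i - 1‖ < 1 / 4 := by
    refine eventually_all.2 fun i => ?_
    have hc : ContinuousAt (fun x => ‖unitFactor (ψ x) i - 1‖) 0 := by
      refine ((ContinuousAt.comp (g := fun q => unitFactor q i) ?_ hψ.continuousAt).sub
        continuousAt_const).norm
      exact (analyticAt_unitFactor _ i).continuousAt
    refine hc.eventually (gt_mem_nhds ?_)
    simp only [hψ0, unitFactor_zero]; norm_num
  have hq : ∀ᶠ x in 𝓝 0, ∀ k, ‖ψ x k‖ < κ ^ 2 := by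
    refine eventually_all.2 fun k => ?_
    have hc : ContinuousAt (fun x => ‖ψ x k‖) 0 :=
      ((analyticAt_pi_iff.1 hψ k).continuousAt).norm
    refine hc.eventually (gt_mem_nhds ?_)
    simp only [hψ0, Pi.zero_apply, norm_zero]; positivity
  -- In the sup norm the coordinatewise bound by ε describes a ball about 0. The local inverse ψ is
  -- controlled on all of it, including the hyperplanes where the mirror map itself is not used.
  obtain ⟨ε, hε, H⟩ := Metric.eventually_nhds_iff.1
    ((hψ.eventually_analyticAt.and hψx).and (hF.and hq))
  have hε' : ∀ x : Fin μ → ℂ, (∀ k, x k ≠ 0 ∧ ‖x k‖ < ε) → dist x 0 < ε := fun x hx => by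
    rw [dist_zero_right, pi_norm_lt_iff hε]; exact fun k => (hx k).2
  have hu0 : ∀ x : Fin μ → ℂ, (∀ k, x k ≠ 0 ∧ ‖x k‖ < ε) → ∀ i, unitFactor (ψ x) i ≠ 0 :=
    fun x hx i => ne_zero_of_norm_sub_one_lt (((H (hε' x hx)).2.1 i).trans (by norm_num))
  have hψne : ∀ x : Fin μ → ℂ, (∀ k, x k ≠ 0 ∧ ‖x k‖ < ε) → ∀ k, ψ x k ≠ 0 := fun x hx k =>
    left_ne_zero_of_mul (by rw [(H (hε' x hx)).1.2 k]; exact (hx k).1)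
  have hmm : ∀ x : Fin μ → ℂ, (∀ k, x k ≠ 0 ∧ ‖x k‖ < ε) → mirrorMap (ψ x) = x := fun x hx => by
    ext k
    rw [mirrorMap_eq_mul_unitFactor (hψne x hx), (H (hε' x hx)).1.2 k]
  have hsum : ∀ x : Fin μ → ℂ, (∀ k, x k ≠ 0 ∧ ‖x k‖ < ε) → ∀ k, HasSum (wTermD k x)
      (Complex.log (x k) + ∑ i, (lVec k i : ℂ) * -Complex.log (unitFactor (ψ x) i)) :=
    fun x hx k => by
      have := hasSum_wTermD hκ hκ1 (hψne x hx) (fun k => ((H (hε' x hx)).2.2 k).le)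
        (fun i => ((H (hε' x hx)).2.1 i).le) (by rw [hmm x hx]; exact fun k => (hx k).1) k
      rwa [hmm x hx] at this
  have hw : ∀ x : Fin μ → ℂ, (∀ k, x k ≠ 0 ∧ ‖x k‖ < ε) → w x = fun k =>
      (2 * Real.pi * Complex.I)⁻¹ * (Complex.log (x k) +
        ∑ i, (lVec k i : ℂ) * -Complex.log (unitFactor (ψ x) i)) := fun x hx => by
    ext k
    rw [w, (hsum x hx k).tsum_eq]
  have hexp : ∀ x : Fin μ → ℂ, (∀ k, x k ≠ 0 ∧ ‖x k‖ < ε) → expQ (w x) = ψ x := fun x hx => by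
    ext k
    simp only [expQ, hw x hx]
    rw [mul_inv_cancel_left₀ two_pi_I_ne_zero]
    -- The exponential of the second difference of the -log u_i divides x_k by u_k u_{k+2} /
    -- u_{k+1}² (indices from 0), which leaves ψ_k(x).
    rw [Finset.sum_congr rfl fun i _ => mul_comm (lVec k i : ℂ) _, sum_mul_lVec]
    have hu := hu0 x hx
    rw [Complex.exp_add, Complex.exp_log (hx k).1, Complex.exp_add, Complex.exp_sub, two_mul,
      Complex.exp_add, Complex.exp_neg, Complex.exp_neg, Complex.exp_neg, Complex.exp_log (hu _),
      Complex.exp_log (hu _), Complex.exp_log (hu _), ← (H (hε' x hx)).1.2 k]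
    have h1 := hu k.castSucc.castSucc
    have h2 := hu k.succ.castSucc
    have h3 := hu k.succ.succ
    generalize unitFactor (ψ x) k.castSucc.castSucc = A at *
    generalize unitFactor (ψ x) k.succ.castSucc = B at *
    generalize unitFactor (ψ x) k.succ.succ = C at *
    field_simp
  have hmem : ∀ x : Fin μ → ℂ, (∀ k, x k ≠ 0 ∧ ‖x k‖ < ε) →
      expQ (w x) ∈ qSpace μ ∧ mirrorMap (expQ (w x)) = x := fun x hx => by
    rw [hexp x hx]
    exact ⟨mem_qSpace_of_norm_lt (hψne x hx) (fun k => ((H (hε' x hx)).2.2 k).trans hκlt)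
      (hu0 x hx), hmm x hx⟩
  refine ⟨ε, hε, fun x₀ hx₀ => ⟨fun k => (hsum x₀ hx₀ k).summable, (hmem x₀ hx₀).1,
    (hmem x₀ hx₀).2, fun hslit => ?_⟩⟩
  have hnear : ∀ᶠ x in 𝓝 x₀, ∀ k, x k ≠ 0 ∧ ‖x k‖ < ε := by
    refine eventually_all.2 fun k => ?_
    have hc : ContinuousAt (fun x : Fin μ → ℂ => x k) x₀ := (continuous_apply k).continuousAt
    exact (hc.eventually_ne (hx₀ k).1).and (hc.norm.eventually (gt_mem_nhds (hx₀ k).2))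
  refine ⟨?_, hnear.mono hmem⟩
  refine AnalyticAt.congr (analyticAt_pi_iff.2 fun k => ?_)
    (hnear.mono fun x hx => (hw x hx).symm)
  refine analyticAt_const.mul (((analyticAt_apply _ _).clog (hslit k)).add
    (Finset.analyticAt_fun_sum _ fun i _ => analyticAt_const.mul (AnalyticAt.neg
      (AnalyticAt.clog (AnalyticAt.comp (g := fun q => unitFactor q i)
        (analyticAt_unitFactor _ i) (H (hε' x₀ hx₀)).1.1) ?_))))
  have := Complex.mem_slitPlane_of_norm_lt_one
    (((H (hε' x₀ hx₀)).2.1 i).trans (show (1 / 4 : ℝ) < 1 by norm_num))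
  rwa [add_sub_cancel] at this

theorem qSpace_nonempty (μ : ℕ) : (qSpace μ).Nonempty := by
  obtain ⟨ε, hε, h⟩ := exists_radius_hypergeometric μ
  refine ⟨_, (h (fun _ => ((ε / 2 : ℝ) : ℂ)) fun _ => ⟨?_, ?_⟩).2.1⟩
  · exact Complex.ofReal_ne_zero.2 (by positivity)
  · rw [Complex.norm_real, Real.norm_of_nonneg (by positivity)]; linarith

/-! ### Three roots -/

theorem permQ_swap_zero_one {q : Fin 2 → ℂ} :
    permQ (Equiv.swap 0 1) q = ![1 / q 0, q 0 * q 1] := by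
  have h1 : Fin.partialProd q 1 = q 0 := by simpa using Fin.partialProd_succ q 0
  have h2 : Fin.partialProd q 2 = q 0 * q 1 := by simpa [h1] using Fin.partialProd_succ q 1
  have e2 : (Equiv.swap 0 1 : Equiv.Perm (Fin 3)) 2 = 2 := by decide
  ext k
  fin_cases k
  · simp [permQ, Equiv.swap_inv, h1]
  · simp [permQ, Equiv.swap_inv, e2, h2]

theorem permQ_swap_one_two {q : Fin 2 → ℂ} (hq : ∀ k, q k ≠ 0) :
    permQ (Equiv.swap 1 2) q = ![q 0 * q 1, 1 / q 1] := by
  have h1 : Fin.partialProd q 1 = q 0 := by simpa using Fin.partialProd_succ q 0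
  have h2 : Fin.partialProd q 2 = q 0 * q 1 := by simpa [h1] using Fin.partialProd_succ q 1
  have e0 : (Equiv.swap 1 2 : Equiv.Perm (Fin 3)) 0 = 0 := by decide
  have hq0 := hq 0
  ext k
  fin_cases k
  · simp [permQ, Equiv.swap_inv, e0, h2]
  · simp [permQ, Equiv.swap_inv, h1, h2]
    field_simp

theorem permW_swap_zero_one (v : Fin 2 → ℂ) :
    permW (Equiv.swap 0 1) v = ![-v 0, v 0 + v 1] := by
  have h1 : Fin.partialSum v 1 = v 0 := by simpa using Fin.partialSum_succ v 0
  have h2 : Fin.partialSum v 2 = v 0 + v 1 := by simpa [h1] using Fin.partialSum_succ v 1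
  have e2 : (Equiv.swap 0 1 : Equiv.Perm (Fin 3)) 2 = 2 := by decide
  ext k
  fin_cases k
  · simp [permW, Equiv.swap_inv, h1]
  · simp [permW, Equiv.swap_inv, e2, h2]

theorem permW_swap_one_two (v : Fin 2 → ℂ) :
    permW (Equiv.swap 1 2) v = ![v 0 + v 1, -v 1] := by
  have h1 : Fin.partialSum v 1 = v 0 := by simpa using Fin.partialSum_succ v 0
  have h2 : Fin.partialSum v 2 = v 0 + v 1 := by simpa [h1] using Fin.partialSum_succ v 1
  have e0 : (Equiv.swap 1 2 : Equiv.Perm (Fin 3)) 0 = 0 := by decide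
  ext k
  fin_cases k
  · simp [permW, Equiv.swap_inv, e0, h2]
  · simp [permW, Equiv.swap_inv, h1, h2]

theorem closure_swap_fin_three :
    Subgroup.closure {(Equiv.swap 0 1 : Equiv.Perm (Fin 3)), Equiv.swap 1 2} = ⊤ := by
  rw [Subgroup.eq_top_iff']
  intro σ
  have h1 := Subgroup.subset_closure (k := {(Equiv.swap 0 1 : Equiv.Perm (Fin 3)),
    Equiv.swap 1 2}) (Set.mem_insert _ _)
  have h2 := Subgroup.subset_closure (k := {(Equiv.swap 0 1 : Equiv.Perm (Fin 3)),
    Equiv.swap 1 2}) (Set.mem_insert_of_mem _ rfl)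
  have h : ∀ σ : Equiv.Perm (Fin 3), σ = 1 ∨ σ = Equiv.swap 0 1 ∨ σ = Equiv.swap 1 2 ∨
      σ = Equiv.swap 0 1 * Equiv.swap 1 2 ∨ σ = Equiv.swap 1 2 * Equiv.swap 0 1 ∨
      σ = Equiv.swap 0 1 * Equiv.swap 1 2 * Equiv.swap 0 1 := by decide
  rcases h σ with rfl | rfl | rfl | rfl | rfl | rfl
  · exact one_mem _
  · exact h1
  · exact h2
  · exact mul_mem h1 h2
  · exact mul_mem h2 h1
  · exact mul_mem (mul_mem h1 h2) h1

end LocalMirror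

end

/-! ### Assembly of the assertions -/

theorem proposition3p2 (μ : ℕ) (hμ : 1 ≤ μ) :
    -- the symmetric group on `μ + 1` letters acts freely on the `q`-space, which is path connected
    (∀ q ∈ LocalMirror.qSpace μ,
      (∀ σ : Equiv.Perm (Fin (μ + 1)), LocalMirror.permQ σ q ∈ LocalMirror.qSpace μ) ∧
      LocalMirror.permQ 1 q = q ∧
      (∀ σ τ : Equiv.Perm (Fin (μ + 1)),
        LocalMirror.permQ (σ * τ) q = LocalMirror.permQ σ (LocalMirror.permQ τ q)) ∧
      (∀ σ : Equiv.Perm (Fin (μ + 1)), LocalMirror.permQ σ q = q → σ = 1)) ∧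
    IsPathConnected (LocalMirror.qSpace μ) ∧
    -- the mirror map is a Galois covering with this group, with holomorphic local inverses
    (∃ h : Set.MapsTo LocalMirror.mirrorMap (LocalMirror.qSpace μ) (LocalMirror.xSpace μ),
      IsCoveringMap h.restrict ∧ Function.Surjective h.restrict) ∧
    (∀ q ∈ LocalMirror.qSpace μ, ∀ q' ∈ LocalMirror.qSpace μ,
      LocalMirror.mirrorMap q = LocalMirror.mirrorMap q' ↔
        ∃ σ : Equiv.Perm (Fin (μ + 1)), q' = LocalMirror.permQ σ q) ∧
    (∀ q ∈ LocalMirror.qSpace μ, ∃ W : (Fin μ → ℂ) → Fin μ → ℂ,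
      LocalMirror.IsMirrorBranchAt W (LocalMirror.mirrorMap q) ∧
      LocalMirror.expQ (W (LocalMirror.mirrorMap q)) = q) ∧
    -- the solutions of the GKZ system are the combinations of `1, log q_1, …, log q_μ`
    (∀ a ∈ LocalMirror.regularLocus μ, ∀ W : (Fin μ → ℂ) → Fin μ → ℂ,
      LocalMirror.IsMirrorBranchAt W (LocalMirror.xCoord a) →
      ∀ f : (Fin (μ + 2) → ℂ) → ℂ,
        LocalMirror.IsGKZSolutionAt f a ↔
          ∃! c : ℂ × (Fin μ → ℂ),
            f =ᶠ[𝓝 a] fun b => c.1 + ∑ k, c.2 k * W (LocalMirror.xCoord b) k) ∧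
    -- the hypergeometric series near the large complex structure limit, and their monodromy
    (∃ ε : ℝ, 0 < ε ∧ ∀ x₀ : Fin μ → ℂ, (∀ k, x₀ k ≠ 0 ∧ ‖x₀ k‖ < ε) →
      x₀ ∈ LocalMirror.xSpace μ ∧
      (∀ k, Summable (LocalMirror.wTermD k x₀)) ∧
      LocalMirror.expQ (LocalMirror.w x₀) ∈ LocalMirror.qSpace μ ∧
      LocalMirror.mirrorMap (LocalMirror.expQ (LocalMirror.w x₀)) = x₀ ∧
      ((∀ k, x₀ k ∈ Complex.slitPlane) →
        LocalMirror.IsMirrorBranchAt LocalMirror.w x₀ ∧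
        -- continuation along every path exists and remains an inverse of the mirror map
        (∀ (x₁ : Fin μ → ℂ) (γ : Path x₀ x₁), (∀ t, γ t ∈ LocalMirror.xSpace μ) →
          (∃ F, LocalMirror.IsContinuationAlong γ F ∧ F 0 =ᶠ[𝓝 x₀] LocalMirror.w) ∧
          (∀ F, LocalMirror.IsContinuationAlong γ F → F 0 =ᶠ[𝓝 x₀] LocalMirror.w →
            ∀ t, LocalMirror.IsMirrorBranchAt (F t) (γ t))) ∧
        -- along a loop: a permutation followed by an integral shift, and only a shift exactly
        -- when the loop lifts to a loop in the `q`-space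
        (∀ γ : Path x₀ x₀, (∀ t, γ t ∈ LocalMirror.xSpace μ) →
          ∀ F, LocalMirror.IsContinuationAlong γ F → F 0 =ᶠ[𝓝 x₀] LocalMirror.w →
            (∃! p : Equiv.Perm (Fin (μ + 1)) × (Fin μ → ℤ),
              F 1 =ᶠ[𝓝 x₀] fun x k =>
                LocalMirror.permW p.1 (LocalMirror.w x) k + (p.2 k : ℂ)) ∧
            ((∃ δ : Path (LocalMirror.expQ (LocalMirror.w x₀))
                (LocalMirror.expQ (LocalMirror.w x₀)),
                ∀ t, δ t ∈ LocalMirror.qSpace μ ∧ LocalMirror.mirrorMap (δ t) = γ t) ↔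
              ∃ n : Fin μ → ℤ,
                F 1 =ᶠ[𝓝 x₀] fun x k => LocalMirror.w x k + (n k : ℂ))) ∧
        -- every permutation and every integral shift occur
        (∀ (σ : Equiv.Perm (Fin (μ + 1))) (n : Fin μ → ℤ),
          ∃ γ : Path x₀ x₀, (∀ t, γ t ∈ LocalMirror.xSpace μ) ∧
            ∃ F, LocalMirror.IsContinuationAlong γ F ∧ F 0 =ᶠ[𝓝 x₀] LocalMirror.w ∧
              F 1 =ᶠ[𝓝 x₀] fun x k =>
                LocalMirror.permW σ (LocalMirror.w x) k + (n k : ℂ)))) ∧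
    -- the residual action on `q` induced by the action on `w`
    (∀ (σ : Equiv.Perm (Fin (μ + 1))) (v : Fin μ → ℂ) (n : Fin μ → ℤ),
      LocalMirror.expQ (fun k => LocalMirror.permW σ v k + (n k : ℂ)) =
        LocalMirror.permQ σ (LocalMirror.expQ v)) ∧
    -- the example `μ = 2`: the reflections `r_1 = (0 1)` and `r_2 = (1 2)`
    ((∀ q : Fin 2 → ℂ, (∀ k, q k ≠ 0) →
        LocalMirror.permQ (Equiv.swap 0 1) q = ![1 / q 0, q 0 * q 1] ∧
        LocalMirror.permQ (Equiv.swap 1 2) q = ![q 0 * q 1, 1 / q 1]) ∧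
      (∀ v : Fin 2 → ℂ,
        LocalMirror.permW (Equiv.swap 0 1) v = ![-v 0, v 0 + v 1] ∧
        LocalMirror.permW (Equiv.swap 1 2) v = ![v 0 + v 1, -v 1]) ∧
      (Equiv.swap 0 1 : Equiv.Perm (Fin 3)) ^ 2 = 1 ∧
      (Equiv.swap 1 2 : Equiv.Perm (Fin 3)) ^ 2 = 1 ∧
      ((Equiv.swap 0 1 : Equiv.Perm (Fin 3)) * Equiv.swap 1 2) ^ 3 = 1 ∧
      Subgroup.closure {(Equiv.swap 0 1 : Equiv.Perm (Fin 3)), Equiv.swap 1 2} = ⊤) := by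
  open LocalMirror in
  refine ⟨fun q hq => ⟨permQ_mem_qSpace hq, permQ_one hq.1, permQ_mul hq.1,
      fun σ h => eq_one_of_permQ_eq hq h⟩, isPathConnected_qSpace (qSpace_nonempty μ),
    ⟨mirrorMap_mapsTo, isCoveringMap_mirrorMap, surjective_mirrorMap⟩,
    fun q hq q' hq' => mirrorMap_eq_iff hq hq', fun q hq => ?_,
    fun a ha W hW f => isGKZSolutionAt_iff ha hW f, ?_, expQ_permW_add_int,
    fun q hq => ⟨permQ_swap_zero_one, permQ_swap_one_two hq⟩,
    fun v => ⟨permW_swap_zero_one v, permW_swap_one_two v⟩, by decide, by decide, by decide,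
    closure_swap_fin_three⟩
  · obtain ⟨v, rfl⟩ := LocalMirror.exists_expQ_eq hq.1
    obtain ⟨W, hW, hWv, -⟩ := LocalMirror.exists_mirrorBranch hq
    exact ⟨W, hW, by rw [hWv]⟩
  · obtain ⟨ε, hε, H⟩ := LocalMirror.exists_radius_hypergeometric μ
    refine ⟨ε, hε, fun x₀ hx₀ => ?_⟩
    obtain ⟨hs, hq, hx, hb⟩ := H x₀ hx₀
    refine ⟨hx ▸ LocalMirror.mirrorMap_mapsTo hq, hs, hq, hx, fun hslit => ?_⟩
    have hw := hb hslit
    refine ⟨hw, fun x₁ γ hγ => ⟨?_, fun F hF h0 => (hw.continuation hγ hF h0).1⟩,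
      fun γ hγ F hF h0 => ⟨hw.existsUnique_monodromy hγ hF h0, hw.lift_loop_iff hγ hF h0⟩,
      hw.exists_loop⟩
    obtain ⟨F, hF, h0, -⟩ := hw.exists_continuation γ hγ
    exact ⟨F, hF, h0⟩
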